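/- **Setting.** For every $n$ let $X=X_n$ be a deterministic real $n\times p$ matrix ($p=p_n$) with $X'X$ invertible, let $\beta=\beta_n\in\mathbb R^p$, and let $Y=X\beta+\varepsilon$ with $\varepsilon_i=\sigma_i\xi_i$, $i=1,\dots,n$, where $\sigma_i=\sigma_{n,i}\ge 0$ are deterministic and, for each $n$, $\xi_1,\dots,\xi_n$ are i.i.d. with a law $\mu$ that does not depend on $n$, is symmetric about $0$, and satisfies $\mathrm E\xi_1^2=1$, $\mathrm E|\xi_1|^8<\infty$. Put $M_k=\mathrm E\xi_1^k$ and $$\nu_4=M_4-3,\quad \nu_6=M_6-15M_4+30,\quad \nu_8=M_8-28M_6-35M_4^2+420M_4-630 .$$ Let $\hat\beta=(X'X)^{-1}X'Y$, $\hat\varepsilon=Y-X\hat\beta$, and $$T=\frac{\sum_{i=1}^n\bigl(\hat\varepsilon_i^2-\frac1n\sum_{j=1}^n\hat\varepsilon_j^2\bigr)^2}{\frac1n\bigl(\sum_{i=1}^n\hat\varepsilon_i^2\bigr)^2}.$$ Let $P=I_n-X(X'X)^{-1}X'$, $D=\mathrm{diag}(\sigma_1,\dots,\sigma_n)$, $A=PD$,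 $B=AA'$. Write $\circ$ for the Hadamard product, $M^{\circ k}$ for the $k$-th Hadamard power, $M^k$ for the usual matrix power, $\mathrm{Diag}(M)$ for the vector of diagonal entries of $M$, $D_M$ for the diagonal matrix with the same diagonal as $M$, and $\mathbf 1=(1,\dots,1)'$; below, $\mathrm{tr}\,M^k$ is the trace of $M^k$. Define $$m_1=3\,\mathrm{tr}(B\circ B)+\nu_4\,\mathrm{tr}\bigl((A\circ A)'(A\circ A)\bigr),\qquad m_2=\tfrac1n\bigl((\mathrm{tr}B)^2+2\,\mathrm{tr}B^2+\nu_4\,\mathrm{tr}(A'A\circ A'A)\bigr),$$ $$\begin{aligned}\Theta_{11}={}&72\,\mathrm{Diag}(B)'(B\circ B)\mathrm{Diag}(B)+24\,\mathrm{tr}(B\circ B)^2+\nu_4\bigl(96\,\mathrm{tr}(BD_BA(A^{\circ3})')+72\,\mathrm{tr}((B\circ B)(A\circ A)(A\circ A)')\\&+36\,\mathrm{Diag}(B)'(A\circ A)(A\circ A)'\mathrm{Diag}(B)\bigr)+\nu_4^2\bigl(18\,\mathrm{tr}((A\circ A)(A\circ A)')^2+16\,\mathrm{tr}(A^{\circ3}A')^2\bigr)\\&+\nu_6\bigl(12\,\mathrm{tr}((A'D_BA)\circ((A^{\circ2})'A^{\circ2}))+16\,\mathrm{tr}(BA^{\circ3}(A^{\circ3})')\bigr)+\nu_8\,\mathbf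 1'A^{\circ4}(A^{\circ4})'\mathbf 1,\end{aligned}$$ $$\Theta_{22}=\frac{8(\mathrm{tr}B)^2\mathrm{tr}B^2+4\nu_4\,\mathrm{tr}(A'A\circ A'A)(\mathrm{tr}B)^2}{n^2},$$ $$\Theta_{12}=\Theta_{21}=\frac{\mathrm{tr}B}{n}\Bigl(24\,\mathrm{tr}(B^2\circ B)+16\nu_4\,\mathrm{tr}(BA(A^{\circ3})')+12\nu_4\,\mathrm{tr}((A'D_BA)\circ(A'A))+2\nu_6\,\mathrm{Diag}(A'A)'(A^{\circ4})'\mathbf 1\Bigr),$$ $$a=\frac{m_1}{m_2}-1,\qquad \Delta=\Bigl(\frac1{m_2},-\frac{m_1}{m_2^2}\Bigr)',\qquad b=\Delta'\Theta\Delta .$$ **Theorem 1.** Suppose that $p/n\to y\in[0,1)$ as $n\to\infty$, that $\sup_{n,i}\sigma_{n,i}<\infty$ and $\liminf_n \frac1n\mathrm{tr}(AA')>0$ (both automatic if the $\sigma_{n,i}$ are bounded away from $0$ and $\infty$, in particular if they all equal one constant $\sigma>0$), and that at least one of the following nondegeneracy conditions holds: (i) $|\xi_1|$ is not almost surely confined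 to a set of at most two values; (ii) $\liminf_n n\,b>0$. Then, without assuming homoscedasticity, $$\frac{T-a}{\sqrt b}\ \xrightarrow{\ d\ }\ N(0,1).$$ Moreover, for every $n$ for which $\sigma_{n,1}=\dots=\sigma_{n,n}=\sigma$ with $\sigma>0$ (that is, under $H_0$), the constants $a$ and $b$ are equal to $$a=\frac{n\bigl(3\,\mathrm{tr}(P\circ P)+\nu_4\,\mathrm{tr}(P\circ P)^2\bigr)}{(n-p)^2+2(n-p)+\nu_4\,\mathrm{tr}(P\circ P)}-1,\qquad b=\Delta'\Theta\Delta,$$ with $$\Delta'=\Bigl(\tfrac{n}{(n-p)^2+2(n-p)+\nu_4\mathrm{tr}(P\circ P)},\ -\tfrac{n^2(3\mathrm{tr}(P\circ P)+\nu_4\mathrm{tr}(P\circ P)^2)}{((n-p)^2+2(n-p)+\nu_4\mathrm{tr}(P\circ P))^2}\Bigr),$$ $$\begin{aligned}\Theta_{11}={}&72\,\mathrm{Diag}(P)'(P\circ P)\mathrm{Diag}(P)+24\,\mathrm{tr}(P\circ P)^2+\nu_4\bigl(96\,\mathrm{tr}(PD_PPP^{\circ3})+72\,\mathrm{tr}(P\circ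 P)^3\\&+36\,\mathrm{Diag}(P)'(P\circ P)^2\mathrm{Diag}(P)\bigr)+\nu_4^2\bigl(18\,\mathrm{tr}(P\circ P)^4+16\,\mathrm{tr}(P^{\circ3}P)^2\bigr)\\&+\nu_6\bigl(12\,\mathrm{tr}((PD_PP)\circ(P^{\circ2}P^{\circ2}))+16\,\mathrm{tr}(PP^{\circ3}P^{\circ3})\bigr)+\nu_8\,\mathbf 1'P^{\circ4}P^{\circ4}\mathbf 1,\end{aligned}$$ $$\Theta_{22}=\frac{8(n-p)^3+4\nu_4(n-p)^2\,\mathrm{tr}(P\circ P)}{n^2},$$ $$\Theta_{12}=\Theta_{21}=\frac{n-p}{n}\Bigl(24\,\mathrm{tr}(P\circ P)+16\nu_4\,\mathrm{tr}(PP^{\circ3})+12\nu_4\,\mathrm{tr}((PD_PP)\circ P)+2\nu_6\,\mathrm{Diag}(P)'P^{\circ4}\mathbf 1\Bigr).$$ -/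

import Mathlib

open Filter Topology MeasureTheory ProbabilityTheory
open scoped Matrix

namespace Homoscedasticity

noncomputable section

/-! ### Ordinary least squares and the coefficient-of-variation statistic -/

/-- The response vector `Y = X β + ε`. -/
def response {n p : ℕ} (X : Matrix (Fin n) (Fin p) ℝ) (β : Fin p → ℝ) (ε : Fin n → ℝ) :
    Fin n → ℝ :=
  X *ᵥ β + ε

/-- The OLS estimator `(X' X)⁻¹ X' Y`. -/
def olsEstimator {n p : ℕ} (X : Matrix (Fin n) (Fin p) ℝ) (Y : Fin n → ℝ) : Fin p → ℝ :=
  (Xᵀ * X)⁻¹ *ᵥ (Xᵀ *ᵥ Y)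

/-- The OLS residuals `Y - X β̂`. -/
def residual {n p : ℕ} (X : Matrix (Fin n) (Fin p) ℝ) (Y : Fin n → ℝ) : Fin n → ℝ :=
  Y - X *ᵥ olsEstimator X Y

/-- The coefficient-of-variation statistic of a vector `e` of residuals. -/
def cvStat {n : ℕ} (e : Fin n → ℝ) : ℝ :=
  (∑ i, (e i ^ 2 - (1 / (n : ℝ)) * ∑ j, e j ^ 2) ^ 2) /
    ((1 / (n : ℝ)) * (∑ i, e i ^ 2) ^ 2)

/-- The projection matrix `P = I - X (X' X)⁻¹ X'`. -/
def projMat {n p : ℕ} (X : Matrix (Fin n) (Fin p) ℝ) : Matrix (Fin n) (Fin n) ℝ :=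
  1 - X * (Xᵀ * X)⁻¹ * Xᵀ

/-- The matrix `A = P D`, where `D` is the diagonal matrix of the standard deviations. -/
def scaledProj {n p : ℕ} (X : Matrix (Fin n) (Fin p) ℝ) (σ : Fin n → ℝ) :
    Matrix (Fin n) (Fin n) ℝ :=
  projMat X * Matrix.diagonal σ

/-! ### Cumulants of a symmetric law with unit variance -/

/-- The `k`-th moment of the law `μ`. -/
def lawMoment (μ : Measure ℝ) (k : ℕ) : ℝ := ∫ x, x ^ k ∂μ

/-- Fourth cumulant. -/
def nu4 (μ : Measure ℝ) : ℝ := lawMoment μ 4 - 3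

/-- Sixth cumulant. -/
def nu6 (μ : Measure ℝ) : ℝ := lawMoment μ 6 - 15 * lawMoment μ 4 + 30

/-- Eighth cumulant. -/
def nu8 (μ : Measure ℝ) : ℝ :=
  lawMoment μ 8 - 28 * lawMoment μ 6 - 35 * lawMoment μ 4 ^ 2 + 420 * lawMoment μ 4 - 630

/-! ### Matrix notions -/

/-- The `k`-th Hadamard power of a matrix. -/
def hpow {n : ℕ} (A : Matrix (Fin n) (Fin n) ℝ) (k : ℕ) : Matrix (Fin n) (Fin n) ℝ :=
  Matrix.of fun i j => A i j ^ k

/-- The diagonal part of a matrix, as a matrix. -/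
def diagPart {n : ℕ} (A : Matrix (Fin n) (Fin n) ℝ) : Matrix (Fin n) (Fin n) ℝ :=
  Matrix.diagonal A.diag

/-! ### Centering and variance in the general (heteroscedastic) model, in terms of `A`

With `ê = A ξ`, these are the mean of `T₁ = ∑ ê i ^ 4`, the mean of `T₂ = (∑ ê i ^ 2) ^ 2 / n`,
the variance of `T₁`, and the leading parts of the variance of `T₂` and of the covariance. -/

/-- `E T₁`. -/
def meanT1 {n : ℕ} (μ : Measure ℝ) (A : Matrix (Fin n) (Fin n) ℝ) : ℝ :=
  3 * ((A * Aᵀ) ⊙ (A * Aᵀ)).trace + nu4 μ * ((A ⊙ A)ᵀ * (A ⊙ A)).trace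

/-- `E T₂`. -/
def meanT2 {n : ℕ} (μ : Measure ℝ) (A : Matrix (Fin n) (Fin n) ℝ) : ℝ :=
  (n : ℝ)⁻¹ * ((A * Aᵀ).trace ^ 2 + 2 * ((A * Aᵀ) ^ 2).trace
    + nu4 μ * ((Aᵀ * A) ⊙ (Aᵀ * A)).trace)

/-- `Var T₁`. -/
def theta11 {n : ℕ} (μ : Measure ℝ) (A : Matrix (Fin n) (Fin n) ℝ) : ℝ :=
  let B := A * Aᵀ
  72 * (B.diag ⬝ᵥ ((B ⊙ B) *ᵥ B.diag)) + 24 * ((B ⊙ B) ^ 2).trace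
  + nu4 μ * (96 * (B * diagPart B * A * (hpow A 3)ᵀ).trace
      + 72 * ((B ⊙ B) * ((A ⊙ A) * (A ⊙ A)ᵀ)).trace
      + 36 * (B.diag ⬝ᵥ (((A ⊙ A) * (A ⊙ A)ᵀ) *ᵥ B.diag)))
  + nu4 μ ^ 2 * (18 * (((A ⊙ A) * (A ⊙ A)ᵀ) ^ 2).trace + 16 * ((hpow A 3 * Aᵀ) ^ 2).trace)
  + nu6 μ * (12 * ((Aᵀ * diagPart B * A) ⊙ ((hpow A 2)ᵀ * hpow A 2)).trace
      + 16 * (B * hpow A 3 * (hpow A 3)ᵀ).trace)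
  + nu8 μ * ((1 : Fin n → ℝ) ⬝ᵥ ((hpow A 4 * (hpow A 4)ᵀ) *ᵥ 1))

/-- Leading part of `Var T₂`. -/
def theta22 {n : ℕ} (μ : Measure ℝ) (A : Matrix (Fin n) (Fin n) ℝ) : ℝ :=
  (8 * (A * Aᵀ).trace ^ 2 * ((A * Aᵀ) ^ 2).trace
    + 4 * nu4 μ * ((Aᵀ * A) ⊙ (Aᵀ * A)).trace * (A * Aᵀ).trace ^ 2) / (n : ℝ) ^ 2

/-- Leading part of `Cov (T₁, T₂)`. -/
def theta12 {n : ℕ} (μ : Measure ℝ) (A : Matrix (Fin n) (Fin n) ℝ) : ℝ :=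
  let B := A * Aᵀ
  B.trace / (n : ℝ) *
    (24 * ((B ^ 2) ⊙ B).trace + 16 * nu4 μ * (B * A * (hpow A 3)ᵀ).trace
      + 12 * nu4 μ * ((Aᵀ * diagPart B * A) ⊙ (Aᵀ * A)).trace
      + 2 * nu6 μ * ((Aᵀ * A).diag ⬝ᵥ ((hpow A 4)ᵀ *ᵥ 1)))

/-- The centering constant `a = E T₁ / E T₂ - 1`. -/
def centering {n : ℕ} (μ : Measure ℝ) (A : Matrix (Fin n) (Fin n) ℝ) : ℝ :=
  meanT1 μ A / meanT2 μ A - 1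

/-- The gradient of `x / y - 1` at `(E T₁, E T₂)`. -/
def gradVec {n : ℕ} (μ : Measure ℝ) (A : Matrix (Fin n) (Fin n) ℝ) : Fin 2 → ℝ :=
  ![1 / meanT2 μ A, -(meanT1 μ A / meanT2 μ A ^ 2)]

/-- The variance constant `b = Δ' Θ Δ`. -/
def scaling {n : ℕ} (μ : Measure ℝ) (A : Matrix (Fin n) (Fin n) ℝ) : ℝ :=
  gradVec μ A ⬝ᵥ
    (!![theta11 μ A, theta12 μ A; theta12 μ A, theta22 μ A] *ᵥ gradVec μ A)

/-! ### The explicit constants under homoscedasticity, in terms of `P`, `n`, `p` -/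

/-- `3 tr (P ∘ P) + ν₄ tr (P ∘ P)²`. -/
def numH0 {n : ℕ} (μ : Measure ℝ) (P : Matrix (Fin n) (Fin n) ℝ) : ℝ :=
  3 * (P ⊙ P).trace + nu4 μ * ((P ⊙ P) ^ 2).trace

/-- `(n - p)² + 2 (n - p) + ν₄ tr (P ∘ P)`. -/
def denH0 {n : ℕ} (μ : Measure ℝ) (p : ℕ) (P : Matrix (Fin n) (Fin n) ℝ) : ℝ :=
  ((n : ℝ) - p) ^ 2 + 2 * ((n : ℝ) - p) + nu4 μ * (P ⊙ P).trace

/-- The constant `a` under homoscedasticity. -/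
def centeringH0 {n : ℕ} (μ : Measure ℝ) (p : ℕ) (P : Matrix (Fin n) (Fin n) ℝ) : ℝ :=
  (n : ℝ) * numH0 μ P / denH0 μ p P - 1

/-- The vector `Δ` under homoscedasticity. -/
def gradVecH0 {n : ℕ} (μ : Measure ℝ) (p : ℕ) (P : Matrix (Fin n) (Fin n) ℝ) : Fin 2 → ℝ :=
  ![(n : ℝ) / denH0 μ p P, -((n : ℝ) ^ 2 * numH0 μ P / denH0 μ p P ^ 2)]

/-- `Θ₁₁` under homoscedasticity. -/
def theta11H0 {n : ℕ} (μ : Measure ℝ) (P : Matrix (Fin n) (Fin n) ℝ) : ℝ :=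
  72 * (P.diag ⬝ᵥ ((P ⊙ P) *ᵥ P.diag)) + 24 * ((P ⊙ P) ^ 2).trace
  + nu4 μ * (96 * (P * diagPart P * P * hpow P 3).trace + 72 * ((P ⊙ P) ^ 3).trace
      + 36 * (P.diag ⬝ᵥ (((P ⊙ P) ^ 2) *ᵥ P.diag)))
  + nu4 μ ^ 2 * (18 * ((P ⊙ P) ^ 4).trace + 16 * ((hpow P 3 * P) ^ 2).trace)
  + nu6 μ * (12 * ((P * diagPart P * P) ⊙ (hpow P 2 * hpow P 2)).trace
      + 16 * (P * hpow P 3 * hpow P 3).trace)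
  + nu8 μ * ((1 : Fin n → ℝ) ⬝ᵥ ((hpow P 4 * hpow P 4) *ᵥ 1))

/-- `Θ₂₂` under homoscedasticity. -/
def theta22H0 {n : ℕ} (μ : Measure ℝ) (p : ℕ) (P : Matrix (Fin n) (Fin n) ℝ) : ℝ :=
  (8 * ((n : ℝ) - p) ^ 3 + 4 * nu4 μ * ((n : ℝ) - p) ^ 2 * (P ⊙ P).trace) / (n : ℝ) ^ 2

/-- `Θ₁₂ = Θ₂₁` under homoscedasticity. -/
def theta12H0 {n : ℕ} (μ : Measure ℝ) (p : ℕ) (P : Matrix (Fin n) (Fin n) ℝ) : ℝ :=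
  ((n : ℝ) - p) / n *
    (24 * (P ⊙ P).trace + 16 * nu4 μ * (P * hpow P 3).trace
      + 12 * nu4 μ * ((P * diagPart P * P) ⊙ P).trace
      + 2 * nu6 μ * (P.diag ⬝ᵥ (hpow P 4 *ᵥ 1)))

/-- The constant `b = Δ' Θ Δ` under homoscedasticity. -/
def scalingH0 {n : ℕ} (μ : Measure ℝ) (p : ℕ) (P : Matrix (Fin n) (Fin n) ℝ) : ℝ :=
  gradVecH0 μ p P ⬝ᵥ
    (!![theta11H0 μ P, theta12H0 μ p P; theta12H0 μ p P, theta22H0 μ p P] *ᵥ gradVecH0 μ p P)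

end

end Homoscedasticity

/-!
Put `A = P D`. The residuals are `A ξ`, and the statistic is `n T₄ / S² - 1` with the power sums
`S = ∑ (A ξ)ᵢ²` and `T₄ = ∑ (A ξ)ᵢ⁴`. Under `H₀` the constants reduce to those in terms of `P` because
`P` is a symmetric idempotent.

*Linearization.* Put `s = E S = tr B`, let `m₁` and `m₂` be the two means in the centering, and let
`W = T₄ - r S` with `r = 2 s m₁ / (n m₂)`. Since `n m₂ = s² + Var S` holds exactly,
`(T - a) / √b` equals `(n m₂ / S²) ((W - E W) - m₁ / (n m₂) ((S - s)² - Var S)) / √(Var W)`, provided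
that `b = Var W / m₂²` (`statistic_eq`). As `Var S = O(n)`, this is `(W - E W) / √(Var W)` up to an
error of order `1 / √n`, outside an event of small probability, as soon as `Var W` has at least the
order `n` (`abs_remainder_le`, `norm_charFun_statistic_sub_le`).

*The constants.* The identity `b = Var W / m₂²` is `scaling_eq`. Mixed moments of `(A ξ)ᵢ` and
`(A ξ)ⱼ` are polynomials in their joint cumulants, which are `κ ∑ₖ Aᵢₖˢ Aⱼₖᵗ` with `κ` the cumulant
of order `s + t` of the law (`HasCumulants`, `covariance_powSum`). So `Θ₁₁` is the variance of `T₄`,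
while the other entries of `Θ` are `Cov(T₄, S)` and `Var S` up to the factors `2 s / n` and
`(2 s / n)²`.

*Nondegeneracy.* If `|ξ|` takes at least three values, `ξ⁴` has a nonzero residual `ψ(ξ)` after
regression on `1` and `ξ²`. The projection of `W` to the span of the `ψ(ξₖ)` has variance
`Var ψ ∑ₖ (∑ᵢ Aᵢₖ⁴)²`, which is at least of order `n` (`exists_le_variance_quartic`,
`le_sum_sq_sum_pow_four`). Otherwise the lower bound for `Var W` is the second condition.

*Normal approximation of `W`.* For bounded variables (`exists_norm_charFun_quartic_sub_le`), write
`W - E W = ∑ Uₖ` where `Uₖ` has mean zero when integrated over `ξₖ` alone (`steinTerm`), and let `Vₖ`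
be the increment of `W` when `ξₖ` is reset to zero (`incTerm`). A Taylor expansion in `ξₖ` gives, for
the characteristic function `φ` of `(W - E W) / √n`, the approximate differential equation
`φ'(t) = -t (Var W / n) φ(t)`, with an error governed by `Var (∑ Vₖ Uₖ)` and `E Vₖ² |Uₖ|`. Both
`Uₖ` and `Vₖ` are sums of cubic polynomials of the `(A ξ)ᵢ`, and an Efron–Stein inequality shows that
`Var (∑ Vₖ Uₖ) = O(n^{3/2})` (`variance_pairForm_le`). Unbounded variables are truncated; the cumulant
formulas show that this changes `W` by a small multiple of `√n` in `L²`
(`exists_variance_sub_clamp_le`), so that eight moments suffice.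
-/


namespace Homoscedasticity

/-! ### Product measures: resetting one coordinate, and an Efron–Stein inequality -/

lemma indepFun_update_eval (ν : Measure ℝ) [IsProbabilityMeasure ν] {n : ℕ} (k : Fin n) :
    IndepFun (fun x : Fin n → ℝ => Function.update x k 0) (fun x => x k)
      (Measure.pi fun _ => ν) := by
  classical
  have h := iIndepFun_pi (μ := fun _ : Fin n => ν) (X := fun _ x => x)
    (fun _ => aemeasurable_id)
  have h2 := h.indepFun_finset (Finset.univ.erase k) {k} (by simp) (fun i => measurable_pi_apply i)
  have hφ : Measurable (fun (z : ↥(Finset.univ.erase k : Finset (Fin n)) → ℝ) (i : Fin n) =>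
      if hi : i ∈ (Finset.univ.erase k : Finset (Fin n)) then z ⟨i, hi⟩ else 0) := by
    refine measurable_pi_lambda _ fun i => ?_
    by_cases hi : i ∈ (Finset.univ.erase k : Finset (Fin n))
    · simp only [hi, dite_true]; exact measurable_pi_apply _
    · simp only [hi, dite_false]; exact measurable_const
  have hψ : Measurable (fun (z : ↥({k} : Finset (Fin n)) → ℝ) => z ⟨k, by simp⟩) :=
    measurable_pi_apply _
  have h3 := h2.comp hφ hψ
  convert h3 using 1
  · ext x i
    by_cases hi : i = k
    · subst hi; simp
    · simp [hi]
  · rfl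

/-- From a vector of pairs, the first components before position `k` and the second components
from position `k` on. -/
def mixAt {n : ℕ} (k : ℕ) (ω : Fin n → ℝ × ℝ) : Fin n → ℝ :=
  fun i => if i.val < k then (ω i).1 else (ω i).2

/-- Exchange the two components of the `k`-th pair. -/
def swapAt {n : ℕ} (k : Fin n) (ω : Fin n → ℝ × ℝ) : Fin n → ℝ × ℝ :=
  fun i => if i = k then (ω i).swap else ω i

section EfronStein

variable {n : ℕ} (ν : Measure ℝ) [IsProbabilityMeasure ν]

lemma measurePreserving_mixAt (k : ℕ) :
    MeasurePreserving (mixAt (n := n) k) (Measure.pi fun _ => ν.prod ν) (Measure.pi fun _ => ν) := by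
  have := measurePreserving_pi (fun _ : Fin n => ν.prod ν) (fun _ : Fin n => ν)
    (f := fun i p => if i.val < k then p.1 else p.2) (fun i => by
      by_cases h : i.val < k
      · simp only [h, if_true]; exact measurePreserving_fst
      · simp only [h, if_false]; exact measurePreserving_snd)
  exact this

lemma measurePreserving_swapAt (k : Fin n) :
    MeasurePreserving (swapAt k) (Measure.pi fun _ => ν.prod ν) (Measure.pi fun _ => ν.prod ν) := by
  have := measurePreserving_pi (fun _ : Fin n => ν.prod ν) (fun _ : Fin n => ν.prod ν)
    (f := fun i p => if i = k then p.swap else p) (fun i => by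
      by_cases h : i = k
      · simp only [h, if_true]; exact Measure.measurePreserving_swap
      · simp only [h, if_false]; exact MeasurePreserving.id _)
  exact this

lemma mixAt_swapAt (k : Fin n) (ω : Fin n → ℝ × ℝ) :
    mixAt k.val (swapAt k ω) = mixAt (k.val + 1) ω := by
  ext i
  by_cases h : i = k
  · subst h; simp [mixAt, swapAt]
  · have : i.val ≠ k.val := fun h' => h (Fin.ext h')
    simp only [mixAt, swapAt, h, if_false]
    have : i.val < k.val + 1 ↔ i.val < k.val := by omega
    simp [this]

lemma update_mixAt_swapAt (k : Fin n) (m : ℕ) (ω : Fin n → ℝ × ℝ) :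
    Function.update (mixAt m (swapAt k ω)) k 0 = Function.update (mixAt m ω) k 0 := by
  ext i
  by_cases h : i = k
  · subst h; simp
  · simp [mixAt, swapAt, h]

lemma update_mixAt_succ (k : Fin n) (ω : Fin n → ℝ × ℝ) :
    Function.update (mixAt (k.val + 1) ω) k 0 = Function.update (mixAt k.val ω) k 0 := by
  rw [← mixAt_swapAt, update_mixAt_swapAt]

lemma integral_mixAt_mul {F : (Fin n → ℝ) → ℝ} :
    ∫ ω, F (mixAt n ω) * F (mixAt 0 ω) ∂(Measure.pi fun _ : Fin n => ν.prod ν)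
      = (∫ x, F x ∂(Measure.pi fun _ : Fin n => ν)) ^ 2 := by
  have h := measurePreserving_arrowProdEquivProdArrow ℝ ℝ (Fin n) (fun _ => ν) (fun _ => ν)
  have h2 := h.integral_comp' (g := fun p : (Fin n → ℝ) × (Fin n → ℝ) => F p.1 * F p.2)
  rw [integral_prod_mul (μ := Measure.pi fun _ : Fin n => ν) (ν := Measure.pi fun _ : Fin n => ν) F F]
    at h2
  rw [sq, ← h2]
  refine integral_congr_ae (ae_of_all _ fun ω => ?_)
  have e1 : mixAt n ω = (MeasurableEquiv.arrowProdEquivProdArrow ℝ ℝ (Fin n) ω).1 := by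
    ext i; simp [mixAt, MeasurableEquiv.arrowProdEquivProdArrow, Equiv.arrowProdEquivProdArrow]
  have e2 : mixAt 0 ω = (MeasurableEquiv.arrowProdEquivProdArrow ℝ ℝ (Fin n) ω).2 := by
    ext i; simp [mixAt, MeasurableEquiv.arrowProdEquivProdArrow, Equiv.arrowProdEquivProdArrow]
  simp only [e1, e2]

/-- An Efron–Stein inequality: the variance of a function of independent variables is controlled by
the effects of resetting single variables to zero. The variance is a telescoping sum of differences
in which the variables are replaced by an independent copy one after the other; the difference in the
`k`-th variable is orthogonal to functions that do not depend on that variable. -/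
theorem variance_le_two_mul_sum_integral_sq_sub_update {F : (Fin n → ℝ) → ℝ}
    (hF : MemLp F 2 (Measure.pi fun _ => ν))
    (hFk : ∀ k, MemLp (fun x => F (Function.update x k 0)) 2 (Measure.pi fun _ => ν)) :
    Var[F; Measure.pi fun _ => ν] ≤
      2 * ∑ k, ∫ x, (F x - F (Function.update x k 0)) ^ 2 ∂(Measure.pi fun _ => ν) := by
  set Q : Measure (Fin n → ℝ × ℝ) := Measure.pi fun _ => ν.prod ν with hQ
  have mp := fun k => measurePreserving_mixAt (n := n) ν k
  have hL : ∀ k, MemLp (fun ω => F (mixAt k ω)) 2 Q := fun k => hF.comp_measurePreserving (mp k)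
  have hLk : ∀ (m : ℕ) (k : Fin n), MemLp (fun ω => F (Function.update (mixAt m ω) k 0)) 2 Q :=
    fun m k => (hFk k).comp_measurePreserving (mp m)
  have hii : ∀ k l, Integrable (fun ω => F (mixAt k ω) * F (mixAt l ω)) Q :=
    fun k l => (hL k).integrable_mul (hL l)
  have key : ∀ k : Fin n, ∫ ω, F (mixAt n ω) * (F (mixAt (k.val + 1) ω) - F (mixAt k.val ω)) ∂Q
      ≤ 2 * ∫ x, (F x - F (Function.update x k 0)) ^ 2 ∂(Measure.pi fun _ => ν) := by
    intro k
    set V : (Fin n → ℝ) → ℝ := fun x => F x - F (Function.update x k 0) with hV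
    have hVL : ∀ m, MemLp (fun ω => V (mixAt m ω)) 2 Q := fun m => (hL m).sub (hLk m k)
    -- exchanging the `k`-th variable with its copy leaves the first factor unchanged
    have hzero : ∫ ω, F (Function.update (mixAt n ω) k 0) *
        (F (mixAt (k.val + 1) ω) - F (mixAt k.val ω)) ∂Q = 0 := by
      have h1 : ∀ l, Integrable
          (fun ω => F (Function.update (mixAt n ω) k 0) * F (mixAt l ω)) Q :=
        fun l => (hLk n k).integrable_mul (hL l)
      have h2 : ∫ ω, F (Function.update (mixAt n ω) k 0) * F (mixAt (k.val + 1) ω) ∂Q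
          = ∫ ω, F (Function.update (mixAt n ω) k 0) * F (mixAt k.val ω) ∂Q := by
        have mps := measurePreserving_swapAt ν k
        have : Integrable
            (fun ω => F (Function.update (mixAt n ω) k 0) * F (mixAt k.val ω))
            (Q.map (swapAt k)) := by rw [mps.map_eq]; exact h1 _
        conv_rhs => rw [hQ, ← mps.map_eq]
        rw [integral_map mps.measurable.aemeasurable this.aestronglyMeasurable]
        simp only [update_mixAt_swapAt, mixAt_swapAt, hQ]
      simp only [mul_sub]
      rw [integral_sub (h1 _) (h1 _), h2, sub_self]
    have hdiff : ∀ ω, F (mixAt (k.val + 1) ω) - F (mixAt k.val ω)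
        = V (mixAt (k.val + 1) ω) - V (mixAt k.val ω) := by
      intro ω; simp only [hV, update_mixAt_succ]; ring
    have hsq : ∀ m, ∫ ω, V (mixAt m ω) ^ 2 ∂Q = ∫ x, V x ^ 2 ∂(Measure.pi fun _ => ν) := by
      intro m
      have hV2 : MemLp V 2 (Measure.pi fun _ => ν) := hF.sub (hFk k)
      have := integral_map (μ := Q) (mp m).measurable.aemeasurable (f := fun x => V x ^ 2)
        (by rw [(mp m).map_eq]; exact (hV2.integrable_sq).aestronglyMeasurable)
      rw [(mp m).map_eq] at this
      exact this.symm
    have hsqi : ∀ m, Integrable (fun ω => V (mixAt m ω) ^ 2) Q := fun m => (hVL m).integrable_sq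
    calc ∫ ω, F (mixAt n ω) * (F (mixAt (k.val + 1) ω) - F (mixAt k.val ω)) ∂Q
        = ∫ ω, F (mixAt n ω) * (F (mixAt (k.val + 1) ω) - F (mixAt k.val ω)) ∂Q
          - ∫ ω, F (Function.update (mixAt n ω) k 0) *
            (F (mixAt (k.val + 1) ω) - F (mixAt k.val ω)) ∂Q := by rw [hzero, sub_zero]
      _ = ∫ ω, V (mixAt n ω) * (V (mixAt (k.val + 1) ω) - V (mixAt k.val ω)) ∂Q := by
          rw [← integral_sub]
          · refine integral_congr_ae (ae_of_all _ fun ω => ?_)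
            simp only [← hdiff]; simp only [hV]; ring
          · exact (hL n).integrable_mul ((hL _).sub (hL _))
          · exact (hLk n k).integrable_mul ((hL _).sub (hL _))
      _ ≤ ∫ ω, (V (mixAt n ω) ^ 2 + (V (mixAt (k.val + 1) ω) ^ 2 / 2
            + V (mixAt k.val ω) ^ 2 / 2)) ∂Q := by
          refine integral_mono ((hVL n).integrable_mul ((hVL _).sub (hVL _)))
            ((hsqi n).add (((hsqi _).div_const 2).add ((hsqi _).div_const 2))) fun ω => ?_
          have h1 := sq_nonneg (V (mixAt n ω) - V (mixAt (k.val + 1) ω))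
          have h2 := sq_nonneg (V (mixAt n ω) + V (mixAt k.val ω))
          simp only
          nlinarith
      _ = 2 * ∫ x, V x ^ 2 ∂(Measure.pi fun _ => ν) := by
          have hi : ∀ m, Integrable (fun ω => V (mixAt m ω) ^ 2 / 2) Q :=
            fun m => (hsqi m).div_const 2
          have h2 : Integrable
              (fun ω => V (mixAt (k.val + 1) ω) ^ 2 / 2 + V (mixAt k.val ω) ^ 2 / 2) Q :=
            (hi _).add (hi _)
          rw [integral_add (hsqi n) h2, integral_add (hi _) (hi _), integral_div, integral_div,
            hsq, hsq, hsq]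
          ring
  have htel : ∀ ω, F (mixAt n ω) * (F (mixAt n ω) - F (mixAt 0 ω))
      = ∑ k : Fin n, F (mixAt n ω) * (F (mixAt (k.val + 1) ω) - F (mixAt k.val ω)) := by
    intro ω
    rw [← Finset.mul_sum, Fin.sum_univ_eq_sum_range
      (fun k => F (mixAt (k + 1) ω) - F (mixAt k ω)) n, Finset.sum_range_sub (fun k => F (mixAt k ω))]
  have hsqF : ∫ ω, F (mixAt n ω) * F (mixAt n ω) ∂Q = ∫ x, F x ^ 2 ∂(Measure.pi fun _ => ν) := by
    have := integral_map (μ := Q) (mp n).measurable.aemeasurable (f := fun x => F x ^ 2)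
      (by rw [(mp n).map_eq]; exact (hF.integrable_sq).aestronglyMeasurable)
    rw [(mp n).map_eq] at this
    rw [this]
    simp only [sq]
  calc Var[F; Measure.pi fun _ => ν]
      = ∫ ω, F (mixAt n ω) * (F (mixAt n ω) - F (mixAt 0 ω)) ∂Q := by
        simp only [mul_sub]
        rw [integral_sub (hii n n) (hii n 0), hsqF, integral_mixAt_mul, variance_eq_sub hF]
        rfl
    _ = ∑ k : Fin n, ∫ ω, F (mixAt n ω) * (F (mixAt (k.val + 1) ω) - F (mixAt k.val ω)) ∂Q := by
        simp only [htel]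
        exact integral_finsetSum _ fun k _ => (hL n).integrable_mul ((hL _).sub (hL _))
    _ ≤ _ := by
        rw [Finset.mul_sum]
        exact Finset.sum_le_sum fun k _ => key k

end EfronStein

/-! ### Laws with bounded support -/

section BoundedLaw

variable {n : ℕ} {ν : Measure ℝ} [IsProbabilityMeasure ν] {τ : ℝ}

lemma ae_pi_abs_le (hτ : ∀ᵐ y ∂ν, |y| ≤ τ) :
    ∀ᵐ y ∂(Measure.pi fun _ : Fin n => ν), ∀ j, |y j| ≤ τ := by
  refine ae_all_iff.2 fun j => ?_
  exact (measurePreserving_eval (fun _ : Fin n => ν) j).quasiMeasurePreserving.ae hτ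

lemma memLp_of_continuous (hτ : ∀ᵐ y ∂ν, |y| ≤ τ) {G : (Fin n → ℝ) → ℝ} (hG : Continuous G)
    (q : ENNReal) : MemLp G q (Measure.pi fun _ => ν) := by
  obtain ⟨B, hB⟩ := (isCompact_univ_pi fun _ : Fin n => isCompact_Icc (a := -τ) (b := τ)).exists_bound_of_continuousOn
    hG.continuousOn
  refine MemLp.of_bound hG.aestronglyMeasurable B ?_
  filter_upwards [ae_pi_abs_le hτ] with y hy
  exact hB y fun j _ => abs_le.1 (hy j)

lemma integrable_of_continuous (hτ : ∀ᵐ y ∂ν, |y| ≤ τ) {G : (Fin n → ℝ) → ℝ}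
    (hG : Continuous G) : Integrable G (Measure.pi fun _ => ν) :=
  memLp_one_iff_integrable.1 (memLp_of_continuous hτ hG 1)

lemma continuous_update_zero (k : Fin n) :
    Continuous (fun x : Fin n → ℝ => Function.update x k (0 : ℝ)) :=
  continuous_id.update k continuous_const

lemma variance_le_of_continuous (hτ : ∀ᵐ y ∂ν, |y| ≤ τ) {F : (Fin n → ℝ) → ℝ}
    (hF : Continuous F) :
    Var[F; Measure.pi fun _ => ν] ≤
      2 * ∫ x, ∑ k, (F x - F (Function.update x k 0)) ^ 2 ∂(Measure.pi fun _ => ν) := by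
  have hk : ∀ k, Continuous fun x => F (Function.update x k 0) :=
    fun k => hF.comp (continuous_update_zero k)
  have hi : ∀ k ∈ Finset.univ, Integrable (fun x => (F x - F (Function.update x k 0)) ^ 2)
      (Measure.pi fun _ => ν) := fun k _ => integrable_of_continuous hτ ((hF.sub (hk k)).pow 2)
  rw [integral_finsetSum _ hi]
  exact variance_le_two_mul_sum_integral_sq_sub_update ν (memLp_of_continuous hτ hF 2)
    fun k => memLp_of_continuous hτ (hk k) 2

/-- A fourth moment version of the Efron–Stein inequality, obtained by applying the latter to `F`
and to `F ^ 2`. -/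
lemma integral_pow_four_le (hτ : ∀ᵐ y ∂ν, |y| ≤ τ) {F : (Fin n → ℝ) → ℝ}
    (hF : Continuous F) (h0 : ∫ x, F x ∂(Measure.pi fun _ => ν) = 0) :
    ∫ x, F x ^ 4 ∂(Measure.pi fun _ => ν) ≤
      272 * ∫ x, (∑ k, (F x - F (Function.update x k 0)) ^ 2) ^ 2 ∂(Measure.pi fun _ => ν) := by
  set P : Measure (Fin n → ℝ) := Measure.pi fun _ => ν
  have hk : ∀ k, Continuous fun x => F (Function.update x k 0) :=
    fun k => hF.comp (continuous_update_zero k)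
  set Γ : (Fin n → ℝ) → ℝ := fun x => ∑ k, (F x - F (Function.update x k 0)) ^ 2 with hΓ
  have hΓc : Continuous Γ := continuous_finsetSum _ fun k _ => (hF.sub (hk k)).pow 2
  have i4 : Integrable (fun x => F x ^ 4) P := integrable_of_continuous hτ (hF.pow 4)
  have iG2 : Integrable (fun x => Γ x ^ 2) P := integrable_of_continuous hτ (hΓc.pow 2)
  have iG : Integrable Γ P := integrable_of_continuous hτ hΓc
  have h1 := variance_le_of_continuous hτ hF
  have h2 := variance_le_of_continuous hτ (hF.pow 2)
  rw [variance_eq_sub (memLp_of_continuous hτ hF 2)] at h1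
  rw [variance_eq_sub (memLp_of_continuous hτ (hF.pow 2) 2)] at h2
  have e2 : (P[(F ^ 2) ^ 2] : ℝ) = ∫ x, F x ^ 4 ∂P := by
    congr 1; ext x; simp only [Pi.pow_apply]; ring
  have e1 : (P[F ^ 2] : ℝ) = ∫ x, F x ^ 2 ∂P := rfl
  rw [e2] at h2
  rw [e1, h0] at h1
  have hΓ0 : ∀ x, 0 ≤ Γ x := fun x => Finset.sum_nonneg fun k _ => sq_nonneg _
  have hb : ∫ x, ∑ k, (F x ^ 2 - F (Function.update x k 0) ^ 2) ^ 2 ∂P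
      ≤ ∫ x, (F x ^ 4 / 4 + 66 * Γ x ^ 2) ∂P := by
    refine integral_mono (integrable_of_continuous hτ (continuous_finsetSum _ fun k _ =>
      ((hF.pow 2).sub ((hk k).pow 2)).pow 2)) ((i4.div_const 4).add (iG2.const_mul 66)) fun x => ?_
    have hle : ∀ k, (F x ^ 2 - F (Function.update x k 0) ^ 2) ^ 2 ≤
        (F x - F (Function.update x k 0)) ^ 2 * (8 * F x ^ 2 + 2 * Γ x) := by
      intro k
      have hkΓ : (F x - F (Function.update x k 0)) ^ 2 ≤ Γ x :=
        Finset.single_le_sum (f := fun k => (F x - F (Function.update x k 0)) ^ 2)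
          (fun k _ => sq_nonneg _) (Finset.mem_univ k)
      have : (F x ^ 2 - F (Function.update x k 0) ^ 2) ^ 2
          = (F x - F (Function.update x k 0)) ^ 2 * (2 * F x - (F x - F (Function.update x k 0))) ^ 2 := by
        ring
      rw [this]
      refine mul_le_mul_of_nonneg_left ?_ (sq_nonneg _)
      nlinarith [sq_nonneg (2 * F x + (F x - F (Function.update x k 0)))]
    calc ∑ k, (F x ^ 2 - F (Function.update x k 0) ^ 2) ^ 2
        ≤ ∑ k, (F x - F (Function.update x k 0)) ^ 2 * (8 * F x ^ 2 + 2 * Γ x) :=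
          Finset.sum_le_sum fun k _ => hle k
      _ = Γ x * (8 * F x ^ 2 + 2 * Γ x) := by rw [← Finset.sum_mul]
      _ ≤ F x ^ 4 / 4 + 66 * Γ x ^ 2 := by nlinarith [sq_nonneg (F x ^ 2 / 2 - 8 * Γ x)]
  rw [integral_add (i4.div_const 4) (iG2.const_mul 66), integral_div, integral_const_mul] at hb
  have hJ : (∫ x, Γ x ∂P) ^ 2 ≤ ∫ x, Γ x ^ 2 ∂P := by
    have := variance_nonneg Γ P
    rw [variance_eq_sub (memLp_of_continuous hτ hΓc 2)] at this
    have e : (P[Γ ^ 2] : ℝ) = ∫ x, Γ x ^ 2 ∂P := rfl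
    rw [e] at this; linarith
  have hF2 : 0 ≤ ∫ x, F x ^ 2 ∂P := integral_nonneg fun x => sq_nonneg _
  have h3 : ∫ x, F x ^ 2 ∂P ≤ 2 * ∫ x, Γ x ∂P := by linarith
  have h4 : (∫ x, F x ^ 2 ∂P) ^ 2 ≤ (2 * ∫ x, Γ x ∂P) ^ 2 := pow_le_pow_left₀ hF2 h3 2
  have h2' : ∫ x, F x ^ 4 ∂P - (∫ x, F x ^ 2 ∂P) ^ 2 ≤
      2 * ∫ x, ∑ k, (F x ^ 2 - F (Function.update x k 0) ^ 2) ^ 2 ∂P := h2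
  change ∫ x, F x ^ 4 ∂P ≤ 272 * ∫ x, Γ x ^ 2 ∂P
  rw [mul_pow] at h4
  -- `h2'` and `hb` give `x - u ^ 2 ≤ x / 2 + 132 * y` with `u ^ 2 ≤ 4 * y`; hence `272 = 2 * (132 + 4)`
  linarith

lemma integral_exp_mul_le (hτ : ∀ᵐ y ∂ν, |y| ≤ τ) (hsymm : ν.map (fun x => -x) = ν) (a : ℝ) :
    ∫ y, Real.exp (a * y) ∂ν ≤ Real.exp (a ^ 2 * τ ^ 2 / 2) := by
  have hb : ∀ c : ℝ, Integrable (fun y => Real.exp (c * y)) ν := fun c => by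
    refine Integrable.of_bound (by fun_prop) (Real.exp (|c| * τ)) ?_
    filter_upwards [hτ] with y hy
    rw [Real.norm_eq_abs, abs_of_pos (Real.exp_pos _)]
    refine Real.exp_le_exp.2 ((le_abs_self _).trans ?_)
    rw [abs_mul]; gcongr
  have hneg : ∫ y, Real.exp (a * y) ∂ν = ∫ y, Real.exp (-a * y) ∂ν := by
    conv_lhs => rw [← hsymm]
    rw [integral_map (by fun_prop) (by fun_prop)]
    simp
  have : ∫ y, Real.exp (a * y) ∂ν = ∫ y, Real.cosh (a * y) ∂ν := by
    have : (fun y => Real.cosh (a * y)) = fun y => (Real.exp (a * y) + Real.exp (-a * y)) / 2 := by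
      ext y; rw [Real.cosh_eq]; simp
    rw [this, integral_div, integral_add (hb a) (hb (-a)), ← hneg]
    ring
  rw [this]
  calc ∫ y, Real.cosh (a * y) ∂ν ≤ ∫ _, Real.exp (a ^ 2 * τ ^ 2 / 2) ∂ν := by
        refine integral_mono_of_nonneg (ae_of_all _ fun y => (Real.cosh_pos _).le)
          (integrable_const _) ?_
        filter_upwards [hτ] with y hy
        refine (Real.cosh_le_exp_half_sq _).trans (Real.exp_le_exp.2 ?_)
        have : y ^ 2 ≤ τ ^ 2 := sq_le_sq' (abs_le.1 hy).1 (abs_le.1 hy).2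
        rw [mul_pow]
        gcongr
    _ = _ := by simp

/-- A high moment of a linear form in independent symmetric bounded variables is bounded in terms of
the Euclidean norm of the coefficients only, by way of the sub-Gaussian bound for the exponential
moments. The order `16` covers the squares of the eighth powers in `sum_sq_pairForm_sub_le`. -/
lemma integral_linear_pow_le (hτ : ∀ᵐ y ∂ν, |y| ≤ τ) (hsymm : ν.map (fun x => -x) = ν)
    {a : Fin n → ℝ} {C : ℝ} (ha : ∑ j, a j ^ 2 ≤ C) :
    ∫ y, (∑ j, a j * y j) ^ 16 ∂(Measure.pi fun _ => ν)
      ≤ 2 * (16 : ℕ).factorial * Real.exp (C * τ ^ 2 / 2) := by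
  have hexp : ∀ b : Fin n → ℝ, ∑ j, b j ^ 2 ≤ C →
      ∫ y, Real.exp (∑ j, b j * y j) ∂(Measure.pi fun _ => ν) ≤ Real.exp (C * τ ^ 2 / 2) := by
    intro b hb
    have : ∫ y, Real.exp (∑ j, b j * y j) ∂(Measure.pi fun _ : Fin n => ν)
        = ∏ j, ∫ y, Real.exp (b j * y) ∂ν := by
      simp only [Real.exp_sum]
      exact integral_fintype_prod_eq_prod (fun j y => Real.exp (b j * y))
    rw [this]
    calc ∏ j, ∫ y, Real.exp (b j * y) ∂ν ≤ ∏ j, Real.exp (b j ^ 2 * τ ^ 2 / 2) :=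
          Finset.prod_le_prod (fun j _ => integral_nonneg fun y => (Real.exp_pos _).le)
            fun j _ => integral_exp_mul_le hτ hsymm _
      _ = Real.exp ((∑ j, b j ^ 2) * τ ^ 2 / 2) := by
          rw [← Real.exp_sum, Finset.sum_mul, Finset.sum_div]
      _ ≤ _ := Real.exp_le_exp.2 (by gcongr)
  have h1 := hexp a ha
  have h2 := hexp (fun j => -a j) (by simpa using ha)
  have i1 : ∀ b : Fin n → ℝ,
      Integrable (fun y => Real.exp (∑ j, b j * y j)) (Measure.pi fun _ : Fin n => ν) :=
    fun b => integrable_of_continuous hτ (by fun_prop)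
  calc ∫ y, (∑ j, a j * y j) ^ 16 ∂(Measure.pi fun _ => ν)
      ≤ ∫ y, (16 : ℕ).factorial * (Real.exp (∑ j, a j * y j)
          + Real.exp (∑ j, -a j * y j)) ∂(Measure.pi fun _ => ν) := by
        refine integral_mono (integrable_of_continuous hτ (by fun_prop))
          (((i1 a).add (i1 _)).const_mul _) fun y => ?_
        have e : ∑ j, -a j * y j = -∑ j, a j * y j := by simp
        simp only [e]
        set u := ∑ j, a j * y j
        have hu : u ^ 16 = |u| ^ 16 := (Even.pow_abs (by decide) u).symm
        have := Real.pow_div_factorial_le_exp |u| (abs_nonneg u) 16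
        rw [div_le_iff₀ (by positivity)] at this
        rw [hu]
        refine this.trans ?_
        rw [mul_comm]
        gcongr
        rcases abs_cases u with ⟨h, _⟩ | ⟨h, _⟩ <;> rw [h]
        · linarith [Real.exp_pos (-u)]
        · linarith [Real.exp_pos u]
    _ = (16 : ℕ).factorial * (∫ y, Real.exp (∑ j, a j * y j) ∂(Measure.pi fun _ => ν)
          + ∫ y, Real.exp (∑ j, -a j * y j) ∂(Measure.pi fun _ => ν)) := by
        rw [integral_const_mul, integral_add (i1 a) (i1 _)]
    _ ≤ (16 : ℕ).factorial * (Real.exp (C * τ ^ 2 / 2) + Real.exp (C * τ ^ 2 / 2)) := by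
        gcongr
    _ = _ := by ring

end BoundedLaw

/-! ### Matrices with bounded operator norm -/

/-- The operator norm of `R` for the Euclidean norms is at most `√C`; the same bound for the
transpose is included in order to avoid duality arguments. -/
def OpBound {n : ℕ} (R : Matrix (Fin n) (Fin n) ℝ) (C : ℝ) : Prop :=
  (∀ v : Fin n → ℝ, ∑ i, (∑ k, R i k * v k) ^ 2 ≤ C * ∑ i, v i ^ 2) ∧
    ∀ v : Fin n → ℝ, ∑ k, (∑ i, R i k * v i) ^ 2 ≤ C * ∑ i, v i ^ 2

namespace OpBound

variable {n : ℕ} {R : Matrix (Fin n) (Fin n) ℝ} {C : ℝ}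

lemma transpose (h : OpBound R C) : OpBound Rᵀ C := ⟨h.2, h.1⟩

lemma mono (h : OpBound R C) {C' : ℝ} (hC : C ≤ C') : OpBound R C' :=
  ⟨fun v => (h.1 v).trans (mul_le_mul_of_nonneg_right hC (Finset.sum_nonneg fun _ _ => sq_nonneg _)),
   fun v => (h.2 v).trans (mul_le_mul_of_nonneg_right hC (Finset.sum_nonneg fun _ _ => sq_nonneg _))⟩

lemma row_le (h : OpBound R C) (i : Fin n) : ∑ k, R i k ^ 2 ≤ C := by
  have := h.2 (Pi.single i 1)
  simpa [Pi.single_apply, ite_pow] using this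

lemma col_le (h : OpBound R C) (k : Fin n) : ∑ i, R i k ^ 2 ≤ C := h.transpose.row_le k

lemma sq_le (h : OpBound R C) (i k : Fin n) : R i k ^ 2 ≤ C :=
  (Finset.single_le_sum (f := fun k => R i k ^ 2) (fun _ _ => sq_nonneg _)
    (Finset.mem_univ k)).trans (h.row_le i)

lemma abs_le (h : OpBound R C) (hC : 1 ≤ C) (i k : Fin n) : |R i k| ≤ C := by
  refine abs_le_of_sq_le_sq ((h.sq_le i k).trans ?_) (by linarith)
  nlinarith

/-- The Schur test. -/
lemma of_abs_sum_le {S : ℝ} (hr : ∀ i, ∑ k, |R i k| ≤ S) (hc : ∀ k, ∑ i, |R i k| ≤ S) :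
    OpBound R (S ^ 2) := by
  have main : ∀ {R : Matrix (Fin n) (Fin n) ℝ}, (∀ i, ∑ k, |R i k| ≤ S) →
      (∀ k, ∑ i, |R i k| ≤ S) → ∀ v : Fin n → ℝ, ∑ i, (∑ k, R i k * v k) ^ 2 ≤ S ^ 2 * ∑ i, v i ^ 2 := by
    intro R hr hc v
    have h1 : ∀ i, (∑ k, R i k * v k) ^ 2 ≤ S * ∑ k, |R i k| * v k ^ 2 := by
      intro i
      have := Finset.sum_mul_sq_le_sq_mul_sq Finset.univ (fun k => √|R i k|)
        (fun k => √|R i k| * |v k|)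
      have e1 : ∀ k, √|R i k| * (√|R i k| * |v k|) = |R i k * v k| := fun k => by
        rw [← mul_assoc, Real.mul_self_sqrt (abs_nonneg _), abs_mul]
      have e2 : ∀ k, √|R i k| ^ 2 = |R i k| := fun k => Real.sq_sqrt (abs_nonneg _)
      simp only [e1, mul_pow, e2, sq_abs] at this
      calc (∑ k, R i k * v k) ^ 2 ≤ (∑ k, |R i k * v k|) ^ 2 := by
            rw [← sq_abs]
            exact pow_le_pow_left₀ (abs_nonneg _) (Finset.abs_sum_le_sum_abs _ _) 2
        _ ≤ _ := this
        _ ≤ _ := mul_le_mul_of_nonneg_right (hr i)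
            (Finset.sum_nonneg fun k _ => mul_nonneg (abs_nonneg _) (sq_nonneg _))
    calc ∑ i, (∑ k, R i k * v k) ^ 2 ≤ ∑ i, S * ∑ k, |R i k| * v k ^ 2 :=
          Finset.sum_le_sum fun i _ => h1 i
      _ = S * ∑ k, (∑ i, |R i k|) * v k ^ 2 := by
          rw [← Finset.mul_sum, Finset.sum_comm]; simp only [Finset.sum_mul]
      _ ≤ S ^ 2 * ∑ i, v i ^ 2 := by
          rw [sq, mul_assoc]
          rcases isEmpty_or_nonempty (Fin n) with he | ⟨⟨i⟩⟩
          · simp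
          have hS : 0 ≤ S := (Finset.sum_nonneg fun k _ => abs_nonneg (R i k)).trans (hr i)
          refine mul_le_mul_of_nonneg_left ?_ hS
          rw [Finset.mul_sum]
          exact Finset.sum_le_sum fun k _ => mul_le_mul_of_nonneg_right (hc k) (sq_nonneg _)
  exact ⟨main hr hc, main (R := Rᵀ) hc hr⟩

lemma abs_pow_le (h : OpBound R C) (hC : 1 ≤ C) (i k : Fin n) {m : ℕ} (hm : 2 ≤ m) :
    |R i k| ^ m ≤ C ^ (m - 2) * R i k ^ 2 := by
  obtain ⟨l, rfl⟩ := Nat.exists_eq_add_of_le hm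
  rw [pow_add, sq_abs, Nat.add_sub_cancel_left, mul_comm]
  gcongr
  exact h.abs_le hC i k

lemma sum_abs_hpow_le (h : OpBound R C) (hC : 1 ≤ C) (k : Fin n) {m : ℕ} (hm : 2 ≤ m) :
    ∑ i, |hpow R m i k| ≤ C ^ m := by
  calc ∑ i, |hpow R m i k| ≤ ∑ i, C ^ (m - 2) * R i k ^ 2 := Finset.sum_le_sum fun i _ => by
        simp only [hpow, Matrix.of_apply, abs_pow]; exact h.abs_pow_le hC i k hm
    _ ≤ C ^ (m - 2) * C := by
        rw [← Finset.mul_sum]; gcongr; exact h.col_le k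
    _ ≤ C ^ m := by
        rw [← pow_succ]; exact pow_le_pow_right₀ hC (by omega)

lemma hpow (h : OpBound R C) (hC : 1 ≤ C) {m : ℕ} (hm : 1 ≤ m) :
    OpBound (hpow R m) (C ^ (2 * m)) := by
  rcases Nat.lt_or_ge 1 m with h2 | h1
  · rw [mul_comm, pow_mul]
    exact of_abs_sum_le (fun i => h.transpose.sum_abs_hpow_le hC i h2)
      fun k => h.sum_abs_hpow_le hC k h2
  · obtain rfl : m = 1 := by omega
    have : Homoscedasticity.hpow R 1 = R := by ext; simp [Homoscedasticity.hpow]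
    rw [this]
    exact h.mono (by simpa using le_self_pow₀ hC two_ne_zero)

end OpBound

/-! ### Sums of cubic polynomials of linear forms -/

/-- The cubic polynomial with coefficients `c`. -/
def cub (c : Fin 4 → ℝ) (e : ℝ) : ℝ := c 0 + c 1 * e + c 2 * e ^ 2 + c 3 * e ^ 3

/-- `∑ i, R i k * cub (c i) ((A y) i)`. -/
def cubForm {n : ℕ} (A R : Matrix (Fin n) (Fin n) ℝ) (c : Fin n → Fin 4 → ℝ) (k : Fin n)
    (y : Fin n → ℝ) : ℝ :=
  ∑ i, R i k * cub (c i) ((A *ᵥ y) i)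

/-- A bound for the effect on `cub` of resetting one variable. -/
def incConst (C τ K : ℝ) : ℝ := 400 * τ ^ 6 * C ^ 6 * K ^ 2

lemma sq_sum_three_le (x y z : ℝ) : (x + y + z) ^ 2 ≤ 3 * (x ^ 2 + y ^ 2 + z ^ 2) := by
  nlinarith [sq_nonneg (x - y), sq_nonneg (y - z), sq_nonneg (x - z)]

lemma sq_sum_four_le (x y z w : ℝ) :
    (x + y + z + w) ^ 2 ≤ 4 * (x ^ 2 + y ^ 2 + z ^ 2 + w ^ 2) := by
  nlinarith [sq_nonneg (x - y), sq_nonneg (y - z), sq_nonneg (x - z), sq_nonneg (x - w),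
    sq_nonneg (y - w), sq_nonneg (z - w)]

section Increments

variable {n : ℕ} {A R R' : Matrix (Fin n) (Fin n) ℝ} {c c' : Fin n → Fin 4 → ℝ} {C τ K S : ℝ}

lemma continuous_mulVec_apply (A : Matrix (Fin n) (Fin n) ℝ) (i : Fin n) :
    Continuous fun y : Fin n → ℝ => (A *ᵥ y) i := by
  simp only [Matrix.mulVec, dotProduct]; fun_prop

lemma continuous_cubForm (A R : Matrix (Fin n) (Fin n) ℝ) (c : Fin n → Fin 4 → ℝ) (k : Fin n) :
    Continuous (cubForm A R c k) := by
  have := continuous_mulVec_apply A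
  unfold cubForm cub
  fun_prop

lemma mulVec_update_zero (A : Matrix (Fin n) (Fin n) ℝ) (y : Fin n → ℝ) (i j : Fin n) :
    (A *ᵥ Function.update y j 0) i = (A *ᵥ y) i - A i j * y j := by
  have : Function.update y j 0 = y - Pi.single j (y j) := by
    ext k
    by_cases h : k = j
    · subst h; simp
    · simp [h]
  rw [this, Matrix.mulVec_sub]
  simp [mul_comm]

lemma cub_sub (c : Fin 4 → ℝ) (e t : ℝ) :
    cub c e - cub c (e - t) =
      t * (c 1 + 2 * c 2 * e + 3 * c 3 * e ^ 2) + t ^ 2 * (-c 2 - 3 * c 3 * e) + t ^ 3 * c 3 := by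
  unfold cub; ring

lemma cub_sq_le {c : Fin 4 → ℝ} (hc : ∀ l, |c l| ≤ K) (e : ℝ) :
    cub c e ^ 2 ≤ 16 * K ^ 2 * (1 + e ^ 6) := by
  have h : ∀ l, c l ^ 2 ≤ K ^ 2 := fun l => sq_le_sq' (abs_le.1 (hc l)).1 (abs_le.1 (hc l)).2
  have e2 : e ^ 2 ≤ 1 + e ^ 6 := by nlinarith [sq_nonneg (e ^ 2 - 1), sq_nonneg e, sq_nonneg (e^3 - e)]
  have e4 : e ^ 4 ≤ 1 + e ^ 6 := by
    nlinarith [mul_nonneg (sq_nonneg (e ^ 2 - 1)) (sq_nonneg e), sq_nonneg (e ^ 2 - 1)]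
  have e6 : 0 ≤ e ^ 6 := by positivity
  calc cub c e ^ 2 ≤ 4 * (c 0 ^ 2 + (c 1 * e) ^ 2 + (c 2 * e ^ 2) ^ 2 + (c 3 * e ^ 3) ^ 2) :=
        sq_sum_four_le _ _ _ _
    _ = 4 * (c 0 ^ 2 * 1 + c 1 ^ 2 * e ^ 2 + c 2 ^ 2 * e ^ 4 + c 3 ^ 2 * e ^ 6) := by ring
    _ ≤ 4 * (K ^ 2 * (1 + e ^ 6) + K ^ 2 * (1 + e ^ 6) + K ^ 2 * (1 + e ^ 6)
          + K ^ 2 * (1 + e ^ 6)) := by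
        have key : ∀ l x, 0 ≤ x → x ≤ 1 + e ^ 6 → c l ^ 2 * x ≤ K ^ 2 * (1 + e ^ 6) :=
          fun l x hx hx' => mul_le_mul (h l) hx' hx (sq_nonneg K)
        have k0 := key 0 1 zero_le_one (by linarith)
        have k1 := key 1 (e ^ 2) (sq_nonneg _) e2
        have k2 := key 2 (e ^ 4) (by positivity) e4
        have k3 := key 3 (e ^ 6) e6 (by linarith)
        linarith
    _ = _ := by ring

lemma inc_coeff_sq_le {c : Fin 4 → ℝ} (hc : ∀ l, |c l| ≤ K) (e : ℝ) :
    (c 1 + 2 * c 2 * e + 3 * c 3 * e ^ 2) ^ 2 ≤ 42 * K ^ 2 * (1 + e ^ 4) ∧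
      (-c 2 - 3 * c 3 * e) ^ 2 ≤ 42 * K ^ 2 * (1 + e ^ 4) ∧ c 3 ^ 2 ≤ 42 * K ^ 2 * (1 + e ^ 4) := by
  have h : ∀ l, c l ^ 2 ≤ K ^ 2 := fun l => sq_le_sq' (abs_le.1 (hc l)).1 (abs_le.1 (hc l)).2
  have hK : 0 ≤ K ^ 2 := sq_nonneg K
  have e2 : e ^ 2 ≤ (1 + e ^ 4) / 2 := by nlinarith [sq_nonneg (e ^ 2 - 1)]
  have e4 : 0 ≤ e ^ 4 := by positivity
  refine ⟨?_, ?_, ?_⟩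
  · calc (c 1 + 2 * c 2 * e + 3 * c 3 * e ^ 2) ^ 2
        ≤ 3 * (c 1 ^ 2 + (2 * c 2 * e) ^ 2 + (3 * c 3 * e ^ 2) ^ 2) := sq_sum_three_le _ _ _
      _ = 3 * (c 1 ^ 2 + 4 * (c 2 ^ 2 * e ^ 2) + 9 * (c 3 ^ 2 * e ^ 4)) := by ring
      _ ≤ 3 * (K ^ 2 + 4 * (K ^ 2 * ((1 + e ^ 4) / 2)) + 9 * (K ^ 2 * e ^ 4)) := by
          have k2 := mul_le_mul (h 2) e2 (sq_nonneg e) hK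
          have k3 := mul_le_mul_of_nonneg_right (h 3) e4
          linarith [h 1]
      _ ≤ _ := by nlinarith
  · calc (-c 2 - 3 * c 3 * e) ^ 2 ≤ 2 * (c 2 ^ 2 + 9 * (c 3 ^ 2 * e ^ 2)) := by
          nlinarith [sq_nonneg (c 2 - 3 * c 3 * e)]
      _ ≤ 2 * (K ^ 2 + 9 * (K ^ 2 * ((1 + e ^ 4) / 2))) := by
          have k3 := mul_le_mul (h 3) e2 (sq_nonneg e) hK
          linarith [h 2]
      _ ≤ _ := by nlinarith
  · nlinarith [h 3]

/-- The matrix of increments of the vector `cub (c i) ((A y) i)` under resetting of single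
variables acts boundedly, up to a weight. -/
lemma sum_sq_sum_mul_cub_sub_le (hA : OpBound A C) (hC : 1 ≤ C) (hτ1 : 1 ≤ τ)
    (hc : ∀ i l, |c i l| ≤ K) {y : Fin n → ℝ} (hy : ∀ j, |y j| ≤ τ) (v : Fin n → ℝ) :
    ∑ j, (∑ i, v i * (cub (c i) ((A *ᵥ y) i) - cub (c i) ((A *ᵥ Function.update y j 0) i))) ^ 2
      ≤ incConst C τ K * ∑ i, (1 + (A *ᵥ y) i ^ 4) * v i ^ 2 := by
  set e := A *ᵥ y with he
  -- the coefficient of `t ^ l` in `cub (c i) e - cub (c i) (e - t)`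
  set q : ℕ → Fin n → ℝ := fun l i => if l = 1 then c i 1 + 2 * c i 2 * e i + 3 * c i 3 * e i ^ 2
    else if l = 2 then -c i 2 - 3 * c i 3 * e i else c i 3 with hq
  have hqb : ∀ l i, q l i ^ 2 ≤ 42 * K ^ 2 * (1 + e i ^ 4) := by
    intro l i
    obtain ⟨h1, h2, h3⟩ := inc_coeff_sq_le (hc i) (e i)
    simp only [hq]; split_ifs <;> assumption
  set t : ℕ → Fin n → ℝ := fun l j => ∑ i, hpow A l i j * (q l i * v i) with ht
  have hexp : ∀ j, ∑ i, v i * (cub (c i) (e i) - cub (c i) ((A *ᵥ Function.update y j 0) i))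
      = y j ^ 1 * t 1 j + y j ^ 2 * t 2 j + y j ^ 3 * t 3 j := by
    intro j
    simp only [ht, Finset.mul_sum, ← Finset.sum_add_distrib]
    refine Finset.sum_congr rfl fun i _ => ?_
    rw [mulVec_update_zero, ← he, cub_sub]
    simp only [hq, hpow, Matrix.of_apply]
    norm_num
    ring
  have hbd : ∀ l, 1 ≤ l → l ≤ 3 → ∑ j, (y j ^ l * t l j) ^ 2
      ≤ τ ^ 6 * C ^ 6 * (42 * K ^ 2 * ∑ i, (1 + e i ^ 4) * v i ^ 2) := by
    intro l hl hl3
    calc ∑ j, (y j ^ l * t l j) ^ 2 ≤ ∑ j, τ ^ 6 * t l j ^ 2 := by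
          refine Finset.sum_le_sum fun j _ => ?_
          rw [mul_pow]
          refine mul_le_mul_of_nonneg_right ?_ (sq_nonneg _)
          calc (y j ^ l) ^ 2 = |y j| ^ (l * 2) := by rw [← pow_mul, Even.pow_abs ⟨l, by ring⟩]
            _ ≤ τ ^ (l * 2) := pow_le_pow_left₀ (abs_nonneg _) (hy j) _
            _ ≤ τ ^ 6 := pow_le_pow_right₀ hτ1 (by omega)
      _ = τ ^ 6 * ∑ j, t l j ^ 2 := by rw [Finset.mul_sum]
      _ ≤ τ ^ 6 * (C ^ 6 * ∑ i, (q l i * v i) ^ 2) := by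
          gcongr
          refine ((hA.hpow hC hl).2 _).trans ?_
          gcongr
          omega
      _ ≤ τ ^ 6 * (C ^ 6 * ∑ i, 42 * K ^ 2 * ((1 + e i ^ 4) * v i ^ 2)) := by
          gcongr with i
          rw [mul_pow, ← mul_assoc]
          exact mul_le_mul_of_nonneg_right (hqb l i) (sq_nonneg _)
      _ = _ := by rw [← Finset.mul_sum]; ring
  have hnn : 0 ≤ τ ^ 6 * C ^ 6 * (K ^ 2 * ∑ i, (1 + e i ^ 4) * v i ^ 2) := by
    have : 0 ≤ ∑ i, (1 + e i ^ 4) * v i ^ 2 := Finset.sum_nonneg fun i _ => by positivity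
    positivity
  calc ∑ j, (∑ i, v i * (cub (c i) (e i) - cub (c i) ((A *ᵥ Function.update y j 0) i))) ^ 2
      ≤ ∑ j, 3 * ((y j ^ 1 * t 1 j) ^ 2 + (y j ^ 2 * t 2 j) ^ 2 + (y j ^ 3 * t 3 j) ^ 2) :=
        Finset.sum_le_sum fun j _ => by rw [hexp]; exact sq_sum_three_le _ _ _
    _ = 3 * (∑ j, (y j ^ 1 * t 1 j) ^ 2 + ∑ j, (y j ^ 2 * t 2 j) ^ 2
          + ∑ j, (y j ^ 3 * t 3 j) ^ 2) := by
        rw [← Finset.mul_sum, Finset.sum_add_distrib, Finset.sum_add_distrib]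
    _ ≤ _ := by
        have h1 := hbd 1 (by norm_num) (by norm_num)
        have h2 := hbd 2 (by norm_num) (by norm_num)
        have h3 := hbd 3 (by norm_num) (by norm_num)
        unfold incConst
        nlinarith

/-- The squared size of the increments of `cub (c i) ((A y) i)` under resetting of the variable
`j`. -/
lemma sum_sq_cub_sub_le (hA : OpBound A C) (hC : 1 ≤ C) (hτ1 : 1 ≤ τ)
    (hc : ∀ i l, |c i l| ≤ K) {y : Fin n → ℝ} (hy : ∀ j, |y j| ≤ τ) (j : Fin n) :
    ∑ i, (cub (c i) ((A *ᵥ y) i) - cub (c i) ((A *ᵥ Function.update y j 0) i)) ^ 2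
      ≤ incConst C τ K * ∑ i, A i j ^ 2 * (1 + (A *ᵥ y) i ^ 4) := by
  rw [Finset.mul_sum]
  refine Finset.sum_le_sum fun i _ => ?_
  set e := (A *ᵥ y) i
  rw [mulVec_update_zero, cub_sub]
  obtain ⟨h1, h2, h3⟩ := inc_coeff_sq_le (hc i) e
  set q1 := c i 1 + 2 * c i 2 * e + 3 * c i 3 * e ^ 2
  set q2 := -c i 2 - 3 * c i 3 * e
  set q3 := c i 3
  have ht : |A i j * y j| ≤ C * τ := by
    rw [abs_mul]; exact mul_le_mul (hA.abs_le hC i j) (hy j) (abs_nonneg _) (by linarith)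
  have ht2 : (A i j * y j) ^ 2 ≤ (C * τ) ^ 2 := sq_le_sq' (abs_le.1 ht).1 (abs_le.1 ht).2
  have hCτ : 1 ≤ (C * τ) ^ 2 := one_le_pow₀ (by nlinarith)
  have hta : (A i j * y j) ^ 2 ≤ A i j ^ 2 * τ ^ 2 := by
    rw [mul_pow]; gcongr ?_ * ?_
    exact sq_le_sq' (abs_le.1 (hy j)).1 (abs_le.1 (hy j)).2
  set t := A i j * y j
  set B := 42 * K ^ 2 * (1 + e ^ 4) with hB
  have hB0 : 0 ≤ B := by positivity
  have hCt4 : (C * τ) ^ 2 ≤ (C * τ) ^ 4 := pow_le_pow_right₀ (by nlinarith) (by norm_num)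
  calc (t * q1 + t ^ 2 * q2 + t ^ 3 * q3) ^ 2
      ≤ 3 * ((t * q1) ^ 2 + (t ^ 2 * q2) ^ 2 + (t ^ 3 * q3) ^ 2) := sq_sum_three_le _ _ _
    _ = 3 * (t ^ 2 * (1 * q1 ^ 2) + t ^ 2 * (t ^ 2 * q2 ^ 2) + t ^ 2 * ((t ^ 2) ^ 2 * q3 ^ 2)) := by
        ring
    _ ≤ 3 * (t ^ 2 * ((C * τ) ^ 4 * B) + t ^ 2 * ((C * τ) ^ 4 * B)
          + t ^ 2 * (((C * τ) ^ 2) ^ 2 * B)) := by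
        gcongr
        · exact hCτ.trans hCt4
        · exact ht2.trans hCt4
    _ = 9 * t ^ 2 * ((C * τ) ^ 4 * B) := by ring
    _ ≤ 9 * (A i j ^ 2 * τ ^ 2) * ((C * τ) ^ 4 * B) := by gcongr
    _ = 378 * (A i j ^ 2 * (1 + e ^ 4) * K ^ 2 * τ ^ 6) * C ^ 4 := by rw [hB]; ring
    _ ≤ 400 * (A i j ^ 2 * (1 + e ^ 4) * K ^ 2 * τ ^ 6) * C ^ 6 := by
        gcongr
        · norm_num
        · norm_num
    _ = _ := by unfold incConst; ring

lemma cubForm_sub (k j : Fin n) (y : Fin n → ℝ) :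
    cubForm A R c k y - cubForm A R c k (Function.update y j 0) =
      ∑ i, R i k * (cub (c i) ((A *ᵥ y) i) - cub (c i) ((A *ᵥ Function.update y j 0) i)) := by
  simp only [cubForm, mul_sub, Finset.sum_sub_distrib]

lemma sum_sq_cubForm_le (hR : OpBound R S) (hS : 0 ≤ S) (hc : ∀ i l, |c i l| ≤ K)
    (y : Fin n → ℝ) :
    ∑ k, cubForm A R c k y ^ 2 ≤ S * (16 * K ^ 2 * ∑ i, (1 + (A *ᵥ y) i ^ 6)) := by
  refine (hR.2 _).trans (mul_le_mul_of_nonneg_left ?_ hS)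
  rw [Finset.mul_sum]
  exact Finset.sum_le_sum fun i _ => cub_sq_le (hc i) _

lemma sum_sq_cubForm_sub_le (hA : OpBound A C) (hC : 1 ≤ C) (hτ1 : 1 ≤ τ)
    (hR : OpBound R S) (hS : 0 ≤ S) (hc : ∀ i l, |c i l| ≤ K) {y : Fin n → ℝ}
    (hy : ∀ j, |y j| ≤ τ) (j : Fin n) :
    ∑ k, (cubForm A R c k y - cubForm A R c k (Function.update y j 0)) ^ 2
      ≤ S * (incConst C τ K * ∑ i, A i j ^ 2 * (1 + (A *ᵥ y) i ^ 4)) := by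
  simp only [cubForm_sub]
  exact (hR.2 _).trans (mul_le_mul_of_nonneg_left (sum_sq_cub_sub_le hA hC hτ1 hc hy j) hS)

lemma sum_sq_weight_le (hA : OpBound A C) (y : Fin n → ℝ) (j : Fin n) :
    (∑ i, A i j ^ 2 * (1 + (A *ᵥ y) i ^ 4)) ^ 2
      ≤ C * (2 * ∑ i, A i j ^ 2 * (1 + (A *ᵥ y) i ^ 8)) := by
  have h := Finset.sum_mul_sq_le_sq_mul_sq Finset.univ (fun i => A i j)
    (fun i => A i j * (1 + (A *ᵥ y) i ^ 4))
  have e1 : ∀ i, A i j * (A i j * (1 + (A *ᵥ y) i ^ 4)) = A i j ^ 2 * (1 + (A *ᵥ y) i ^ 4) :=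
    fun i => by ring
  simp only [e1] at h
  refine h.trans (mul_le_mul (hA.col_le j) ?_ (Finset.sum_nonneg fun _ _ => sq_nonneg _)
    ((Finset.sum_nonneg fun _ _ => sq_nonneg _).trans (hA.col_le j)))
  rw [Finset.mul_sum]
  refine Finset.sum_le_sum fun i _ => ?_
  have : 0 ≤ A i j ^ 2 * (1 - (A *ᵥ y) i ^ 4) ^ 2 := by positivity
  nlinarith

lemma sum_sum_sq_weight_le (hA : OpBound A C) (hC : 0 ≤ C) (y : Fin n → ℝ) :
    ∑ j, (∑ i, A i j ^ 2 * (1 + (A *ᵥ y) i ^ 4)) ^ 2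
      ≤ 2 * C ^ 2 * ∑ i, (1 + (A *ᵥ y) i ^ 8) := by
  calc ∑ j, (∑ i, A i j ^ 2 * (1 + (A *ᵥ y) i ^ 4)) ^ 2
      ≤ ∑ j, C * (2 * ∑ i, A i j ^ 2 * (1 + (A *ᵥ y) i ^ 8)) :=
        Finset.sum_le_sum fun j _ => sum_sq_weight_le hA y j
    _ = 2 * C * ∑ i, (∑ j, A i j ^ 2) * (1 + (A *ᵥ y) i ^ 8) := by
        rw [← Finset.mul_sum, ← Finset.mul_sum, Finset.sum_comm]
        simp only [Finset.sum_mul]; ring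
    _ ≤ 2 * C * ∑ i, C * (1 + (A *ᵥ y) i ^ 8) := by
        gcongr with i
        exact hA.row_le i
    _ = _ := by rw [← Finset.mul_sum]; ring

end Increments

/-- `∑ k, y k ^ b * g k * g' k` for two vectors `g`, `g'` of sums of cubic polynomials. -/
def pairForm {n : ℕ} (A R R' : Matrix (Fin n) (Fin n) ℝ) (c c' : Fin n → Fin 4 → ℝ) (b : ℕ)
    (y : Fin n → ℝ) : ℝ :=
  ∑ k, y k ^ b * (cubForm A R c k y * cubForm A R' c' k y)

lemma continuous_pairForm {n : ℕ} (A R R' : Matrix (Fin n) (Fin n) ℝ) (c c' : Fin n → Fin 4 → ℝ)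
    (b : ℕ) : Continuous (pairForm A R R' c c' b) := by
  have h1 := continuous_cubForm A R c
  have h2 := continuous_cubForm A R' c'
  unfold pairForm
  fun_prop

section PairForm

variable {n : ℕ} {A R R' : Matrix (Fin n) (Fin n) ℝ} {c c' : Fin n → Fin 4 → ℝ} {C τ K S : ℝ}

lemma incConst_nonneg : 0 ≤ incConst C τ K := by
  unfold incConst; positivity

lemma sum_sq_sum_cubForm_sub_mul_le (hA : OpBound A C) (hC : 1 ≤ C) (hτ1 : 1 ≤ τ)
    (hR : OpBound R S) (hc : ∀ i l, |c i l| ≤ K) {y : Fin n → ℝ}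
    (hy : ∀ j, |y j| ≤ τ) (u : Fin n → ℝ) {s : ℝ} (hs : 0 < s) :
    ∑ j, (∑ k, (cubForm A R c k y - cubForm A R c k (Function.update y j 0)) * u k) ^ 2
      ≤ incConst C τ K * ((1 + s + (∑ i, (1 + (A *ᵥ y) i ^ 8)) / s) * (S * ∑ k, u k ^ 2)) := by
  set Y := ∑ i, (1 + (A *ᵥ y) i ^ 8) with hY
  have hD := incConst_nonneg (C := C) (τ := τ) (K := K)
  have e1 : ∀ j, ∑ k, (cubForm A R c k y - cubForm A R c k (Function.update y j 0)) * u k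
      = ∑ i, (∑ k, R i k * u k) *
        (cub (c i) ((A *ᵥ y) i) - cub (c i) ((A *ᵥ Function.update y j 0) i)) := by
    intro j
    simp only [cubForm_sub, Finset.sum_mul]
    rw [Finset.sum_comm]
    refine Finset.sum_congr rfl fun i _ => Finset.sum_congr rfl fun k _ => by ring
  simp only [e1]
  refine (sum_sq_sum_mul_cub_sub_le hA hC hτ1 hc hy _).trans (mul_le_mul_of_nonneg_left ?_ hD)
  have hw : ∀ i, 1 + (A *ᵥ y) i ^ 4 ≤ 1 + s + Y / s := by
    intro i
    have h1 : 1 + (A *ᵥ y) i ^ 8 ≤ Y := Finset.single_le_sum (f := fun i => 1 + (A *ᵥ y) i ^ 8)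
      (fun i _ => by positivity) (Finset.mem_univ i)
    have h2 : (A *ᵥ y) i ^ 4 ≤ s + (A *ᵥ y) i ^ 8 / s := by
      rw [← sub_nonneg]
      have : s + (A *ᵥ y) i ^ 8 / s - (A *ᵥ y) i ^ 4
          = ((s - (A *ᵥ y) i ^ 4 / 2) ^ 2 + 3 / 4 * (A *ᵥ y) i ^ 8) / s := by
        field_simp; ring
      rw [this]; positivity
    have h3 : (A *ᵥ y) i ^ 8 / s ≤ Y / s := by gcongr; linarith
    linarith
  have hw0 : 0 ≤ 1 + s + Y / s := by
    have : 0 ≤ Y := Finset.sum_nonneg fun i _ => by positivity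
    positivity
  calc ∑ i, (1 + (A *ᵥ y) i ^ 4) * (∑ k, R i k * u k) ^ 2
      ≤ ∑ i, (1 + s + Y / s) * (∑ k, R i k * u k) ^ 2 :=
        Finset.sum_le_sum fun i _ => mul_le_mul_of_nonneg_right (hw i) (sq_nonneg _)
    _ = (1 + s + Y / s) * ∑ i, (∑ k, R i k * u k) ^ 2 := by rw [Finset.mul_sum]
    _ ≤ _ := mul_le_mul_of_nonneg_left (hR.1 u) hw0

lemma sum_one_add_pow_six_le (e : Fin n → ℝ) :
    ∑ i, (1 + e i ^ 6) ≤ 2 * ∑ i, (1 + e i ^ 8) := by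
  rw [Finset.mul_sum]
  refine Finset.sum_le_sum fun i _ => ?_
  have : 0 ≤ e i ^ 2 := sq_nonneg _
  nlinarith [mul_nonneg (sq_nonneg (e i ^ 2 - 1)) (sq_nonneg (e i)), sq_nonneg (e i ^ 2 - 1),
    mul_nonneg (sq_nonneg (e i ^ 3 - e i)) (sq_nonneg (e i)), sq_nonneg (e i ^ 4 - 1),
    sq_nonneg (e i ^ 4 - e i ^ 2)]

/-- The part of the increments of `pairForm` in which only one of the two factors is varied. -/
lemma sum_sq_increment_left_le (hA : OpBound A C) (hC : 1 ≤ C) (hτ1 : 1 ≤ τ)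
    (hR : OpBound R S) (hR' : OpBound R' S) (hS : 0 ≤ S) (hc : ∀ i l, |c i l| ≤ K)
    (hc' : ∀ i l, |c' i l| ≤ K) {y : Fin n → ℝ} (hy : ∀ j, |y j| ≤ τ) {b : ℕ} (hb : b ≤ 5)
    {s : ℝ} (hs : 0 < s) :
    ∑ j, (∑ k, y k ^ b * ((cubForm A R c k y - cubForm A R c k (Function.update y j 0))
        * cubForm A R' c' k y)) ^ 2
      ≤ incConst C τ K * τ ^ 10 * S ^ 2 * 32 * K ^ 2 *
        ((1 + s) * ∑ i, (1 + (A *ᵥ y) i ^ 8) + (∑ i, (1 + (A *ᵥ y) i ^ 8)) ^ 2 / s) := by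
  have h := sum_sq_sum_cubForm_sub_mul_le hA hC hτ1 hR hc hy
    (fun k => y k ^ b * cubForm A R' c' k y) hs
  have hD := incConst_nonneg (C := C) (τ := τ) (K := K)
  set Y := ∑ i, (1 + (A *ᵥ y) i ^ 8) with hY
  have hY0 : 0 ≤ Y := Finset.sum_nonneg fun i _ => by positivity
  have hu : ∑ k, (y k ^ b * cubForm A R' c' k y) ^ 2 ≤ τ ^ 10 * (S * (16 * K ^ 2 * (2 * Y))) := by
    calc ∑ k, (y k ^ b * cubForm A R' c' k y) ^ 2 ≤ ∑ k, τ ^ 10 * cubForm A R' c' k y ^ 2 := by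
          refine Finset.sum_le_sum fun k _ => ?_
          rw [mul_pow]
          refine mul_le_mul_of_nonneg_right ?_ (sq_nonneg _)
          calc (y k ^ b) ^ 2 = |y k| ^ (b * 2) := by rw [← pow_mul, Even.pow_abs ⟨b, by ring⟩]
            _ ≤ τ ^ (b * 2) := pow_le_pow_left₀ (abs_nonneg _) (hy k) _
            _ ≤ τ ^ 10 := pow_le_pow_right₀ hτ1 (by omega)
      _ = τ ^ 10 * ∑ k, cubForm A R' c' k y ^ 2 := by rw [Finset.mul_sum]
      _ ≤ τ ^ 10 * (S * (16 * K ^ 2 * ∑ i, (1 + (A *ᵥ y) i ^ 6))) := by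
          gcongr; exact sum_sq_cubForm_le hR' hS hc' y
      _ ≤ _ := by
          gcongr; exact sum_one_add_pow_six_le _
  have e : ∀ j, ∑ k, y k ^ b * ((cubForm A R c k y - cubForm A R c k (Function.update y j 0))
        * cubForm A R' c' k y) =
      ∑ k, (cubForm A R c k y - cubForm A R c k (Function.update y j 0)) *
        (y k ^ b * cubForm A R' c' k y) :=
    fun j => Finset.sum_congr rfl fun k _ => by ring
  simp only [e]
  refine h.trans ?_
  calc incConst C τ K * ((1 + s + Y / s) * (S * ∑ k, (y k ^ b * cubForm A R' c' k y) ^ 2))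
      ≤ incConst C τ K * ((1 + s + Y / s) * (S * (τ ^ 10 * (S * (16 * K ^ 2 * (2 * Y)))))) := by
        gcongr
    _ = _ := by field_simp; ring

/-- The part of the increments of `pairForm` in which both factors are varied. -/
lemma sum_sq_increment_both_le (hA : OpBound A C) (hC : 1 ≤ C) (hτ1 : 1 ≤ τ)
    (hR : OpBound R S) (hR' : OpBound R' S) (hS : 0 ≤ S) (hc : ∀ i l, |c i l| ≤ K)
    (hc' : ∀ i l, |c' i l| ≤ K) {y : Fin n → ℝ} (hy : ∀ j, |y j| ≤ τ) {b : ℕ} (hb : b ≤ 5) :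
    ∑ j, (∑ k, y k ^ b * ((cubForm A R c k y - cubForm A R c k (Function.update y j 0))
        * (cubForm A R' c' k y - cubForm A R' c' k (Function.update y j 0)))) ^ 2
      ≤ τ ^ 10 * S ^ 2 * incConst C τ K ^ 2 * (2 * C ^ 2 * ∑ i, (1 + (A *ᵥ y) i ^ 8)) := by
  have hD := incConst_nonneg (C := C) (τ := τ) (K := K)
  refine le_trans ?_ (mul_le_mul_of_nonneg_left
    (sum_sum_sq_weight_le hA (by linarith) y) (by positivity))
  rw [Finset.mul_sum]
  refine Finset.sum_le_sum fun j _ => ?_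
  set w := ∑ i, A i j ^ 2 * (1 + (A *ᵥ y) i ^ 4)
  have h1 := sum_sq_cubForm_sub_le hA hC hτ1 hR hS hc hy j
  have h2 := sum_sq_cubForm_sub_le hA hC hτ1 hR' hS hc' hy j
  set d := fun k => cubForm A R c k y - cubForm A R c k (Function.update y j 0)
  set d' := fun k => cubForm A R' c' k y - cubForm A R' c' k (Function.update y j 0)
  have hcs := Finset.sum_mul_sq_le_sq_mul_sq Finset.univ (fun k => y k ^ b * d k) d'
  have hw : ∑ k, (y k ^ b * d k) ^ 2 ≤ τ ^ 10 * ∑ k, d k ^ 2 := by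
    rw [Finset.mul_sum]
    refine Finset.sum_le_sum fun k _ => ?_
    rw [mul_pow]
    refine mul_le_mul_of_nonneg_right ?_ (sq_nonneg _)
    calc (y k ^ b) ^ 2 = |y k| ^ (b * 2) := by rw [← pow_mul, Even.pow_abs ⟨b, by ring⟩]
      _ ≤ τ ^ (b * 2) := pow_le_pow_left₀ (abs_nonneg _) (hy k) _
      _ ≤ τ ^ 10 := pow_le_pow_right₀ hτ1 (by omega)
  have hd0 : 0 ≤ ∑ k, d k ^ 2 := Finset.sum_nonneg fun _ _ => sq_nonneg _
  have hd0' : 0 ≤ ∑ k, d' k ^ 2 := Finset.sum_nonneg fun _ _ => sq_nonneg _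
  calc (∑ k, y k ^ b * (d k * d' k)) ^ 2 = (∑ k, y k ^ b * d k * d' k) ^ 2 := by
        simp only [mul_assoc]
    _ ≤ (∑ k, (y k ^ b * d k) ^ 2) * ∑ k, d' k ^ 2 := hcs
    _ ≤ (τ ^ 10 * (S * (incConst C τ K * w))) * (S * (incConst C τ K * w)) := by
        refine mul_le_mul (hw.trans ?_) h2 hd0' ?_
        · gcongr
        · exact mul_nonneg (by positivity) (hd0.trans h1)
    _ = _ := by ring

/-- The part of the increments of `pairForm` that comes from the outer factor `y k ^ b`. -/
lemma sum_sq_increment_diag_le (hA : OpBound A C) (hC : 1 ≤ C) (hτ1 : 1 ≤ τ)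
    (hR : OpBound R S) (hR' : OpBound R' S) (hS : 0 ≤ S) (hc : ∀ i l, |c i l| ≤ K)
    (hc' : ∀ i l, |c' i l| ≤ K) {y : Fin n → ℝ} (hy : ∀ j, |y j| ≤ τ) {b : ℕ} (hb : b ≤ 5) :
    ∑ j, ((y j ^ b - 0 ^ b) * (cubForm A R c j (Function.update y j 0)
        * cubForm A R' c' j (Function.update y j 0))) ^ 2
      ≤ 16 * τ ^ 10 * (∑ k, (cubForm A R c k y ^ 4 + cubForm A R' c' k y ^ 4)
        + 2 * S ^ 2 * incConst C τ K ^ 2 * (2 * C ^ 2 * ∑ i, (1 + (A *ᵥ y) i ^ 8))) := by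
  have hD := incConst_nonneg (C := C) (τ := τ) (K := K)
  have hτ10 : (0 : ℝ) ≤ 16 * τ ^ 10 := by positivity
  refine le_trans ?_ (mul_le_mul_of_nonneg_left (add_le_add le_rfl (mul_le_mul_of_nonneg_left
    (sum_sum_sq_weight_le hA (by linarith) y) (by positivity))) hτ10)
  rw [Finset.mul_sum (a := 2 * S ^ 2 * incConst C τ K ^ 2), ← Finset.sum_add_distrib,
    Finset.mul_sum]
  refine Finset.sum_le_sum fun j _ => ?_
  set w := ∑ i, A i j ^ 2 * (1 + (A *ᵥ y) i ^ 4) with hw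
  have hw0 : 0 ≤ w := Finset.sum_nonneg fun i _ => by positivity
  have hyb : (y j ^ b - 0 ^ b) ^ 2 ≤ 4 * τ ^ 10 := by
    have h1 : |y j ^ b| ≤ τ ^ 5 := by
      rw [abs_pow]
      exact (pow_le_pow_left₀ (abs_nonneg _) (hy j) _).trans (pow_le_pow_right₀ hτ1 hb)
    have h2 : |(0 : ℝ) ^ b| ≤ τ ^ 5 := by
      rw [abs_pow, abs_zero]
      exact (pow_le_one₀ le_rfl zero_le_one).trans (one_le_pow₀ hτ1)
    have h3 : |y j ^ b - 0 ^ b| ≤ 2 * τ ^ 5 := (abs_sub _ _).trans (by linarith)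
    calc (y j ^ b - 0 ^ b) ^ 2 ≤ (2 * τ ^ 5) ^ 2 := sq_le_sq' (abs_le.1 h3).1 (abs_le.1 h3).2
      _ = _ := by ring
  have one : ∀ {R : Matrix (Fin n) (Fin n) ℝ} {c : Fin n → Fin 4 → ℝ}, OpBound R S →
      (∀ i l, |c i l| ≤ K) → cubForm A R c j (Function.update y j 0) ^ 4 ≤
        8 * (cubForm A R c j y ^ 4 + S ^ 2 * incConst C τ K ^ 2 * w ^ 2) := by
    intro R c hR hc
    have h := sum_sq_cubForm_sub_le hA hC hτ1 hR hS hc hy j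
    have h1 : (cubForm A R c j y - cubForm A R c j (Function.update y j 0)) ^ 2
        ≤ S * (incConst C τ K * w) := (Finset.single_le_sum
      (f := fun k => (cubForm A R c k y - cubForm A R c k (Function.update y j 0)) ^ 2)
      (fun _ _ => sq_nonneg _) (Finset.mem_univ j)).trans h
    set g := cubForm A R c j y
    set g0 := cubForm A R c j (Function.update y j 0)
    have h2 : ((g - g0) ^ 2) ^ 2 ≤ (S * (incConst C τ K * w)) ^ 2 :=
      pow_le_pow_left₀ (sq_nonneg _) h1 2
    have h3 : g0 ^ 4 ≤ 8 * (g ^ 4 + ((g - g0) ^ 2) ^ 2) := by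
      have a1 : g0 ^ 2 ≤ 2 * (g ^ 2 + (g - g0) ^ 2) := by nlinarith [sq_nonneg (g + (g - g0))]
      have a2 := pow_le_pow_left₀ (sq_nonneg _) a1 2
      nlinarith [sq_nonneg (g ^ 2 - (g - g0) ^ 2)]
    calc g0 ^ 4 ≤ 8 * (g ^ 4 + ((g - g0) ^ 2) ^ 2) := h3
      _ ≤ 8 * (g ^ 4 + (S * (incConst C τ K * w)) ^ 2) := by gcongr
      _ = _ := by ring
  have h1 := one hR hc
  have h2 := one hR' hc'
  set g0 := cubForm A R c j (Function.update y j 0)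
  set g0' := cubForm A R' c' j (Function.update y j 0)
  calc ((y j ^ b - 0 ^ b) * (g0 * g0')) ^ 2 = (y j ^ b - 0 ^ b) ^ 2 * (g0 ^ 2 * g0' ^ 2) := by ring
    _ ≤ 4 * τ ^ 10 * ((g0 ^ 4 + g0' ^ 4) / 2) := by
        gcongr
        nlinarith [sq_nonneg (g0 ^ 2 - g0' ^ 2)]
    _ ≤ 4 * τ ^ 10 * ((8 * (cubForm A R c j y ^ 4 + S ^ 2 * incConst C τ K ^ 2 * w ^ 2)
          + 8 * (cubForm A R' c' j y ^ 4 + S ^ 2 * incConst C τ K ^ 2 * w ^ 2)) / 2) := by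
        gcongr
    _ = _ := by ring

lemma sum_sq_add_four_le {f₀ f₁ f₂ f₃ : Fin n → ℝ} {b₀ b₁ b₂ b₃ : ℝ} (h₀ : ∑ j, f₀ j ^ 2 ≤ b₀)
    (h₁ : ∑ j, f₁ j ^ 2 ≤ b₁) (h₂ : ∑ j, f₂ j ^ 2 ≤ b₂) (h₃ : ∑ j, f₃ j ^ 2 ≤ b₃) :
    ∑ j, (f₀ j + f₁ j + f₂ j + -f₃ j) ^ 2 ≤ 4 * (b₀ + b₁ + b₂ + b₃) := by
  calc ∑ j, (f₀ j + f₁ j + f₂ j + -f₃ j) ^ 2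
      ≤ ∑ j, 4 * (f₀ j ^ 2 + f₁ j ^ 2 + f₂ j ^ 2 + (-f₃ j) ^ 2) :=
        Finset.sum_le_sum fun j _ => sq_sum_four_le _ _ _ _
    _ = 4 * (∑ j, f₀ j ^ 2 + ∑ j, f₁ j ^ 2 + ∑ j, f₂ j ^ 2 + ∑ j, f₃ j ^ 2) := by
        simp only [neg_sq, ← Finset.mul_sum, Finset.sum_add_distrib]
    _ ≤ _ := by linarith

lemma pairForm_sub (y : Fin n → ℝ) (b : ℕ) (j : Fin n) :
    pairForm A R R' c c' b y - pairForm A R R' c c' b (Function.update y j 0)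
      = (y j ^ b - 0 ^ b) * (cubForm A R c j (Function.update y j 0)
          * cubForm A R' c' j (Function.update y j 0))
        + ∑ k, y k ^ b * ((cubForm A R c k y - cubForm A R c k (Function.update y j 0))
          * cubForm A R' c' k y)
        + ∑ k, y k ^ b * ((cubForm A R' c' k y - cubForm A R' c' k (Function.update y j 0))
          * cubForm A R c k y)
        + -∑ k, y k ^ b * ((cubForm A R c k y - cubForm A R c k (Function.update y j 0))
          * (cubForm A R' c' k y - cubForm A R' c' k (Function.update y j 0))) := by
  have h0 : (y j ^ b - 0 ^ b) * (cubForm A R c j (Function.update y j 0)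
      * cubForm A R' c' j (Function.update y j 0)) =
      ∑ k, (y k ^ b - Function.update y j 0 k ^ b) * (cubForm A R c k (Function.update y j 0)
      * cubForm A R' c' k (Function.update y j 0)) := by
    rw [Finset.sum_eq_single j]
    · simp
    · intro k _ hk; simp [Function.update_of_ne hk]
    · simp
  rw [h0, ← Finset.sum_neg_distrib, ← Finset.sum_add_distrib, ← Finset.sum_add_distrib,
    ← Finset.sum_add_distrib]
  unfold pairForm
  rw [← Finset.sum_sub_distrib]
  refine Finset.sum_congr rfl fun k _ => by ring

/-- The Efron–Stein bound for the variance of `pairForm`, before taking expectations. The parameter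
`s` comes from the bound `e ^ 4 ≤ s + e ^ 8 / s` for the weights; it is to be chosen of order `√n`. -/
lemma sum_sq_pairForm_sub_le (hC : 1 ≤ C) (hτ1 : 1 ≤ τ) (hS : 0 ≤ S) :
    ∃ L, 0 ≤ L ∧ ∀ {n : ℕ} {A R R' : Matrix (Fin n) (Fin n) ℝ} {c c' : Fin n → Fin 4 → ℝ}
      {b : ℕ} {y : Fin n → ℝ} {s : ℝ}, OpBound A C → OpBound R S → OpBound R' S →
      (∀ i l, |c i l| ≤ K) → (∀ i l, |c' i l| ≤ K) → b ≤ 5 → (∀ j, |y j| ≤ τ) → 0 < s →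
      ∑ j, (pairForm A R R' c c' b y - pairForm A R R' c c' b (Function.update y j 0)) ^ 2
        ≤ L * ((2 + s) * ∑ i, (1 + (A *ᵥ y) i ^ 8) + (∑ i, (1 + (A *ᵥ y) i ^ 8)) ^ 2 / s
          + ∑ k, (cubForm A R c k y ^ 4 + cubForm A R' c' k y ^ 4)) := by
  have hD := incConst_nonneg (C := C) (τ := τ) (K := K)
  obtain ⟨D, hDdef⟩ : ∃ D, D = incConst C τ K := ⟨_, rfl⟩
  rw [← hDdef] at hD
  obtain ⟨L1, hL1⟩ : ∃ L1, L1 = D * τ ^ 10 * S ^ 2 * 32 * K ^ 2 := ⟨_, rfl⟩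
  obtain ⟨L3, hL3⟩ : ∃ L3, L3 = τ ^ 10 * S ^ 2 * D ^ 2 * (2 * C ^ 2) := ⟨_, rfl⟩
  have hL1' : 0 ≤ L1 := by rw [hL1]; positivity
  have hL3' : 0 ≤ L3 := by rw [hL3]; positivity
  have hτ10 : 0 ≤ τ ^ 10 := by positivity
  refine ⟨4 * (16 * τ ^ 10 + 32 * L3 + 2 * L1 + L3), by positivity, ?_⟩
  intro n A R R' c c' b y s hA hR hR' hc hc' hb hy hs
  have t0 := sum_sq_increment_diag_le hA hC hτ1 hR hR' hS hc hc' hy hb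
  have t1 := sum_sq_increment_left_le hA hC hτ1 hR hR' hS hc hc' hy hb hs
  have t2 := sum_sq_increment_left_le hA hC hτ1 hR' hR hS hc' hc hy hb hs
  have t3 := sum_sq_increment_both_le hA hC hτ1 hR hR' hS hc hc' hy hb
  rw [← hDdef] at t0 t1 t2 t3
  set Y := ∑ i, (1 + (A *ᵥ y) i ^ 8) with hY
  set G := ∑ k, (cubForm A R c k y ^ 4 + cubForm A R' c' k y ^ 4) with hG
  have hY0 : 0 ≤ Y := Finset.sum_nonneg fun i _ => by positivity
  have hG0 : 0 ≤ G := Finset.sum_nonneg fun k _ =>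
    add_nonneg (Even.pow_nonneg (by decide) _) (Even.pow_nonneg (by decide) _)
  have hYs : 0 ≤ Y ^ 2 / s := div_nonneg (sq_nonneg _) hs.le
  have hsY : 0 ≤ s * Y := mul_nonneg hs.le hY0
  clear_value Y G
  have hsum : ∑ j, (pairForm A R R' c c' b y - pairForm A R R' c c' b (Function.update y j 0)) ^ 2
      ≤ 4 * (16 * τ ^ 10 * (G + 2 * S ^ 2 * D ^ 2 * (2 * C ^ 2 * Y))
          + D * τ ^ 10 * S ^ 2 * 32 * K ^ 2 * ((1 + s) * Y + Y ^ 2 / s)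
          + D * τ ^ 10 * S ^ 2 * 32 * K ^ 2 * ((1 + s) * Y + Y ^ 2 / s)
          + τ ^ 10 * S ^ 2 * D ^ 2 * (2 * C ^ 2 * Y)) := by
    simp only [pairForm_sub]
    exact sum_sq_add_four_le t0 t1 t2 t3
  refine hsum.trans ?_
  clear hsum t0 t1 t2 t3
  calc _ = 4 * (16 * τ ^ 10 * G + 32 * L3 * Y + 2 * L1 * ((1 + s) * Y + Y ^ 2 / s) + L3 * Y) := by
        rw [hL1, hL3]; ring
    _ ≤ 4 * (16 * τ ^ 10 * ((2 + s) * Y + Y ^ 2 / s + G)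
          + 32 * L3 * ((2 + s) * Y + Y ^ 2 / s + G)
          + 2 * L1 * ((2 + s) * Y + Y ^ 2 / s + G) + L3 * ((2 + s) * Y + Y ^ 2 / s + G)) := by
        have h1 : (1 + s) * Y + Y ^ 2 / s ≤ (2 + s) * Y + Y ^ 2 / s + G := by linarith
        have h2 : Y ≤ (2 + s) * Y + Y ^ 2 / s + G := by linarith
        have h3 : G ≤ (2 + s) * Y + Y ^ 2 / s + G := by linarith
        gcongr
    _ = _ := by ring

end PairForm

/-! ### Moment and variance bounds for sums of cubic polynomials -/

lemma sq_sum_mul_le_sum_abs_mul {ι : Type*} (s : Finset ι) (r v : ι → ℝ) :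
    (∑ k ∈ s, r k * v k) ^ 2 ≤ (∑ k ∈ s, |r k|) * ∑ k ∈ s, |r k| * v k ^ 2 := by
  have := Finset.sum_mul_sq_le_sq_mul_sq s (fun k => √|r k|) (fun k => √|r k| * |v k|)
  have e1 : ∀ k, √|r k| * (√|r k| * |v k|) = |r k * v k| := fun k => by
    rw [← mul_assoc, Real.mul_self_sqrt (abs_nonneg _), abs_mul]
  have e2 : ∀ k, √|r k| ^ 2 = |r k| := fun k => Real.sq_sqrt (abs_nonneg _)
  simp only [e1, mul_pow, e2, sq_abs] at this
  refine le_trans ?_ this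
  rw [← sq_abs]
  exact pow_le_pow_left₀ (abs_nonneg _) (Finset.abs_sum_le_sum_abs _ _) 2

section Moments

variable {n : ℕ} {ν : Measure ℝ} [IsProbabilityMeasure ν] {τ C K S M : ℝ}
  {A R R' : Matrix (Fin n) (Fin n) ℝ} {c c' : Fin n → Fin 4 → ℝ}

lemma integral_mulVec_pow_le (hτ : ∀ᵐ y ∂ν, |y| ≤ τ) (hsymm : ν.map (fun x => -x) = ν)
    (hA : OpBound A C) (i : Fin n) :
    ∫ y, (A *ᵥ y) i ^ 16 ∂(Measure.pi fun _ => ν)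
      ≤ 2 * (16 : ℕ).factorial * Real.exp (C * τ ^ 2 / 2) :=
  integral_linear_pow_le hτ hsymm (hA.row_le i)

lemma pow_le_one_add_pow {x : ℝ} {a b : ℕ} (hab : a ≤ b) (ha : Even a) (hb : Even b) :
    x ^ a ≤ 1 + x ^ b := by
  rw [← ha.pow_abs, ← hb.pow_abs]
  rcases le_total |x| 1 with h | h
  · have := pow_le_one₀ (n := a) (abs_nonneg x) h
    have := pow_nonneg (abs_nonneg x) b
    linarith
  · have := pow_le_pow_right₀ h hab
    linarith

lemma integral_mulVec_pow_le_of_even (hτ : ∀ᵐ y ∂ν, |y| ≤ τ)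
    (hM : ∀ i, ∫ y, (A *ᵥ y) i ^ 16 ∂(Measure.pi fun _ => ν) ≤ M) (i : Fin n) {a : ℕ}
    (ha : Even a) (ha' : a ≤ 16) :
    ∫ y, (A *ᵥ y) i ^ a ∂(Measure.pi fun _ => ν) ≤ 1 + M := by
  have hi : ∀ a, Integrable (fun y => (A *ᵥ y) i ^ a) (Measure.pi fun _ => ν) :=
    fun a => integrable_of_continuous hτ ((continuous_mulVec_apply A i).pow a)
  calc ∫ y, (A *ᵥ y) i ^ a ∂(Measure.pi fun _ => ν)
      ≤ ∫ y, (1 + (A *ᵥ y) i ^ 16) ∂(Measure.pi fun _ => ν) :=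
        integral_mono (hi a) ((integrable_const 1).add (hi 16))
          fun y => pow_le_one_add_pow ha' ha (by decide)
    _ = 1 + ∫ y, (A *ᵥ y) i ^ 16 ∂(Measure.pi fun _ => ν) := by
        rw [integral_add (integrable_const 1) (hi 16)]; simp
    _ ≤ 1 + M := by linarith [hM i]

/-- Rows with bounded absolute sums: the fourth moments are bounded by Jensen's inequality. -/
lemma integral_cubForm_pow_four_le_of_abs_sum (hτ : ∀ᵐ y ∂ν, |y| ≤ τ)
    (hM : ∀ i, ∫ y, (A *ᵥ y) i ^ 16 ∂(Measure.pi fun _ => ν) ≤ M) (hM0 : 0 ≤ M)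
    (hS : 0 ≤ S) (hc : ∀ i l, |c i l| ≤ K) (k : Fin n) (hR : ∑ i, |R i k| ≤ S) :
    ∫ y, cubForm A R c k y ^ 4 ∂(Measure.pi fun _ => ν) ≤ S ^ 4 * (512 * K ^ 4 * (2 + M)) := by
  set P : Measure (Fin n → ℝ) := Measure.pi fun _ => ν
  have hcm := continuous_mulVec_apply A
  have hpt : ∀ y, cubForm A R c k y ^ 4
      ≤ S ^ 3 * ∑ i, |R i k| * (512 * K ^ 4 * (1 + (A *ᵥ y) i ^ 12)) := by
    intro y
    have h0 : ∀ i, 0 ≤ |R i k| := fun i => abs_nonneg _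
    have h1 := sq_sum_mul_le_sum_abs_mul Finset.univ (fun i => R i k)
      (fun i => cub (c i) ((A *ᵥ y) i))
    have h2 := sq_sum_mul_le_sum_abs_mul Finset.univ (fun i => |R i k|)
      (fun i => cub (c i) ((A *ᵥ y) i) ^ 2)
    simp only [abs_abs] at h2
    set X := ∑ i, |R i k| * cub (c i) ((A *ᵥ y) i) ^ 2 with hX
    have hX0 : 0 ≤ X := Finset.sum_nonneg fun i _ => mul_nonneg (h0 i) (sq_nonneg _)
    have hp : ∀ i, (cub (c i) ((A *ᵥ y) i) ^ 2) ^ 2 ≤ 512 * K ^ 4 * (1 + (A *ᵥ y) i ^ 12) := by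
      intro i
      have := pow_le_pow_left₀ (sq_nonneg _) (cub_sq_le (hc i) ((A *ᵥ y) i)) 2
      refine this.trans ?_
      have hK : 0 ≤ K ^ 4 := by positivity
      have : (1 + (A *ᵥ y) i ^ 6) ^ 2 ≤ 2 * (1 + (A *ᵥ y) i ^ 12) := by
        nlinarith [sq_nonneg (1 - (A *ᵥ y) i ^ 6)]
      calc (16 * K ^ 2 * (1 + (A *ᵥ y) i ^ 6)) ^ 2 = 256 * K ^ 4 * (1 + (A *ᵥ y) i ^ 6) ^ 2 := by
            ring
        _ ≤ 256 * K ^ 4 * (2 * (1 + (A *ᵥ y) i ^ 12)) := by gcongr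
        _ = _ := by ring
    have h3 : ∑ i, |R i k| * (cub (c i) ((A *ᵥ y) i) ^ 2) ^ 2
        ≤ ∑ i, |R i k| * (512 * K ^ 4 * (1 + (A *ᵥ y) i ^ 12)) :=
      Finset.sum_le_sum fun i _ => mul_le_mul_of_nonneg_left (hp i) (h0 i)
    have h30 : 0 ≤ ∑ i, |R i k| * (cub (c i) ((A *ᵥ y) i) ^ 2) ^ 2 :=
      Finset.sum_nonneg fun i _ => mul_nonneg (h0 i) (sq_nonneg _)
    have hR0 : 0 ≤ ∑ i, |R i k| := Finset.sum_nonneg fun i _ => h0 i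
    calc cubForm A R c k y ^ 4 = ((∑ i, R i k * cub (c i) ((A *ᵥ y) i)) ^ 2) ^ 2 := by
          unfold cubForm; ring
      _ ≤ ((∑ i, |R i k|) * X) ^ 2 := pow_le_pow_left₀ (sq_nonneg _) h1 2
      _ ≤ (S * X) ^ 2 := pow_le_pow_left₀ (by positivity) (by gcongr) 2
      _ = S ^ 2 * X ^ 2 := by ring
      _ ≤ S ^ 2 * (S * ∑ i, |R i k| * (512 * K ^ 4 * (1 + (A *ᵥ y) i ^ 12))) := by
          gcongr
          exact h2.trans (mul_le_mul hR h3 h30 hS)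
      _ = _ := by ring
  have hi : ∀ i a, Integrable (fun y => (A *ᵥ y) i ^ a) P :=
    fun i a => integrable_of_continuous hτ ((hcm i).pow a)
  have hi2 : ∀ i, Integrable (fun y => |R i k| * (512 * K ^ 4 * (1 + (A *ᵥ y) i ^ 12))) P :=
    fun i => integrable_of_continuous hτ (by fun_prop)
  calc ∫ y, cubForm A R c k y ^ 4 ∂P
      ≤ ∫ y, S ^ 3 * ∑ i, |R i k| * (512 * K ^ 4 * (1 + (A *ᵥ y) i ^ 12)) ∂P :=
        integral_mono (integrable_of_continuous hτ ((continuous_cubForm A R c k).pow 4))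
          (integrable_of_continuous hτ (by fun_prop)) hpt
    _ = S ^ 3 * ∑ i, |R i k| * (512 * K ^ 4 * (1 + ∫ y, (A *ᵥ y) i ^ 12 ∂P)) := by
        rw [integral_const_mul, integral_finsetSum _ fun i _ => hi2 i]
        congr 1
        refine Finset.sum_congr rfl fun i _ => ?_
        rw [integral_const_mul, integral_const_mul, integral_add (integrable_const 1) (hi i 12)]
        simp [P]
    _ ≤ S ^ 3 * ∑ i, |R i k| * (512 * K ^ 4 * (2 + M)) := by
        have hK : 0 ≤ K ^ 4 := by positivity
        refine mul_le_mul_of_nonneg_left (Finset.sum_le_sum fun i _ => ?_) (by positivity)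
        have := integral_mulVec_pow_le_of_even hτ hM i (a := 12) (by decide) (by norm_num)
        refine mul_le_mul_of_nonneg_left (mul_le_mul_of_nonneg_left ?_ (by positivity))
          (abs_nonneg _)
        linarith
    _ = S ^ 3 * ((∑ i, |R i k|) * (512 * K ^ 4 * (2 + M))) := by rw [Finset.sum_mul]
    _ ≤ S ^ 3 * (S * (512 * K ^ 4 * (2 + M))) := by
        have hK : 0 ≤ K ^ 4 := by positivity
        gcongr
    _ = _ := by ring

lemma integral_eq_zero_of_odd (hsymm : ν.map (fun x => -x) = ν) {F : (Fin n → ℝ) → ℝ}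
    (hF : ∀ y, F (-y) = -F y) : ∫ y, F y ∂(Measure.pi fun _ => ν) = 0 := by
  have mp : MeasurePreserving (fun x : ℝ => -x) ν ν := ⟨measurable_neg, hsymm⟩
  have h := measurePreserving_pi (fun _ : Fin n => ν) (fun _ => ν) (f := fun _ x => -x)
    (fun _ => mp)
  have h2 : ∫ y, F y ∂(Measure.pi fun _ => ν) = ∫ y, F (-y) ∂(Measure.pi fun _ => ν) := by
    have := h.integral_comp (MeasurableEquiv.neg (Fin n → ℝ)).measurableEmbedding F
    exact this.symm
  simp only [hF, integral_neg] at h2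
  linarith

/-- Odd polynomials: here the sum over `i` is not absolutely bounded, and the fourth moment is
bounded because the mean vanishes by symmetry. -/
lemma integral_cubForm_pow_four_le_of_odd (hτ : ∀ᵐ y ∂ν, |y| ≤ τ) (hτ1 : 1 ≤ τ)
    (hsymm : ν.map (fun x => -x) = ν) (hA : OpBound A C) (hC : 1 ≤ C)
    (hM : ∀ i, ∫ y, (A *ᵥ y) i ^ 16 ∂(Measure.pi fun _ => ν) ≤ M)
    (hS : 0 ≤ S) (hc : ∀ i l, |c i l| ≤ K) (hc0 : ∀ i, c i 0 = 0) (hc2 : ∀ i, c i 2 = 0)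
    (k : Fin n) (hR : OpBound R S) :
    ∫ y, cubForm A R c k y ^ 4 ∂(Measure.pi fun _ => ν)
      ≤ 272 * (incConst C τ K ^ 2 * (S * (2 * (S * (2 + M))))) := by
  set P : Measure (Fin n → ℝ) := Measure.pi fun _ => ν
  have hcm := continuous_mulVec_apply A
  have h0 : ∫ y, cubForm A R c k y ∂P = 0 := by
    refine integral_eq_zero_of_odd hsymm fun y => ?_
    unfold cubForm cub
    rw [← Finset.sum_neg_distrib]
    refine Finset.sum_congr rfl fun i _ => ?_
    rw [Matrix.mulVec_neg, hc0, hc2]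
    simp only [Pi.neg_apply]; ring
  refine (integral_pow_four_le hτ (continuous_cubForm A R c k) h0).trans ?_
  have hM2 : 0 ≤ 2 + M := by
    have := integral_nonneg (μ := P) (f := fun y => (A *ᵥ y) k ^ 16)
      (fun y => Even.pow_nonneg (by decide) _)
    linarith [hM k]
  refine mul_le_mul_of_nonneg_left ?_ (by norm_num)
  have hpt : ∀ᵐ y ∂P, (∑ j, (cubForm A R c k y - cubForm A R c k (Function.update y j 0)) ^ 2) ^ 2
      ≤ incConst C τ K ^ 2 * (S * (2 * ∑ i, R i k ^ 2 * (1 + (A *ᵥ y) i ^ 8))) := by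
    filter_upwards [ae_pi_abs_le hτ] with y hy
    have h := sum_sq_sum_mul_cub_sub_le hA hC hτ1 hc hy (fun i => R i k)
    simp only [← cubForm_sub] at h
    have h2 := pow_le_pow_left₀ (Finset.sum_nonneg fun _ _ => sq_nonneg _) h 2
    refine h2.trans ?_
    rw [mul_pow]
    refine mul_le_mul_of_nonneg_left ?_ (sq_nonneg _)
    have hcs := Finset.sum_mul_sq_le_sq_mul_sq Finset.univ (fun i => R i k)
      (fun i => R i k * (1 + (A *ᵥ y) i ^ 4))
    have e1 : ∀ i, R i k * (R i k * (1 + (A *ᵥ y) i ^ 4)) = (1 + (A *ᵥ y) i ^ 4) * R i k ^ 2 :=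
      fun i => by ring
    simp only [e1] at hcs
    refine hcs.trans (mul_le_mul (hR.col_le k) ?_ (Finset.sum_nonneg fun _ _ => sq_nonneg _) hS)
    rw [Finset.mul_sum]
    refine Finset.sum_le_sum fun i _ => ?_
    have : 0 ≤ R i k ^ 2 * (1 - (A *ᵥ y) i ^ 4) ^ 2 := by positivity
    nlinarith
  have hi : ∀ i a, Integrable (fun y => (A *ᵥ y) i ^ a) P :=
    fun i a => integrable_of_continuous hτ ((hcm i).pow a)
  have hi2 : ∀ i, Integrable (fun y => R i k ^ 2 * (1 + (A *ᵥ y) i ^ 8)) P :=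
    fun i => integrable_of_continuous hτ (by fun_prop)
  have hcf := continuous_cubForm A R c k
  have hcu : ∀ j, Continuous fun y => cubForm A R c k (Function.update y j 0) :=
    fun j => hcf.comp (continuous_update_zero j)
  calc ∫ y, (∑ j, (cubForm A R c k y - cubForm A R c k (Function.update y j 0)) ^ 2) ^ 2 ∂P
      ≤ ∫ y, incConst C τ K ^ 2 * (S * (2 * ∑ i, R i k ^ 2 * (1 + (A *ᵥ y) i ^ 8))) ∂P :=
        integral_mono_ae (integrable_of_continuous hτ
          ((continuous_finsetSum _ fun j _ => (hcf.sub (hcu j)).pow 2).pow 2))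
          (integrable_of_continuous hτ (by fun_prop)) hpt
    _ = incConst C τ K ^ 2 * (S * (2 * ∑ i, R i k ^ 2 * (1 + ∫ y, (A *ᵥ y) i ^ 8 ∂P))) := by
        rw [integral_const_mul, integral_const_mul, integral_const_mul,
          integral_finsetSum _ fun i _ => hi2 i]
        congr 4
        ext i
        rw [integral_const_mul, integral_add (integrable_const 1) (hi i 8)]
        simp [P]
    _ ≤ incConst C τ K ^ 2 * (S * (2 * ∑ i, R i k ^ 2 * (2 + M))) := by
        have : ∀ i, 1 + ∫ y, (A *ᵥ y) i ^ 8 ∂P ≤ 2 + M := fun i => by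
          linarith [integral_mulVec_pow_le_of_even hτ hM i (a := 8) (by decide) (by norm_num)]
        refine mul_le_mul_of_nonneg_left (mul_le_mul_of_nonneg_left (mul_le_mul_of_nonneg_left
          (Finset.sum_le_sum fun i _ => mul_le_mul_of_nonneg_left (this i) (sq_nonneg _))
          (by norm_num)) hS) (sq_nonneg _)
    _ = incConst C τ K ^ 2 * (S * (2 * ((∑ i, R i k ^ 2) * (2 + M)))) := by rw [Finset.sum_mul]
    _ ≤ _ := by
        gcongr
        exact hR.col_le k

/-- The variance of `pairForm` is of smaller order than `n ^ 2`. -/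
lemma variance_pairForm_le (hC : 1 ≤ C) (hτ1 : 1 ≤ τ) (hS : 0 ≤ S) (hM0 : 0 ≤ M) (K : ℝ)
    {M' : ℝ} (hM' : 0 ≤ M') (hτ : ∀ᵐ y ∂ν, |y| ≤ τ) :
    ∃ L, 0 ≤ L ∧ ∀ {n : ℕ} {A R R' : Matrix (Fin n) (Fin n) ℝ} {c c' : Fin n → Fin 4 → ℝ}
      {b : ℕ}, 0 < n → OpBound A C → OpBound R S → OpBound R' S →
      (∀ i l, |c i l| ≤ K) → (∀ i l, |c' i l| ≤ K) → b ≤ 5 →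
      (∀ i, ∫ y, (A *ᵥ y) i ^ 16 ∂(Measure.pi fun _ => ν) ≤ M) →
      (∀ k, ∫ y, cubForm A R c k y ^ 4 ∂(Measure.pi fun _ => ν) ≤ M') →
      (∀ k, ∫ y, cubForm A R' c' k y ^ 4 ∂(Measure.pi fun _ => ν) ≤ M') →
      Var[pairForm A R R' c c' b; Measure.pi fun _ => ν] ≤ L * (n * √n) := by
  obtain ⟨L, hL0, hL⟩ := sum_sq_pairForm_sub_le (K := K) hC hτ1 hS
  refine ⟨2 * (L * (3 * (2 + M) + 2 * (2 + M) + 2 * M')), by positivity, ?_⟩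
  intro n A R R' c c' b hn hA hR hR' hc hc' hb hM hg hg'
  set P : Measure (Fin n → ℝ) := Measure.pi fun _ => ν
  have hcm := continuous_mulVec_apply A
  have hcf := continuous_cubForm A R c
  have hcf' := continuous_cubForm A R' c'
  have hcp := continuous_pairForm A R R' c c' b
  have hcpu : ∀ j, Continuous fun y => pairForm A R R' c c' b (Function.update y j 0) :=
    fun j => hcp.comp (continuous_update_zero j)
  have hn1 : (1 : ℝ) ≤ n := by exact_mod_cast hn
  have hs1 : 1 ≤ √(n : ℝ) := Real.one_le_sqrt.2 hn1
  -- this choice of the parameter `s` of `sum_sq_pairForm_sub_le` balances `s * n` and `n ^ 2 / s`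
  set s := √(n : ℝ) with hs
  have hs0 : 0 < s := by linarith
  have hss : s * s = n := Real.mul_self_sqrt (by linarith)
  refine (variance_le_of_continuous hτ hcp).trans ?_
  rw [mul_assoc 2]
  refine mul_le_mul_of_nonneg_left ?_ (by norm_num)
  have hi : ∀ i a, Integrable (fun y => (A *ᵥ y) i ^ a) P :=
    fun i a => integrable_of_continuous hτ ((hcm i).pow a)
  have iY : Integrable (fun y => ∑ i, (1 + (A *ᵥ y) i ^ 8)) P :=
    integrable_of_continuous hτ (by fun_prop)
  have iY2 : Integrable (fun y => (∑ i, (1 + (A *ᵥ y) i ^ 8)) ^ 2) P :=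
    integrable_of_continuous hτ (by fun_prop)
  have i4 : ∀ k, Integrable (fun y => cubForm A R c k y ^ 4) P :=
    fun k => integrable_of_continuous hτ (by fun_prop)
  have i4' : ∀ k, Integrable (fun y => cubForm A R' c' k y ^ 4) P :=
    fun k => integrable_of_continuous hτ (by fun_prop)
  have iG : Integrable (fun y => ∑ k, (cubForm A R c k y ^ 4 + cubForm A R' c' k y ^ 4)) P :=
    integrable_of_continuous hτ (by fun_prop)
  have eY : ∫ y, ∑ i, (1 + (A *ᵥ y) i ^ 8) ∂P ≤ n * (2 + M) := by
    have h8 : ∀ i ∈ Finset.univ, Integrable (fun y => 1 + (A *ᵥ y) i ^ 8) P :=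
      fun i _ => (integrable_const 1).add (hi i 8)
    rw [integral_finsetSum _ h8]
    calc ∑ i, ∫ y, (1 + (A *ᵥ y) i ^ 8) ∂P ≤ ∑ _i : Fin n, (2 + M) := by
          refine Finset.sum_le_sum fun i _ => ?_
          rw [integral_add (integrable_const 1) (hi i 8)]
          have := integral_mulVec_pow_le_of_even hτ hM i (a := 8) (by decide) (by norm_num)
          simp only [integral_const, probReal_univ, smul_eq_mul, one_mul]
          linarith
      _ = _ := by simp only [Finset.sum_const, Finset.card_univ, Fintype.card_fin, nsmul_eq_mul]
  have eY2 : ∫ y, (∑ i, (1 + (A *ᵥ y) i ^ 8)) ^ 2 ∂P ≤ n * (n * (2 * (2 + M))) := by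
    calc ∫ y, (∑ i, (1 + (A *ᵥ y) i ^ 8)) ^ 2 ∂P
        ≤ ∫ y, (n : ℝ) * ∑ i, (2 * (1 + (A *ᵥ y) i ^ 16)) ∂P := by
          refine integral_mono iY2 (integrable_of_continuous hτ (by fun_prop)) fun y => ?_
          have := sq_sum_le_card_mul_sum_sq (s := Finset.univ) (f := fun i => 1 + (A *ᵥ y) i ^ 8)
          simp only [Finset.card_univ, Fintype.card_fin] at this
          refine this.trans (mul_le_mul_of_nonneg_left (Finset.sum_le_sum fun i _ => ?_)
            (by positivity))
          nlinarith [sq_nonneg (1 - (A *ᵥ y) i ^ 8)]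
      _ = (n : ℝ) * ∑ i, (2 * (1 + ∫ y, (A *ᵥ y) i ^ 16 ∂P)) := by
          have h16 : ∀ i ∈ Finset.univ, Integrable (fun y => 2 * (1 + (A *ᵥ y) i ^ 16)) P :=
            fun i _ => ((integrable_const 1).add (hi i 16)).const_mul 2
          rw [integral_const_mul, integral_finsetSum _ h16]
          congr 2
          ext i
          rw [integral_const_mul, integral_add (integrable_const 1) (hi i 16)]
          simp [P]
      _ ≤ (n : ℝ) * ∑ _i : Fin n, (2 * (2 + M)) := by
          refine mul_le_mul_of_nonneg_left (Finset.sum_le_sum fun i _ => ?_) (by positivity)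
          linarith [hM i]
      _ = _ := by simp
  have eG : ∫ y, ∑ k, (cubForm A R c k y ^ 4 + cubForm A R' c' k y ^ 4) ∂P ≤ n * (2 * M') := by
    have h44 : ∀ k ∈ Finset.univ,
        Integrable (fun y => cubForm A R c k y ^ 4 + cubForm A R' c' k y ^ 4) P :=
      fun k _ => (i4 k).add (i4' k)
    rw [integral_finsetSum _ h44]
    calc ∑ k, ∫ y, (cubForm A R c k y ^ 4 + cubForm A R' c' k y ^ 4) ∂P
        ≤ ∑ _k : Fin n, 2 * M' := by
          refine Finset.sum_le_sum fun k _ => ?_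
          rw [integral_add (i4 k) (i4' k)]
          linarith [hg k, hg' k]
      _ = _ := by simp
  have i1 : Integrable (fun y => (2 + s) * ∑ i, (1 + (A *ᵥ y) i ^ 8)) P := iY.const_mul _
  have i2 : Integrable (fun y => (∑ i, (1 + (A *ᵥ y) i ^ 8)) ^ 2 / s) P := iY2.div_const _
  have i12 : Integrable (fun y => (2 + s) * ∑ i, (1 + (A *ᵥ y) i ^ 8)
      + (∑ i, (1 + (A *ᵥ y) i ^ 8)) ^ 2 / s) P := i1.add i2
  calc ∫ y, ∑ j, (pairForm A R R' c c' b y - pairForm A R R' c c' b (Function.update y j 0)) ^ 2 ∂P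
      ≤ ∫ y, L * ((2 + s) * ∑ i, (1 + (A *ᵥ y) i ^ 8) + (∑ i, (1 + (A *ᵥ y) i ^ 8)) ^ 2 / s
          + ∑ k, (cubForm A R c k y ^ 4 + cubForm A R' c' k y ^ 4)) ∂P := by
        refine integral_mono_ae (integrable_of_continuous hτ
          (continuous_finsetSum _ fun j _ => (hcp.sub (hcpu j)).pow 2))
          (((i12.add iG).const_mul L)) ?_
        filter_upwards [ae_pi_abs_le hτ] with y hy
        exact hL hA hR hR' hc hc' hb hy hs0
    _ = L * ((2 + s) * ∫ y, ∑ i, (1 + (A *ᵥ y) i ^ 8) ∂P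
          + (∫ y, (∑ i, (1 + (A *ᵥ y) i ^ 8)) ^ 2 ∂P) / s
          + ∫ y, ∑ k, (cubForm A R c k y ^ 4 + cubForm A R' c' k y ^ 4) ∂P) := by
        rw [integral_const_mul, integral_add i12 iG, integral_add i1 i2, integral_const_mul,
          integral_div]
    _ ≤ L * ((2 + s) * (n * (2 + M)) + (n * (n * (2 * (2 + M)))) / s + n * (2 * M')) := by
        gcongr
    _ ≤ L * ((3 * s) * (n * (2 + M)) + n * s * (2 * (2 + M)) + n * s * (2 * M')) := by
        have e : (n * (n * (2 * (2 + M)))) / s = n * s * (2 * (2 + M)) := by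
          rw [div_eq_iff hs0.ne']; rw [← hss]; ring
        rw [e]
        gcongr
        · linarith
        · nlinarith
    _ = _ := by ring

end Moments

/-! ### The quartic form and its decomposition into coordinatewise centered terms -/

/-- The statistic `∑ i, e i ^ 4 - r * ∑ i, e i ^ 2` with `e = A y`. -/
def quartic {n : ℕ} (A : Matrix (Fin n) (Fin n) ℝ) (r : ℝ) (y : Fin n → ℝ) : ℝ :=
  ∑ i, ((A *ᵥ y) i ^ 4 - r * (A *ᵥ y) i ^ 2)

/-- Coefficients of the increments of `quartic` under resetting of one variable. -/
def incCoeff {n : ℕ} (r : ℝ) (m : Fin 4) (_ : Fin n) : Fin 4 → ℝ :=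
  (![![0, -2 * r, 0, 4], ![r, 0, -6, 0], ![0, 4, 0, 0], ![-1, 0, 0, 0]] : Fin 4 → Fin 4 → ℝ) m

/-- Coefficients of the coordinatewise centered terms whose sum is the centered `quartic`; here
`v` and `w` stand for the second and the fourth moment of the variables. -/
def steinCoeff {n : ℕ} (A : Matrix (Fin n) (Fin n) ℝ) (r v w : ℝ) (l : Fin 3) (i : Fin n) :
    Fin 4 → ℝ :=
  (![![0, 3 * v * (∑ k, A i k ^ 2) - r, 0, 1],
    ![-(3 * v ^ 2 * (∑ k, A i k ^ 2) - r * v), 0, -3 * v, 0],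
    ![3 * v ^ 2 - w, 0, 0, 0]] : Fin 3 → Fin 4 → ℝ) l

/-- The power of `y k` in the `l`-th part of `steinTerm`. -/
def steinExp (l : Fin 3) : ℕ := (![1, 0, 0] : Fin 3 → ℕ) l

/-- The Hadamard power of `A` in the `l`-th part of `steinTerm`. -/
def steinPow (l : Fin 3) : ℕ := (![1, 2, 4] : Fin 3 → ℕ) l

/-- The terms of a decomposition of the centered `quartic` such that the `k`-th term has mean zero
when integrated over the `k`-th variable. It comes from writing `e ^ 4 = ∑ k, a k * y k * e ^ 3` and
subtracting the means over single variables, repeatedly. -/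
def steinTerm {n : ℕ} (A : Matrix (Fin n) (Fin n) ℝ) (r v w : ℝ) (k : Fin n) (y : Fin n → ℝ) : ℝ :=
  ∑ l : Fin 3, y k ^ steinExp l * cubForm A (hpow A (steinPow l)) (steinCoeff A r v w l) k y

/-- The increment of `quartic` under resetting of the variable `k`, written as a combination of
sums of cubic polynomials. -/
def incTerm {n : ℕ} (A : Matrix (Fin n) (Fin n) ℝ) (r : ℝ) (k : Fin n) (y : Fin n → ℝ) : ℝ :=
  ∑ m : Fin 4, y k ^ (m.val + 1) * cubForm A (hpow A (m.val + 1)) (incCoeff r m) k y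

section Decomposition

variable {n : ℕ} {A : Matrix (Fin n) (Fin n) ℝ} {r v w : ℝ}

lemma continuous_quartic (A : Matrix (Fin n) (Fin n) ℝ) (r : ℝ) : Continuous (quartic A r) := by
  have := continuous_mulVec_apply A
  unfold quartic; fun_prop

lemma continuous_steinTerm (A : Matrix (Fin n) (Fin n) ℝ) (r v w : ℝ) (k : Fin n) :
    Continuous (steinTerm A r v w k) := by
  unfold steinTerm
  refine continuous_finsetSum _ fun l _ => ?_
  exact ((continuous_apply k).pow _).mul (continuous_cubForm _ _ _ _)

lemma continuous_incTerm (A : Matrix (Fin n) (Fin n) ℝ) (r : ℝ) (k : Fin n) :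
    Continuous (incTerm A r k) := by
  unfold incTerm
  refine continuous_finsetSum _ fun l _ => ?_
  exact ((continuous_apply k).pow _).mul (continuous_cubForm _ _ _ _)

lemma quartic_sub_update (k : Fin n) (y : Fin n → ℝ) :
    quartic A r y - quartic A r (Function.update y k 0) = incTerm A r k y := by
  unfold quartic incTerm cubForm cub
  rw [← Finset.sum_sub_distrib]
  simp only [Finset.mul_sum]
  rw [Finset.sum_comm]
  refine Finset.sum_congr rfl fun i _ => ?_
  rw [mulVec_update_zero, Fin.sum_univ_four]
  simp [hpow, incCoeff]
  ring

lemma sum_steinTerm (y : Fin n → ℝ) :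
    ∑ k, steinTerm A r v w k y = quartic A r y
      - ∑ i, (3 * v ^ 2 * (∑ k, A i k ^ 2) ^ 2 - r * v * (∑ k, A i k ^ 2)
        - (3 * v ^ 2 - w) * ∑ k, A i k ^ 4) := by
  unfold quartic
  rw [← Finset.sum_sub_distrib]
  have h : ∀ k, steinTerm A r v w k y = ∑ i, (
      A i k * y k * ((3 * v * (∑ k, A i k ^ 2) - r) * (A *ᵥ y) i + (A *ᵥ y) i ^ 3)
      + A i k ^ 2 * (-(3 * v ^ 2 * (∑ k, A i k ^ 2) - r * v) - 3 * v * (A *ᵥ y) i ^ 2)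
      + A i k ^ 4 * (3 * v ^ 2 - w)) := by
    intro k
    unfold steinTerm cubForm cub
    simp only [Finset.mul_sum]
    rw [Finset.sum_comm]
    refine Finset.sum_congr rfl fun i _ => ?_
    rw [Fin.sum_univ_three]
    simp [hpow, steinCoeff, steinExp, steinPow, Finset.mul_sum]
    ring
  simp only [h]
  rw [Finset.sum_comm]
  refine Finset.sum_congr rfl fun i _ => ?_
  rw [Finset.sum_add_distrib, Finset.sum_add_distrib, ← Finset.sum_mul, ← Finset.sum_mul,
    ← Finset.sum_mul]
  have e : ∑ k, A i k * y k = (A *ᵥ y) i := rfl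
  rw [e]
  ring

/-- `steinTerm` in terms of the variable `y k` and of functions of the other variables. -/
lemma steinTerm_eq (k : Fin n) (y : Fin n → ℝ) :
    steinTerm A r v w k y =
      y k * (∑ i, (A i k * (A *ᵥ Function.update y k 0) i ^ 3
        + (3 * v * (A i k * (∑ l, A i l ^ 2) - 2 * A i k ^ 3) - r * A i k)
          * (A *ᵥ Function.update y k 0) i))
      + (y k ^ 2 - v) * (∑ i, (3 * A i k ^ 2 * (A *ᵥ Function.update y k 0) i ^ 2
        + 3 * v * (A i k ^ 2 * (∑ l, A i l ^ 2) - A i k ^ 4) - r * A i k ^ 2))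
      + y k ^ 3 * (∑ i, 3 * A i k ^ 3 * (A *ᵥ Function.update y k 0) i)
      + (y k ^ 4 - w) * ∑ i, A i k ^ 4 := by
  obtain ⟨d, hd⟩ : ∃ d : Fin n → ℝ, ∀ i, ∑ l, A i l ^ 2 = d i := ⟨_, fun _ => rfl⟩
  unfold steinTerm cubForm cub
  simp only [hd, Finset.mul_sum]
  rw [Finset.sum_comm, ← Finset.sum_add_distrib, ← Finset.sum_add_distrib,
    ← Finset.sum_add_distrib]
  refine Finset.sum_congr rfl fun i _ => ?_
  rw [Fin.sum_univ_three, mulVec_update_zero]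
  simp [hpow, steinCoeff, steinExp, steinPow, hd]
  ring

end Decomposition

section Centering

variable {n : ℕ} {ν : Measure ℝ} [IsProbabilityMeasure ν] {τ : ℝ}
  {A : Matrix (Fin n) (Fin n) ℝ} {r : ℝ}
  {E : Type*} [NormedAddCommGroup E] [NormedSpace ℝ E] [CompleteSpace E]
  [MeasurableSpace E] [BorelSpace E] [SecondCountableTopology E]

lemma integrable_of_continuous_normed (hτ : ∀ᵐ y ∂ν, |y| ≤ τ) {G : (Fin n → ℝ) → E}
    (hG : Continuous G) : Integrable G (Measure.pi fun _ => ν) := by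
  obtain ⟨B, hB⟩ := (isCompact_univ_pi fun _ : Fin n =>
    isCompact_Icc (a := -τ) (b := τ)).exists_bound_of_continuousOn hG.continuousOn
  refine Integrable.of_bound hG.aestronglyMeasurable B ?_
  filter_upwards [ae_pi_abs_le hτ] with y hy
  exact hB y fun j _ => abs_le.1 (hy j)

lemma integral_smul_update_eq_zero {ψ : ℝ → ℝ} (hψ : Continuous ψ) (h0 : ∫ x, ψ x ∂ν = 0)
    {G : (Fin n → ℝ) → E} (hG : Continuous G) (k : Fin n) :
    ∫ y, ψ (y k) • G (Function.update y k 0) ∂(Measure.pi fun _ => ν) = 0 := by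
  have hind := ((indepFun_update_eval ν k).comp hG.measurable hψ.measurable).symm
  have h := hind.integral_fun_smul_eq_smul_integral
    (hψ.comp (continuous_apply k)).aestronglyMeasurable
    (hG.comp (continuous_update_zero k)).aestronglyMeasurable
  have h1 : ∫ y : Fin n → ℝ, ψ (y k) ∂(Measure.pi fun _ => ν) = 0 := by
    rw [← h0]
    exact integral_comp_eval (μ := fun _ : Fin n => ν) (f := ψ) (i := k)
      hψ.aestronglyMeasurable
  simp only [Function.comp_def] at h
  rw [h, h1, zero_smul]

lemma integral_pow_eq_zero_of_odd (hsymm : ν.map (fun x => -x) = ν) {m : ℕ} (hm : Odd m) :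
    ∫ x, x ^ m ∂ν = 0 := by
  have : ∫ x, x ^ m ∂ν = ∫ x, (-x) ^ m ∂ν := by
    conv_lhs => rw [← hsymm]
    rw [integral_map (by fun_prop) (by fun_prop)]
  simp only [hm.neg_pow, integral_neg] at this
  linarith

/-- `steinTerm` has mean zero when integrated over the `k`-th variable. -/
lemma integral_steinTerm_smul_update (hτ : ∀ᵐ y ∂ν, |y| ≤ τ) (hsymm : ν.map (fun x => -x) = ν)
    {G : (Fin n → ℝ) → E} (hG : Continuous G) (k : Fin n) :
    ∫ y, steinTerm A r (∫ x, x ^ 2 ∂ν) (∫ x, x ^ 4 ∂ν) k y • G (Function.update y k 0)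
      ∂(Measure.pi fun _ => ν) = 0 := by
  set v := ∫ x, x ^ 2 ∂ν with hv
  set w := ∫ x, x ^ 4 ∂ν with hw
  have hi : ∀ m : ℕ, Integrable (fun x : ℝ => x ^ m) ν := fun m => by
    refine Integrable.of_bound (by fun_prop) (τ ^ m) ?_
    filter_upwards [hτ] with y hy
    rw [norm_pow, Real.norm_eq_abs]
    exact pow_le_pow_left₀ (abs_nonneg _) hy m
  have hcm := continuous_mulVec_apply A
  have key : ∀ (ψ : ℝ → ℝ) (H : (Fin n → ℝ) → ℝ), Continuous ψ → ∫ x, ψ x ∂ν = 0 →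
      Continuous H → Integrable (fun y => (ψ (y k) * H (Function.update y k 0)) •
        G (Function.update y k 0)) (Measure.pi fun _ => ν) ∧
      ∫ y, (ψ (y k) * H (Function.update y k 0)) • G (Function.update y k 0)
        ∂(Measure.pi fun _ => ν) = 0 := by
    intro ψ H hψ h0 hH
    have hu := continuous_update_zero (n := n) k
    refine ⟨integrable_of_continuous_normed hτ (((hψ.comp (continuous_apply k)).mul
      (hH.comp hu)).smul (hG.comp hu)), ?_⟩
    simp only [mul_smul]
    exact integral_smul_update_eq_zero hψ h0 (hH.smul hG) k
  obtain ⟨i1, z1⟩ := key (fun x => x) (fun z => ∑ i, (A i k * (A *ᵥ z) i ^ 3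
        + (3 * v * (A i k * (∑ l, A i l ^ 2) - 2 * A i k ^ 3) - r * A i k) * (A *ᵥ z) i))
    continuous_id (by simpa using integral_pow_eq_zero_of_odd hsymm (m := 1) (by decide))
    (by fun_prop)
  obtain ⟨i2, z2⟩ := key (fun x => x ^ 2 - v) (fun z => ∑ i, (3 * A i k ^ 2 * (A *ᵥ z) i ^ 2
        + 3 * v * (A i k ^ 2 * (∑ l, A i l ^ 2) - A i k ^ 4) - r * A i k ^ 2))
    (by fun_prop) (by rw [integral_sub (hi 2) (integrable_const _)]; simp [hv]) (by fun_prop)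
  obtain ⟨i3, z3⟩ := key (fun x => x ^ 3) (fun z => ∑ i, 3 * A i k ^ 3 * (A *ᵥ z) i)
    (by fun_prop) (integral_pow_eq_zero_of_odd hsymm (by decide)) (by fun_prop)
  obtain ⟨i4, z4⟩ := key (fun x => x ^ 4 - w) (fun _ => ∑ i, A i k ^ 4)
    (by fun_prop) (by rw [integral_sub (hi 4) (integrable_const _)]; simp [hw]) (by fun_prop)
  simp only [steinTerm_eq, add_smul]
  have i12 := i1.add i2
  have i123 := i12.add i3
  simp only [Pi.add_def] at i12 i123
  rw [integral_add i123 i4, integral_add i12 i3, integral_add i1 i2, z1, z2, z3, z4]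
  simp

lemma integral_steinTerm (hτ : ∀ᵐ y ∂ν, |y| ≤ τ) (hsymm : ν.map (fun x => -x) = ν) (k : Fin n) :
    ∫ y, steinTerm A r (∫ x, x ^ 2 ∂ν) (∫ x, x ^ 4 ∂ν) k y ∂(Measure.pi fun _ => ν) = 0 := by
  have := integral_steinTerm_smul_update (A := A) (r := r) hτ hsymm (G := fun _ => (1 : ℝ))
    continuous_const k
  simpa using this

lemma sum_steinTerm_eq (hτ : ∀ᵐ y ∂ν, |y| ≤ τ) (hsymm : ν.map (fun x => -x) = ν)
    (y : Fin n → ℝ) :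
    ∑ k, steinTerm A r (∫ x, x ^ 2 ∂ν) (∫ x, x ^ 4 ∂ν) k y
      = quartic A r y - ∫ z, quartic A r z ∂(Measure.pi fun _ => ν) := by
  have h := sum_steinTerm (A := A) (r := r) (v := ∫ x, x ^ 2 ∂ν) (w := ∫ x, x ^ 4 ∂ν)
  have h2 : ∫ y, ∑ k, steinTerm A r (∫ x, x ^ 2 ∂ν) (∫ x, x ^ 4 ∂ν) k y
      ∂(Measure.pi fun _ => ν) = 0 := by
    rw [integral_finsetSum _ fun k _ =>
      integrable_of_continuous hτ (continuous_steinTerm A r _ _ k)]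
    exact Finset.sum_eq_zero fun k _ => integral_steinTerm hτ hsymm k
  simp only [h] at h2
  rw [integral_sub (integrable_of_continuous hτ (continuous_quartic A r)) (integrable_const _)] at h2
  rw [h]
  simp only [integral_const, probReal_univ, smul_eq_mul, one_mul] at h2
  linarith

/-- The variance of `quartic` as the mean of a sum of products of increments and centered terms. -/
lemma integral_sum_incTerm_mul_steinTerm (hτ : ∀ᵐ y ∂ν, |y| ≤ τ)
    (hsymm : ν.map (fun x => -x) = ν) :
    ∫ y, ∑ k, incTerm A r k y * steinTerm A r (∫ x, x ^ 2 ∂ν) (∫ x, x ^ 4 ∂ν) k y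
      ∂(Measure.pi fun _ => ν) = Var[quartic A r; Measure.pi fun _ => ν] := by
  have hq := continuous_quartic A r
  have hst := continuous_steinTerm A r (∫ x, x ^ 2 ∂ν) (∫ x, x ^ 4 ∂ν)
  have hu := continuous_update_zero (n := n)
  have hi : ∀ k, Integrable (fun y => quartic A r y *
      steinTerm A r (∫ x, x ^ 2 ∂ν) (∫ x, x ^ 4 ∂ν) k y) (Measure.pi fun _ => ν) :=
    fun k => integrable_of_continuous hτ (hq.mul (hst k))
  have hi' : ∀ k, Integrable (fun y => incTerm A r k y *
      steinTerm A r (∫ x, x ^ 2 ∂ν) (∫ x, x ^ 4 ∂ν) k y) (Measure.pi fun _ => ν) :=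
    fun k => integrable_of_continuous hτ ((continuous_incTerm A r k).mul (hst k))
  have hk : ∀ k, ∫ y, incTerm A r k y * steinTerm A r (∫ x, x ^ 2 ∂ν) (∫ x, x ^ 4 ∂ν) k y
      ∂(Measure.pi fun _ => ν) = ∫ y, quartic A r y *
      steinTerm A r (∫ x, x ^ 2 ∂ν) (∫ x, x ^ 4 ∂ν) k y ∂(Measure.pi fun _ => ν) := by
    intro k
    have hz := integral_steinTerm_smul_update (A := A) (r := r) hτ hsymm hq k
    simp only [← quartic_sub_update, sub_mul, smul_eq_mul] at hz ⊢
    rw [integral_sub (hi k)]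
    · rw [sub_eq_self]
      exact Eq.trans (integral_congr_ae (ae_of_all _ fun y => mul_comm _ _)) hz
    · exact integrable_of_continuous hτ ((hq.comp (hu k)).mul (hst k))
  rw [integral_finsetSum _ fun k _ => hi' k]
  simp only [hk]
  rw [← integral_finsetSum _ fun k _ => hi k]
  simp only [← Finset.mul_sum, sum_steinTerm_eq hτ hsymm]
  rw [variance_eq_sub (memLp_of_continuous hτ hq 2)]
  have iq2 : Integrable (fun y => quartic A r y * quartic A r y) (Measure.pi fun _ => ν) :=
    integrable_of_continuous hτ (hq.mul hq)
  have iq : Integrable (fun y => quartic A r y * ∫ z, quartic A r z ∂(Measure.pi fun _ => ν))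
    (Measure.pi fun _ => ν) := integrable_of_continuous hτ (hq.mul continuous_const)
  simp only [mul_sub]
  rw [integral_sub iq2 iq, integral_mul_const]
  simp only [Pi.pow_apply, sq]

end Centering

/-! ### Moment bounds for the increments and the centered terms -/

lemma pow_four_sum_four_le (x y z w : ℝ) :
    (x + y + z + w) ^ 4 ≤ 64 * (x ^ 4 + y ^ 4 + z ^ 4 + w ^ 4) := by
  have h1 := sq_sum_four_le x y z w
  have h2 := sq_sum_four_le (x ^ 2) (y ^ 2) (z ^ 2) (w ^ 2)
  have h3 : ((x + y + z + w) ^ 2) ^ 2 ≤ (4 * (x ^ 2 + y ^ 2 + z ^ 2 + w ^ 2)) ^ 2 :=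
    pow_le_pow_left₀ (sq_nonneg _) h1 2
  calc (x + y + z + w) ^ 4 = ((x + y + z + w) ^ 2) ^ 2 := by ring
    _ ≤ (4 * (x ^ 2 + y ^ 2 + z ^ 2 + w ^ 2)) ^ 2 := h3
    _ = 16 * (x ^ 2 + y ^ 2 + z ^ 2 + w ^ 2) ^ 2 := by ring
    _ ≤ 16 * (4 * ((x ^ 2) ^ 2 + (y ^ 2) ^ 2 + (z ^ 2) ^ 2 + (w ^ 2) ^ 2)) := by linarith
    _ = _ := by ring

lemma variance_sum_le {Ω ι : Type*} [MeasurableSpace Ω] {P : Measure Ω} [IsProbabilityMeasure P]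
    (s : Finset ι) {F : ι → Ω → ℝ} (hF : ∀ i, MemLp (F i) 2 P) :
    Var[fun ω => ∑ i ∈ s, F i ω; P] ≤ s.card * ∑ i ∈ s, Var[F i; P] := by
  have hint : ∀ i, Integrable (F i) P := fun i => (hF i).integrable (by norm_num)
  have hs : MemLp (fun ω => ∑ i ∈ s, F i ω) 2 P := memLp_finsetSum s fun i _ => hF i
  have hsq : ∀ i, Integrable (fun ω => (F i ω - ∫ ω, F i ω ∂P) ^ 2) P :=
    fun i => ((hF i).sub (memLp_const _)).integrable_sq
  rw [variance_eq_integral hs.aestronglyMeasurable.aemeasurable]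
  simp_rw [variance_eq_integral (hF _).aestronglyMeasurable.aemeasurable]
  rw [← integral_finsetSum _ fun i _ => hsq i, ← integral_const_mul]
  refine integral_mono (hs.sub (memLp_const _)).integrable_sq
    ((integrable_finsetSum _ fun i _ => hsq i).const_mul _) fun ω => ?_
  dsimp only
  rw [integral_finsetSum _ fun i _ => hint i, ← Finset.sum_sub_distrib]
  exact sq_sum_le_card_mul_sum_sq

section Bounds

variable {n : ℕ} {A : Matrix (Fin n) (Fin n) ℝ} {r ρ v w τ C : ℝ}

lemma abs_incCoeff_le (hr : |r| ≤ ρ) (m : Fin 4) (i : Fin n) (l : Fin 4) :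
    |incCoeff r m i l| ≤ 6 + 2 * ρ := by
  have h0 := abs_nonneg r
  fin_cases m <;> fin_cases l <;> simp [incCoeff, abs_mul] <;> linarith

/-- A bound for the coefficients of the cubic polynomials involved. -/
def coefBound (C τ ρ : ℝ) : ℝ :=
  6 + 3 * ρ + 3 * τ ^ 2 * C + 3 * τ ^ 4 * C + ρ * τ ^ 2 + 3 * τ ^ 2 + 4 * τ ^ 4

lemma le_coefBound (hρ : 0 ≤ ρ) (hC : 1 ≤ C) : 6 + 2 * ρ ≤ coefBound C τ ρ := by
  unfold coefBound
  have h0 : 0 ≤ C := by linarith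
  have h1 : 0 ≤ 3 * τ ^ 2 * C := by positivity
  have h2 : 0 ≤ 3 * τ ^ 4 * C := by positivity
  have h3 : 0 ≤ ρ * τ ^ 2 := by positivity
  have h4 : 0 ≤ τ ^ 2 := by positivity
  have h5 : 0 ≤ τ ^ 4 := by positivity
  linarith

lemma abs_steinCoeff_le (hr : |r| ≤ ρ) (hA : OpBound A C) (hC : 1 ≤ C) (hv0 : 0 ≤ v)
    (hv : v ≤ τ ^ 2) (hw0 : 0 ≤ w) (hw : w ≤ τ ^ 4) (l : Fin 3) (i : Fin n) (j : Fin 4) :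
    |steinCoeff A r v w l i j| ≤ coefBound C τ ρ := by
  have h0 := abs_nonneg r
  have hρ : 0 ≤ ρ := h0.trans hr
  have hd := hA.row_le i
  have hd0 : 0 ≤ ∑ k, A i k ^ 2 := Finset.sum_nonneg fun _ _ => sq_nonneg _
  have hC0 : 0 ≤ C := by linarith
  have h1 : 0 ≤ τ ^ 2 * C := by positivity
  have h2 : 0 ≤ τ ^ 4 * C := by positivity
  have h3 : 0 ≤ ρ * τ ^ 2 := by positivity
  have h4 : 0 ≤ τ ^ 2 := by positivity
  have h5 : 0 ≤ τ ^ 4 := by positivity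
  have hv2 : v ^ 2 ≤ τ ^ 4 := by
    calc v ^ 2 ≤ (τ ^ 2) ^ 2 := pow_le_pow_left₀ hv0 hv 2
      _ = τ ^ 4 := by ring
  have hvd : v * (∑ k, A i k ^ 2) ≤ τ ^ 2 * C := mul_le_mul hv hd hd0 h4
  have hvd0 : 0 ≤ v * (∑ k, A i k ^ 2) := mul_nonneg hv0 hd0
  have hv2d : v ^ 2 * (∑ k, A i k ^ 2) ≤ τ ^ 4 * C := mul_le_mul hv2 hd hd0 h5
  have hv2d0 : 0 ≤ v ^ 2 * (∑ k, A i k ^ 2) := by positivity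
  have hrv : |r| * v ≤ ρ * τ ^ 2 := mul_le_mul hr hv hv0 hρ
  obtain ⟨r1, r2⟩ := abs_le.1 hr
  have hrv' := abs_le.1 (show |r * v| ≤ ρ * τ ^ 2 by rwa [abs_mul, abs_of_nonneg hv0])
  obtain ⟨r3, r4⟩ := hrv'
  have hvv : 0 ≤ v ^ 2 := sq_nonneg v
  generalize hD : ∑ k, A i k ^ 2 = d at *
  unfold coefBound
  fin_cases l <;> fin_cases j <;> refine abs_le.2 ⟨?_, ?_⟩ <;> simp [steinCoeff, hD] <;> linarith

lemma integral_pow_nonneg_of_even {ν : Measure ℝ} {m : ℕ} (hm : Even m) : 0 ≤ ∫ x, x ^ m ∂ν :=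
  integral_nonneg fun _ => hm.pow_nonneg _

lemma integral_pow_le_of_even {ν : Measure ℝ} [IsProbabilityMeasure ν]
    (hτ : ∀ᵐ y ∂ν, |y| ≤ τ) {m : ℕ} (hm : Even m) : ∫ x, x ^ m ∂ν ≤ τ ^ m := by
  have hb : ∀ᵐ y ∂ν, y ^ m ≤ τ ^ m := by
    filter_upwards [hτ] with y hy
    rw [← hm.pow_abs]
    exact pow_le_pow_left₀ (abs_nonneg _) hy m
  have hi : Integrable (fun x : ℝ => x ^ m) ν := by
    refine Integrable.of_bound (by fun_prop) (τ ^ m) ?_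
    filter_upwards [hb] with y hy
    rwa [Real.norm_of_nonneg (hm.pow_nonneg _)]
  calc ∫ x, x ^ m ∂ν ≤ ∫ _, τ ^ m ∂ν := integral_mono_ae hi (integrable_const _) hb
    _ = τ ^ m := by simp

lemma sum_incTerm_mul_steinTerm (y : Fin n → ℝ) :
    ∑ k, incTerm A r k y * steinTerm A r v w k y
      = ∑ x : Fin 4 × Fin 3, pairForm A (hpow A (x.1.val + 1)) (hpow A (steinPow x.2))
          (incCoeff r x.1) (steinCoeff A r v w x.2) (x.1.val + 1 + steinExp x.2) y := by
  unfold incTerm steinTerm pairForm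
  rw [Finset.sum_comm]
  refine Finset.sum_congr rfl fun k _ => ?_
  rw [Finset.sum_mul_sum, ← Finset.univ_product_univ, Finset.sum_product]
  refine Finset.sum_congr rfl fun m _ => Finset.sum_congr rfl fun l _ => ?_
  rw [pow_add]
  ring

end Bounds

section CharFun

variable {ν : Measure ℝ} [IsProbabilityMeasure ν] {τ C ρ : ℝ}

/-- The increments and the centered terms have bounded mixed moments, and the variance of the sum
of their products is of smaller order than `n ^ 2`, uniformly over the matrices `A`. -/
lemma exists_bound_incTerm_steinTerm (hτ : ∀ᵐ y ∂ν, |y| ≤ τ) (hτ1 : 1 ≤ τ)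
    (hsymm : ν.map (fun x => -x) = ν) (hC : 1 ≤ C) (hρ : 0 ≤ ρ) :
    ∃ L, 0 ≤ L ∧ ∀ {n : ℕ} {A : Matrix (Fin n) (Fin n) ℝ} {r : ℝ}, 0 < n → OpBound A C →
      |r| ≤ ρ →
      Var[fun y => ∑ k, incTerm A r k y * steinTerm A r (∫ x, x ^ 2 ∂ν) (∫ x, x ^ 4 ∂ν) k y;
        Measure.pi fun _ => ν] ≤ L * (n * √n) ∧
      ∀ k, ∫ y, incTerm A r k y ^ 2 * |steinTerm A r (∫ x, x ^ 2 ∂ν) (∫ x, x ^ 4 ∂ν) k y|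
        ∂(Measure.pi fun _ => ν) ≤ L := by
  set v := ∫ x, x ^ 2 ∂ν with hv
  set w := ∫ x, x ^ 4 ∂ν with hw
  have hv0 : 0 ≤ v := integral_pow_nonneg_of_even (by decide)
  have hw0 : 0 ≤ w := integral_pow_nonneg_of_even (by decide)
  have hv1 : v ≤ τ ^ 2 := integral_pow_le_of_even hτ (by decide)
  have hw1 : w ≤ τ ^ 4 := integral_pow_le_of_even hτ (by decide)
  obtain ⟨M, hMd⟩ : ∃ M, M = 2 * ((16 : ℕ).factorial : ℝ) * Real.exp (C * τ ^ 2 / 2) := ⟨_, rfl⟩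
  have hM0 : 0 ≤ M := by rw [hMd]; positivity
  have hC0 : 0 ≤ C := by linarith
  obtain ⟨S, hSd⟩ : ∃ S, S = C ^ 8 := ⟨_, rfl⟩
  have hS : 0 ≤ S := by rw [hSd]; positivity
  obtain ⟨K, hKd⟩ : ∃ K, K = coefBound C τ ρ := ⟨_, rfl⟩
  have hK0 : 0 ≤ K := by rw [hKd]; linarith [le_coefBound (τ := τ) hρ hC]
  obtain ⟨M', hM'd⟩ : ∃ M', M' = S ^ 4 * (512 * K ^ 4 * (2 + M))
    + 272 * (incConst C τ K ^ 2 * (S * (2 * (S * (2 + M))))) := ⟨_, rfl⟩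
  have hM'1 : S ^ 4 * (512 * K ^ 4 * (2 + M)) ≤ M' := by
    rw [hM'd]; exact le_add_of_nonneg_right (by positivity)
  have hM'2 : 272 * (incConst C τ K ^ 2 * (S * (2 * (S * (2 + M))))) ≤ M' := by
    rw [hM'd]; exact le_add_of_nonneg_left (by positivity)
  have hM' : 0 ≤ M' := le_trans (by positivity) hM'1
  obtain ⟨L, hL0, hL⟩ := variance_pairForm_le (ν := ν) (τ := τ) hC hτ1 hS hM0 K hM' hτ
  refine ⟨12 * (12 * L) + (64 * (4 * (τ ^ 16 * M')) + 1 + 64 * (3 * (τ ^ 16 * M'))),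
    by positivity, ?_⟩
  intro n A r hn hA hr
  set P : Measure (Fin n → ℝ) := Measure.pi fun _ => ν
  have hM : ∀ i, ∫ y, (A *ᵥ y) i ^ 16 ∂P ≤ M := fun i => by
    rw [hMd]; exact integral_mulVec_pow_le hτ hsymm hA i
  have hhp : ∀ m, 1 ≤ m → m ≤ 4 → OpBound (hpow A m) S := fun m h1 h4 =>
    (hA.hpow hC h1).mono (by rw [hSd]; exact pow_le_pow_right₀ hC (by omega))
  have hha : ∀ m, 2 ≤ m → m ≤ 4 → ∀ k, ∑ i, |hpow A m i k| ≤ S := fun m h1 h4 k =>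
    (hA.sum_abs_hpow_le hC k h1).trans (by rw [hSd]; exact pow_le_pow_right₀ hC (by omega))
  have hci : ∀ m i l, |incCoeff (n := n) r m i l| ≤ K := fun m i l =>
    (abs_incCoeff_le hr m i l).trans (by rw [hKd]; exact le_coefBound hρ hC)
  have hcs : ∀ m i l, |steinCoeff A r v w m i l| ≤ K := fun m i l => by
    rw [hKd]; exact abs_steinCoeff_le hr hA hC hv0 hv1 hw0 hw1 m i l
  have h4i : ∀ (m : Fin 4) k,
      ∫ y, cubForm A (hpow A (m.val + 1)) (incCoeff r m) k y ^ 4 ∂P ≤ M' := by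
    intro m k
    rcases Nat.eq_zero_or_pos m.val with h0 | h0
    · have hm : m = 0 := Fin.ext h0
      subst hm
      exact (integral_cubForm_pow_four_le_of_odd hτ hτ1 hsymm hA hC hM hS (hci 0)
        (fun i => by simp [incCoeff]) (fun i => by simp [incCoeff]) k
        (hhp 1 le_rfl (by norm_num))).trans hM'2
    · exact (integral_cubForm_pow_four_le_of_abs_sum hτ hM hM0 hS (hci m) k
        (hha _ (by omega) (by omega) k)).trans hM'1
  have hsp : ∀ l, 1 ≤ steinPow l ∧ steinPow l ≤ 4 := by decide
  have hse : ∀ l, steinExp l ≤ 1 := by decide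
  have h4s : ∀ (l : Fin 3) k,
      ∫ y, cubForm A (hpow A (steinPow l)) (steinCoeff A r v w l) k y ^ 4 ∂P ≤ M' := by
    intro l k
    by_cases hl : l = 0
    · subst hl
      exact (integral_cubForm_pow_four_le_of_odd hτ hτ1 hsymm hA hC hM hS (hcs 0)
        (fun i => by simp [steinCoeff]) (fun i => by simp [steinCoeff]) k
        (hhp 1 le_rfl (by norm_num))).trans hM'2
    · have : 2 ≤ steinPow l := by revert hl; revert l; decide
      exact (integral_cubForm_pow_four_le_of_abs_sum hτ hM hM0 hS (hcs l) k
        (hha _ this (hsp l).2 k)).trans hM'1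
  have hn1 : (1 : ℝ) ≤ n := by exact_mod_cast hn
  have hnn : 0 ≤ (n : ℝ) * √n := by positivity
  have hci' := fun (m : Fin 4) k => continuous_cubForm A (hpow A (m.val + 1)) (incCoeff r m) k
  have hcs' := fun (l : Fin 3) k =>
    continuous_cubForm A (hpow A (steinPow l)) (steinCoeff A r v w l) k
  constructor
  · simp only [sum_incTerm_mul_steinTerm]
    refine (variance_sum_le Finset.univ fun x =>
      memLp_of_continuous hτ (continuous_pairForm _ _ _ _ _ _) 2).trans ?_
    have : ∑ x : Fin 4 × Fin 3, Var[pairForm A (hpow A (x.1.val + 1)) (hpow A (steinPow x.2))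
          (incCoeff r x.1) (steinCoeff A r v w x.2) (x.1.val + 1 + steinExp x.2); P]
        ≤ ∑ _x : Fin 4 × Fin 3, L * (n * √n) := Finset.sum_le_sum fun x _ =>
      hL hn hA (hhp _ (by omega) (by omega)) (hhp _ (hsp x.2).1 (hsp x.2).2) (hci x.1) (hcs x.2)
        (by have := hse x.2; omega) hM (h4i x.1) (h4s x.2)
    simp only [Finset.sum_const, Finset.card_univ, Fintype.card_prod, Fintype.card_fin,
      nsmul_eq_mul] at this ⊢
    have h0 : 0 ≤ (64 * (4 * (τ ^ 16 * M')) + 1 + 64 * (3 * (τ ^ 16 * M'))) * (n * √n) := by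
      positivity
    push_cast at this ⊢
    nlinarith
  · intro k
    have hpt : ∀ᵐ y ∂P, incTerm A r k y ^ 2 * |steinTerm A r v w k y| ≤
        64 * ∑ m : Fin 4, τ ^ 16 * cubForm A (hpow A (m.val + 1)) (incCoeff r m) k y ^ 4 + 1
        + 64 * ∑ l : Fin 3, τ ^ 16 * cubForm A (hpow A (steinPow l)) (steinCoeff A r v w l) k y ^ 4
        := by
      filter_upwards [ae_pi_abs_le hτ] with y hy
      have hy16 : ∀ a, a ≤ 4 → ∀ x, (y k ^ a * x) ^ 4 ≤ τ ^ 16 * x ^ 4 := by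
        intro a ha x
        have e4 : Even (4 : ℕ) := by decide
        rw [mul_pow]
        refine mul_le_mul_of_nonneg_right ?_ (e4.pow_nonneg _)
        rw [← pow_mul, ← (show Even (a * 4) from e4.mul_left a).pow_abs]
        exact (pow_le_pow_left₀ (abs_nonneg _) (hy k) _).trans (pow_le_pow_right₀ hτ1 (by omega))
      have hV : incTerm A r k y ^ 4 ≤ 64 * ∑ m : Fin 4, τ ^ 16 *
          cubForm A (hpow A (m.val + 1)) (incCoeff r m) k y ^ 4 := by
        unfold incTerm
        rw [Fin.sum_univ_four, Fin.sum_univ_four]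
        refine (pow_four_sum_four_le _ _ _ _).trans ?_
        have := hy16 1 (by norm_num)
        refine mul_le_mul_of_nonneg_left ?_ (by norm_num)
        refine add_le_add (add_le_add (add_le_add ?_ ?_) ?_) ?_ <;> exact hy16 _ (by decide) _
      have hU : steinTerm A r v w k y ^ 4 ≤ 64 * ∑ l : Fin 3, τ ^ 16 *
          cubForm A (hpow A (steinPow l)) (steinCoeff A r v w l) k y ^ 4 := by
        unfold steinTerm
        rw [Fin.sum_univ_three, Fin.sum_univ_three]
        have := pow_four_sum_four_le (y k ^ steinExp 0 *
          cubForm A (hpow A (steinPow 0)) (steinCoeff A r v w 0) k y) (y k ^ steinExp 1 *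
          cubForm A (hpow A (steinPow 1)) (steinCoeff A r v w 1) k y) (y k ^ steinExp 2 *
          cubForm A (hpow A (steinPow 2)) (steinCoeff A r v w 2) k y) 0
        rw [add_zero] at this
        refine this.trans ?_
        refine mul_le_mul_of_nonneg_left ?_ (by norm_num)
        rw [zero_pow (by norm_num), add_zero]
        refine add_le_add (add_le_add ?_ ?_) ?_ <;>
          exact hy16 _ ((hse _).trans (by norm_num)) _
      have hVU : incTerm A r k y ^ 2 * |steinTerm A r v w k y|
          ≤ incTerm A r k y ^ 4 + 1 + steinTerm A r v w k y ^ 4 := by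
        have e1 := sq_abs (steinTerm A r v w k y)
        generalize incTerm A r k y = a
        generalize hb : steinTerm A r v w k y = b at *
        have e2 : b ^ 4 = |b| ^ 4 := by rw [← (show Even 4 by decide).pow_abs]
        rw [e2]
        generalize |b| = b
        nlinarith [sq_nonneg (a ^ 2 - b), sq_nonneg (b ^ 2 - 1), sq_nonneg (a ^ 2), sq_nonneg (b^2)]
      linarith
    have hI1 : ∀ m : Fin 4, Integrable (fun y => τ ^ 16 *
        cubForm A (hpow A (m.val + 1)) (incCoeff r m) k y ^ 4) P := fun m =>
      integrable_of_continuous hτ (((hci' m k).pow 4).const_mul _)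
    have hI2 : ∀ l : Fin 3, Integrable (fun y => τ ^ 16 *
        cubForm A (hpow A (steinPow l)) (steinCoeff A r v w l) k y ^ 4) P := fun l =>
      integrable_of_continuous hτ (((hcs' l k).pow 4).const_mul _)
    have hJ1 : Integrable (fun y => 64 * ∑ m : Fin 4, τ ^ 16 *
        cubForm A (hpow A (m.val + 1)) (incCoeff r m) k y ^ 4) P :=
      (integrable_finsetSum _ fun m _ => hI1 m).const_mul _
    have hJ2 : Integrable (fun y => 64 * ∑ l : Fin 3, τ ^ 16 *
        cubForm A (hpow A (steinPow l)) (steinCoeff A r v w l) k y ^ 4) P :=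
      (integrable_finsetSum _ fun m _ => hI2 m).const_mul _
    have hJ3 : Integrable (fun y => 64 * ∑ m : Fin 4, τ ^ 16 *
        cubForm A (hpow A (m.val + 1)) (incCoeff r m) k y ^ 4 + 1) P :=
      hJ1.add (integrable_const 1)
    have hI0 : Integrable (fun y => incTerm A r k y ^ 2 * |steinTerm A r v w k y|) P :=
      integrable_of_continuous hτ
        (((continuous_incTerm A r k).pow 2).mul (continuous_steinTerm A r v w k).abs)
    refine (integral_mono_ae hI0 (hJ3.add hJ2) hpt).trans ?_
    have e := integral_add hJ3 hJ2
    simp only [Pi.add_apply]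
    rw [e, integral_add hJ1 (integrable_const 1), integral_const_mul, integral_const_mul,
      integral_finsetSum _ fun m _ => hI1 m, integral_finsetSum _ fun m _ => hI2 m]
    simp only [integral_const_mul, integral_const, probReal_univ, smul_eq_mul, one_mul]
    have s1 : ∑ m : Fin 4, τ ^ 16 * ∫ y, cubForm A (hpow A (m.val + 1)) (incCoeff r m) k y ^ 4 ∂P
        ≤ ∑ _m : Fin 4, τ ^ 16 * M' := Finset.sum_le_sum fun m _ =>
      mul_le_mul_of_nonneg_left (h4i m k) (by positivity)
    have s2 : ∑ l : Fin 3, τ ^ 16 *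
        ∫ y, cubForm A (hpow A (steinPow l)) (steinCoeff A r v w l) k y ^ 4 ∂P
        ≤ ∑ _l : Fin 3, τ ^ 16 * M' := Finset.sum_le_sum fun l _ =>
      mul_le_mul_of_nonneg_left (h4s l k) (by positivity)
    simp only [Finset.sum_const, Finset.card_univ, Fintype.card_fin, nsmul_eq_mul] at s1 s2
    push_cast at s1 s2
    linarith

end CharFun

/-! ### Normal approximation of the quartic form for bounded variables -/

lemma norm_exp_I_mul_sub_le (x : ℝ) :
    ‖Complex.exp (Complex.I * x) - 1 - Complex.I * x‖ ≤ 2 * x ^ 2 := by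
  have hn : ‖Complex.I * (x : ℂ)‖ = |x| := by simp
  rcases le_total |x| 1 with h | h
  · have := Complex.norm_exp_sub_one_sub_id_le (x := Complex.I * x) (by rwa [hn])
    rw [hn, sq_abs] at this
    nlinarith [sq_nonneg x]
  · have h1 := Real.norm_exp_I_mul_ofReal_sub_one_le (x := x)
    rw [Real.norm_eq_abs] at h1
    have h2 := norm_sub_le (Complex.exp (Complex.I * x) - 1) (Complex.I * x)
    rw [hn] at h2
    have h3 : |x| ≤ x ^ 2 := by rw [← sq_abs]; nlinarith
    linarith

/-- A function with `φ' s + s * v * φ s` close to zero is close to the characteristic function of the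
centered normal law with variance `v`. -/
lemma norm_sub_exp_le_of_hasDerivAt {φ φ' : ℝ → ℂ} {v t ε : ℝ} (hv : 0 ≤ v)
    (hφ : ∀ s, HasDerivAt φ (φ' s) s) (h0 : φ 0 = 1)
    (hb : ∀ s, |s| ≤ |t| → ‖φ' s + s * v * φ s‖ ≤ ε) :
    ‖φ t - Real.exp (-(v * t ^ 2 / 2))‖ ≤ ε * |t| := by
  have hε : 0 ≤ ε := (norm_nonneg _).trans (hb 0 (by simp))
  set g : ℝ → ℂ := fun s => φ s * Real.exp (v * s ^ 2 / 2) with hg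
  have he : ∀ s : ℝ, HasDerivAt (fun s : ℝ => ((Real.exp (v * s ^ 2 / 2) : ℝ) : ℂ))
      ((Real.exp (v * s ^ 2 / 2) * (v * s) : ℝ) : ℂ) s := by
    intro s
    have h1 : HasDerivAt (fun s : ℝ => v * s ^ 2 / 2) (v * s) s := by
      have := (((hasDerivAt_id s).pow 2).const_mul v).div_const 2
      refine this.congr_deriv ?_
      simp; ring
    exact h1.exp.ofReal_comp
  have hgd : ∀ s, HasDerivAt g ((φ' s + s * v * φ s) * Real.exp (v * s ^ 2 / 2)) s := by
    intro s
    refine ((hφ s).mul (he s)).congr_deriv ?_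
    push_cast; ring
  have hseg : ∀ s ∈ Set.uIcc 0 t, |s| ≤ |t| := fun s hs => by
    have := Set.abs_sub_left_of_mem_uIcc hs
    simpa using this
  have key := Convex.norm_image_sub_le_of_norm_hasDerivWithin_le (f := g)
    (f' := fun s => (φ' s + s * v * φ s) * Real.exp (v * s ^ 2 / 2))
    (C := ε * Real.exp (v * t ^ 2 / 2)) (s := Set.uIcc 0 t) (x := 0) (y := t)
    (fun s _ => (hgd s).hasDerivWithinAt)
    (fun s hs => by
      rw [norm_mul]
      have h1 := hb s (hseg s hs)
      have h2 : s ^ 2 ≤ t ^ 2 := sq_le_sq.2 (hseg s hs)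
      rw [Complex.norm_real, Real.norm_of_nonneg (Real.exp_pos _).le]
      refine mul_le_mul h1 (Real.exp_le_exp.2 ?_) (Real.exp_pos _).le hε
      have := mul_le_mul_of_nonneg_left h2 hv
      linarith)
    (convex_uIcc 0 t) Set.left_mem_uIcc Set.right_mem_uIcc
  have h00 : g 0 = 1 := by simp [hg, h0]
  rw [h00, sub_zero, Real.norm_eq_abs] at key
  have hee : Real.exp (v * t ^ 2 / 2) * Real.exp (-(v * t ^ 2 / 2)) = 1 := by
    rw [← Real.exp_add]; simp
  have hfin : φ t - Real.exp (-(v * t ^ 2 / 2)) =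
      (g t - 1) * (Real.exp (-(v * t ^ 2 / 2)) : ℝ) := by
    rw [hg, sub_mul, mul_assoc, ← Complex.ofReal_mul, hee]; simp
  rw [hfin, norm_mul, Complex.norm_real, Real.norm_of_nonneg (Real.exp_pos _).le]
  calc ‖g t - 1‖ * Real.exp (-(v * t ^ 2 / 2))
      ≤ ε * Real.exp (v * t ^ 2 / 2) * |t| * Real.exp (-(v * t ^ 2 / 2)) :=
        mul_le_mul_of_nonneg_right key (Real.exp_pos _).le
    _ = ε * |t| * (Real.exp (v * t ^ 2 / 2) * Real.exp (-(v * t ^ 2 / 2))) := by ring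
    _ = ε * |t| := by rw [hee, mul_one]

section CharFun

variable {n : ℕ} {ν : Measure ℝ} [IsProbabilityMeasure ν] {τ C ρ : ℝ}

lemma hasDerivAt_integral_exp (hτ : ∀ᵐ y ∂ν, |y| ≤ τ) {F : (Fin n → ℝ) → ℝ} (hF : Continuous F)
    (s : ℝ) :
    HasDerivAt (fun s : ℝ => ∫ y, Complex.exp (Complex.I * (s * F y : ℝ))
      ∂(Measure.pi fun _ => ν))
      (∫ y, Complex.I * F y * Complex.exp (Complex.I * (s * F y : ℝ))
        ∂(Measure.pi fun _ => ν)) s := by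
  refine (hasDerivAt_integral_of_dominated_loc_of_deriv_le (s := Set.univ) (bound := fun y => |F y|)
    (F' := fun s y => Complex.I * F y * Complex.exp (Complex.I * (s * F y : ℝ)))
    univ_mem ?_ ?_ ?_ ?_ ?_ ?_).2
  · exact .of_forall fun s => Continuous.aestronglyMeasurable (by fun_prop)
  · exact integrable_of_continuous_normed hτ (by fun_prop)
  · exact Continuous.aestronglyMeasurable (by fun_prop)
  · refine .of_forall fun y s _ => ?_
    rw [norm_mul, Complex.norm_exp_I_mul_ofReal]
    simp
  · exact integrable_of_continuous hτ hF.abs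
  · refine .of_forall fun y s _ => ?_
    have h1 : HasDerivAt (fun s : ℝ => Complex.I * ((s * F y : ℝ) : ℂ)) (Complex.I * F y) s := by
      have : HasDerivAt (fun s : ℝ => s * F y) (F y) s := by
        simpa using (hasDerivAt_id s).mul_const (F y)
      exact this.ofReal_comp.const_mul Complex.I
    refine h1.cexp.congr_deriv ?_
    ring

/-- A differential inequality for the characteristic function of a function `W` of independent
variables: `V k` is the increment of `W` in the variable `k`, and the `U k` are terms with sum
`W - m` that have mean zero when integrated over the `k`-th variable alone. -/
lemma norm_deriv_add_le (hτ : ∀ᵐ y ∂ν, |y| ≤ τ) {W : (Fin n → ℝ) → ℝ}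
    {V U : Fin n → (Fin n → ℝ) → ℝ} {m vW L q : ℝ} (cW : Continuous W) (cV : ∀ k, Continuous (V k))
    (cU : ∀ k, Continuous (U k))
    (hsum : ∀ y, ∑ k, U k y = W y - m)
    (hqs : ∀ k y, W y - W (Function.update y k 0) = V k y)
    (horth : ∀ k (G : (Fin n → ℝ) → ℂ), Continuous G →
      ∫ y, U k y • G (Function.update y k 0) ∂(Measure.pi fun _ => ν) = 0)
    (hEQ : ∫ y, ∑ k, V k y * U k y ∂(Measure.pi fun _ => ν) = vW)
    (hL0 : 0 ≤ L) (hq0 : 0 < q) (hnq : (n : ℝ) = q ^ 4)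
    (hVarQ : Var[fun y => ∑ k, V k y * U k y; Measure.pi fun _ => ν] ≤ L * q ^ 6)
    (hVU : ∀ k, ∫ y, V k y ^ 2 * |U k y| ∂(Measure.pi fun _ => ν) ≤ L) {s t : ℝ} (hs : |s| ≤ |t|) :
    ‖∫ y, Complex.I * ((W y - m) / q ^ 2 : ℝ) *
        Complex.exp (Complex.I * (s * ((W y - m) / q ^ 2) : ℝ)) ∂(Measure.pi fun _ => ν)
      + s * (vW / n : ℝ) * ∫ y, Complex.exp (Complex.I * (s * ((W y - m) / q ^ 2) : ℝ))
        ∂(Measure.pi fun _ => ν)‖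
      ≤ 2 * t ^ 2 * L / q ^ 2 + |t| * √L / q := by
  set P : Measure (Fin n → ℝ) := Measure.pi fun _ => ν
  have cF : Continuous fun y => (W y - m) / q ^ 2 := (cW.sub continuous_const).div_const _
  obtain ⟨F, hFdef⟩ : ∃ F : (Fin n → ℝ) → ℝ, F = fun y => (W y - m) / q ^ 2 := ⟨_, rfl⟩
  rw [← hFdef] at cF
  have hFy : ∀ y, (W y - m) / q ^ 2 = F y := fun y => by rw [hFdef]
  simp only [hFy]
  have cE : Continuous fun y => Complex.exp (Complex.I * (s * F y : ℝ)) := by fun_prop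
  obtain ⟨e, he⟩ : ∃ e : (Fin n → ℝ) → ℂ, e = fun y => Complex.exp (Complex.I * (s * F y : ℝ)) :=
    ⟨_, rfl⟩
  have hey : ∀ y, Complex.exp (Complex.I * (s * F y : ℝ)) = e y := fun y => by rw [he]
  simp only [hey] at cE ⊢
  have hne : ∀ y, ‖e y‖ = 1 := fun y => by rw [← hey, Complex.norm_exp_I_mul_ofReal]
  have ceu : ∀ k, Continuous fun y => e (Function.update y k 0) := fun k =>
    cE.comp (continuous_update_zero k)
  have hI : ∀ {G : (Fin n → ℝ) → ℂ}, Continuous G → Integrable G P := fun hG =>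
    integrable_of_continuous_normed hτ hG
  -- the second order remainder of the exponential
  set R : Fin n → (Fin n → ℝ) → ℂ := fun k y =>
    e y - e (Function.update y k 0) - Complex.I * (s * V k y / q ^ 2 : ℝ) * e y with hR
  have hRn : ∀ k y, ‖R k y‖ ≤ 2 * (s * V k y / q ^ 2) ^ 2 := by
    intro k y
    have h1 : e (Function.update y k 0)
        = e y * Complex.exp (Complex.I * (-(s * V k y / q ^ 2) : ℝ)) := by
      rw [← hey, ← hey, ← Complex.exp_add]
      congr 1
      rw [← hFy, ← hFy, ← hqs k y]
      push_cast; ring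
    have h2 : R k y = -(e y * (Complex.exp (Complex.I * (-(s * V k y / q ^ 2) : ℝ)) - 1
        - Complex.I * (-(s * V k y / q ^ 2) : ℝ))) := by
      simp only [hR, h1]; push_cast; ring
    rw [h2, norm_neg, norm_mul, hne, one_mul]
    exact (norm_exp_I_mul_sub_le _).trans_eq (by ring)
  have cR : ∀ k, Continuous (R k) := fun k => by
    have := cV k; have := ceu k
    simp only [hR]; fun_prop
  have hUe : ∀ k, ∫ y, (U k y : ℂ) * e y ∂P =
      Complex.I * (s / q ^ 2 : ℝ) * ∫ y, ((V k y * U k y : ℝ) : ℂ) * e y ∂P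
        + ∫ y, (U k y : ℂ) * R k y ∂P := by
    intro k
    have h1 := horth k e cE
    simp only [Complex.real_smul] at h1
    have cVk := cV k; have cUk := cU k; have cRk := cR k
    rw [← integral_const_mul, ← integral_add (hI (by fun_prop)) (hI (by fun_prop)),
      ← sub_eq_zero, ← integral_sub (hI (by fun_prop)) (hI (by fun_prop)), ← h1]
    refine integral_congr_ae (ae_of_all _ fun y => ?_)
    simp only [hR]; push_cast; ring
  -- the derivative of the characteristic function
  have hder : ∫ y, Complex.I * F y * e y ∂P = Complex.I / q ^ 2 *
      ∑ k, ∫ y, (U k y : ℂ) * e y ∂P := by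
    rw [← integral_finsetSum _ fun k _ => hI (by have := cU k; fun_prop), ← integral_const_mul]
    refine integral_congr_ae (ae_of_all _ fun y => ?_)
    dsimp only
    rw [← Finset.sum_mul, ← Complex.ofReal_sum, hsum y]
    rw [← hFy]; push_cast; ring
  have cQ : Continuous fun y => ∑ k, V k y * U k y :=
    continuous_finsetSum _ fun k _ => (cV k).mul (cU k)
  have hQ : ∑ k, ∫ y, ((V k y * U k y : ℝ) : ℂ) * e y ∂P
      = vW * ∫ y, e y ∂P + ∫ y, ((∑ k, V k y * U k y - vW : ℝ) : ℂ) * e y ∂P := by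
    rw [← integral_finsetSum _ fun k _ => hI (by have := cU k; have := cV k; fun_prop),
      ← integral_const_mul, ← integral_add (hI (by fun_prop)) (hI (by fun_prop))]
    refine integral_congr_ae (ae_of_all _ fun y => ?_)
    dsimp only
    rw [← Finset.sum_mul]; push_cast; ring
  have hid : ∫ y, Complex.I * F y * e y ∂P + s * (vW / n : ℝ) * ∫ y, e y ∂P
      = -(s / q ^ 4 : ℝ) * ∫ y, ((∑ k, V k y * U k y - vW : ℝ) : ℂ) * e y ∂P
        + Complex.I / q ^ 2 * ∑ k, ∫ y, (U k y : ℂ) * R k y ∂P := by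
    rw [hder]
    simp only [hUe]
    rw [Finset.sum_add_distrib, ← Finset.mul_sum, hQ, hnq]
    have hqc : (q : ℂ) ≠ 0 := by exact_mod_cast hq0.ne'
    push_cast
    field_simp
    linear_combination ((s : ℂ) * (vW * ∫ y, e y ∂P + ∫ y, ((∑ k, V k y * U k y : ℂ) - vW) * e y ∂P)) * Complex.I_sq
  -- the fluctuation of the sum of products, and the remainders of second order
  have hE1 : ‖∫ y, ((∑ k, V k y * U k y - vW : ℝ) : ℂ) * e y ∂P‖ ≤ √L * q ^ 3 := by
    have h1 : ‖∫ y, ((∑ k, V k y * U k y - vW : ℝ) : ℂ) * e y ∂P‖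
        ≤ ∫ y, |∑ k, V k y * U k y - vW| ∂P := by
      refine (norm_integral_le_integral_norm _).trans_eq ?_
      refine integral_congr_ae (ae_of_all _ fun y => ?_)
      simp only [norm_mul, hne, Complex.norm_real, mul_one, Real.norm_eq_abs]
    have h2 : (∫ y, |∑ k, V k y * U k y - vW| ∂P) ^ 2 ≤ L * q ^ 6 := by
      refine le_trans ?_ hVarQ
      rw [variance_eq_integral cQ.measurable.aemeasurable, hEQ]
      have cA : Continuous fun y => |∑ k, V k y * U k y - vW| := by fun_prop
      have h3 := variance_nonneg (fun y => |∑ k, V k y * U k y - vW|) P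
      rw [variance_eq_sub (memLp_of_continuous hτ cA 2)] at h3
      simp only [Pi.pow_apply, sq_abs] at h3
      linarith
    refine h1.trans (abs_le_of_sq_le_sq' ?_ (by positivity)).2
    refine h2.trans_eq ?_
    rw [mul_pow, Real.sq_sqrt hL0]; ring
  have hE2 : ∀ k, ‖∫ y, (U k y : ℂ) * R k y ∂P‖ ≤ 2 * s ^ 2 * L / q ^ 4 := by
    intro k
    have cVk := cV k; have cUk := cU k; have cRk := cR k
    calc ‖∫ y, (U k y : ℂ) * R k y ∂P‖ ≤ ∫ y, ‖(U k y : ℂ) * R k y‖ ∂P :=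
          norm_integral_le_integral_norm _
      _ ≤ ∫ y, 2 * s ^ 2 / q ^ 4 * (V k y ^ 2 * |U k y|) ∂P := by
          refine integral_mono (integrable_of_continuous hτ (by fun_prop))
            (integrable_of_continuous hτ (by fun_prop)) fun y => ?_
          dsimp only
          rw [norm_mul, Complex.norm_real, Real.norm_eq_abs]
          refine (mul_le_mul_of_nonneg_left (hRn k y) (abs_nonneg _)).trans_eq ?_
          rw [div_pow]; ring
      _ = 2 * s ^ 2 / q ^ 4 * ∫ y, V k y ^ 2 * |U k y| ∂P := integral_const_mul _ _
      _ ≤ 2 * s ^ 2 / q ^ 4 * L := mul_le_mul_of_nonneg_left (hVU k) (by positivity)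
      _ = _ := by ring
  have hs2 : s ^ 2 ≤ t ^ 2 := sq_le_sq.2 hs
  rw [hid]
  refine (norm_add_le _ _).trans ?_
  have e1 : ‖-((s / q ^ 4 : ℝ) : ℂ)‖ = |s| / q ^ 4 := by
    rw [norm_neg, Complex.norm_real, Real.norm_eq_abs, abs_div,
      abs_of_nonneg (by positivity : (0 : ℝ) ≤ q ^ 4)]
  have e2 : ‖Complex.I / (q : ℂ) ^ 2‖ = 1 / q ^ 2 := by
    rw [norm_div, Complex.norm_I, norm_pow, Complex.norm_real, Real.norm_of_nonneg hq0.le]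
  rw [norm_mul, norm_mul, e1, e2]
  have hsumR : ‖∑ k, ∫ y, (U k y : ℂ) * R k y ∂P‖ ≤ q ^ 4 * (2 * s ^ 2 * L / q ^ 4) := by
    refine (norm_sum_le _ _).trans ((Finset.sum_le_sum fun k _ => hE2 k).trans_eq ?_)
    simp [hnq]
  have hL' : 0 ≤ √L := Real.sqrt_nonneg _
  calc |s| / q ^ 4 * ‖∫ y, ((∑ k, V k y * U k y - vW : ℝ) : ℂ) * e y ∂P‖
        + 1 / q ^ 2 * ‖∑ k, ∫ y, (U k y : ℂ) * R k y ∂P‖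
      ≤ |s| / q ^ 4 * (√L * q ^ 3) + 1 / q ^ 2 * (q ^ 4 * (2 * s ^ 2 * L / q ^ 4)) := by gcongr
    _ = |s| * √L / q + 2 * s ^ 2 * L / q ^ 2 := by field_simp
    _ ≤ |t| * √L / q + 2 * t ^ 2 * L / q ^ 2 := by gcongr
    _ = _ := by ring

/-- Normal approximation of the centered `quartic`, uniformly over the matrices of bounded operator
norm. -/
theorem exists_norm_charFun_quartic_sub_le (hτ : ∀ᵐ y ∂ν, |y| ≤ τ) (hτ1 : 1 ≤ τ)
    (hsymm : ν.map (fun x => -x) = ν) (hC : 1 ≤ C) (hρ : 0 ≤ ρ) :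
    ∃ L, 0 ≤ L ∧ ∀ {n : ℕ} {A : Matrix (Fin n) (Fin n) ℝ} {r : ℝ}, 0 < n → OpBound A C →
      |r| ≤ ρ → ∀ t : ℝ,
      ‖∫ y, Complex.exp (Complex.I * (t * ((quartic A r y
          - ∫ z, quartic A r z ∂(Measure.pi fun _ => ν)) / √n) : ℝ)) ∂(Measure.pi fun _ => ν)
        - Real.exp (-(Var[quartic A r; Measure.pi fun _ => ν] / n * t ^ 2 / 2))‖
      ≤ L * (1 + |t| ^ 3) / √√n := by
  obtain ⟨L, hL0, hL⟩ := exists_bound_incTerm_steinTerm hτ hτ1 hsymm hC hρ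
  refine ⟨2 * L + √L, by positivity, ?_⟩
  intro n A r hn hA hr t
  obtain ⟨hVarQ, hVU⟩ := hL hn hA hr
  have hsum := sum_steinTerm_eq (A := A) (r := r) hτ hsymm
  have hEQ := integral_sum_incTerm_mul_steinTerm (A := A) (r := r) hτ hsymm
  have horth := fun (k : Fin n) (G : (Fin n → ℝ) → ℂ) (hG : Continuous G) =>
    integral_steinTerm_smul_update (A := A) (r := r) hτ hsymm hG k
  have hqs := fun k y => quartic_sub_update (A := A) (r := r) (k := k) y
  set P : Measure (Fin n → ℝ) := Measure.pi fun _ => ν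
  set m := ∫ z, quartic A r z ∂P
  -- only the properties collected above matter from here on
  set V := incTerm A r
  set U := steinTerm A r (∫ x, x ^ 2 ∂ν) (∫ x, x ^ 4 ∂ν)
  have cW : Continuous (quartic A r) := continuous_quartic A r
  have cV : ∀ k, Continuous (V k) := continuous_incTerm A r
  have cU : ∀ k, Continuous (U k) := continuous_steinTerm A r _ _
  set W := quartic A r
  set vW := Var[W; P]
  have hvW : 0 ≤ vW := variance_nonneg _ _
  clear_value V U W vW m
  have hn0 : (0 : ℝ) < n := by exact_mod_cast hn
  have hn1 : (1 : ℝ) ≤ n := by exact_mod_cast hn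
  obtain ⟨q, hq1, hq4, hqq⟩ : ∃ q : ℝ, 1 ≤ q ∧ √√(n : ℝ) = q ∧ √(n : ℝ) = q ^ 2 :=
    ⟨√√n, Real.one_le_sqrt.2 (Real.one_le_sqrt.2 hn1), rfl,
      (Real.sq_sqrt (Real.sqrt_nonneg _)).symm⟩
  have hnq : (n : ℝ) = q ^ 4 := by
    rw [show q ^ 4 = (q ^ 2) ^ 2 by ring, ← hqq, Real.sq_sqrt hn0.le]
  have hq0 : 0 < q := by linarith
  rw [hq4, hqq]
  set F : (Fin n → ℝ) → ℝ := fun y => (W y - m) / q ^ 2 with hFdef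
  have cF : Continuous F := (cW.sub continuous_const).div_const _
  have key := norm_sub_exp_le_of_hasDerivAt (v := vW / n) (t := t)
    (ε := 2 * t ^ 2 * L / q ^ 2 + |t| * √L / q) (by positivity)
    (fun s => hasDerivAt_integral_exp hτ cF s) (by simp) fun s hs =>
      norm_deriv_add_le hτ cW cV cU hsum hqs horth hEQ hL0 hq0 hnq
        (hVarQ.trans_eq (by rw [hqq, hnq]; ring)) hVU hs
  refine key.trans ?_
  have hs : 0 ≤ √L := Real.sqrt_nonneg _
  have ht : 0 ≤ |t| := abs_nonneg t
  have h1 : 2 * t ^ 2 * L / q ^ 2 ≤ 2 * t ^ 2 * L / q := by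
    refine div_le_div_of_nonneg_left (by positivity) hq0 ?_
    nlinarith
  have h2 : |t| ^ 2 ≤ 1 + |t| ^ 3 := by nlinarith [sq_nonneg (|t| - 1), sq_nonneg |t|]
  calc (2 * t ^ 2 * L / q ^ 2 + |t| * √L / q) * |t|
      ≤ (2 * t ^ 2 * L / q + |t| * √L / q) * |t| := by gcongr
    _ = (2 * L * |t| ^ 3 + √L * |t| ^ 2) / q := by rw [← sq_abs t]; ring
    _ ≤ (2 * L * (1 + |t| ^ 3) + √L * (1 + |t| ^ 3)) / q := by
        gcongr
        linarith
    _ = _ := by ring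

end CharFun

/-! ### Joint moments and cumulants of pairs of sums -/

/-- The mixed moments of orders at most `(4, 4)` of a pair of random variables in terms of the joint
cumulants `g s t`; moments and cumulants of odd total order are supposed to vanish. The coefficients
count the partitions of `p` points of a first and `q` points of a second kind into blocks of given
types. Only the orders at most `(4, 4)` are meaningful. -/
def jointMoment (g : ℕ → ℕ → ℝ) : ℕ → ℕ → ℝ
  | 0, 0 => 1
  | 0, 2 => g 0 2
  | 0, 4 => g 0 4 + 3 * g 0 2 ^ 2
  | 1, 1 => g 1 1
  | 1, 3 => g 1 3 + 3 * g 0 2 * g 1 1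
  | 2, 0 => g 2 0
  | 2, 2 => g 2 2 + g 0 2 * g 2 0 + 2 * g 1 1 ^ 2
  | 2, 4 => g 2 4 + 6 * g 0 2 * g 2 2 + g 0 4 * g 2 0 + 8 * g 1 1 * g 1 3 + 3 * g 0 2 ^ 2 * g 2 0 +
      12 * g 0 2 * g 1 1 ^ 2
  | 3, 1 => g 3 1 + 3 * g 1 1 * g 2 0
  | 3, 3 => g 3 3 + 3 * g 0 2 * g 3 1 + 9 * g 1 1 * g 2 2 + 3 * g 1 3 * g 2 0 + 9 * g 0 2 * g 1 1 *
      g 2 0 + 6 * g 1 1 ^ 3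
  | 4, 0 => g 4 0 + 3 * g 2 0 ^ 2
  | 4, 2 => g 4 2 + g 0 2 * g 4 0 + 8 * g 1 1 * g 3 1 + 6 * g 2 0 * g 2 2 + 3 * g 0 2 * g 2 0 ^ 2 +
      12 * g 1 1 ^ 2 * g 2 0
  | 4, 4 => g 4 4 + 6 * g 0 2 * g 4 2 + g 0 4 * g 4 0 + 16 * g 1 1 * g 3 3 + 16 * g 1 3 * g 3 1 + 6
      * g 2 0 * g 2 4 + 18 * g 2 2 ^ 2 + 3 * g 0 2 ^ 2 * g 4 0 + 48 * g 0 2 * g 1 1 * g 3 1 +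
      36 * g 0 2 * g 2 0 * g 2 2 + 3 * g 0 4 * g 2 0 ^ 2 + 72 * g 1 1 ^ 2 * g 2 2 + 48 * g 1 1
      * g 1 3 * g 2 0 + 9 * g 0 2 ^ 2 * g 2 0 ^ 2 + 72 * g 0 2 * g 1 1 ^ 2 * g 2 0 + 24 * g 1
      1 ^ 4
  | _, _ => 0

/-- The joint cumulants of orders at most `(4, 4)` in terms of the mixed moments, when those of odd
total order vanish. -/
def jointCumulant (M : ℕ → ℕ → ℝ) : ℕ → ℕ → ℝ
  | 0, 2 => M 0 2
  | 0, 4 => M 0 4 - 3 * M 0 2 ^ 2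
  | 1, 1 => M 1 1
  | 1, 3 => M 1 3 - 3 * M 0 2 * M 1 1
  | 2, 0 => M 2 0
  | 2, 2 => M 2 2 - M 0 2 * M 2 0 - 2 * M 1 1 ^ 2
  | 2, 4 => M 2 4 - 6 * M 0 2 * M 2 2 - M 0 4 * M 2 0 - 8 * M 1 1 * M 1 3 + 6 * M 0 2 ^ 2 * M 2 0 +
      24 * M 0 2 * M 1 1 ^ 2
  | 3, 1 => M 3 1 - 3 * M 1 1 * M 2 0
  | 3, 3 => M 3 3 - 3 * M 0 2 * M 3 1 - 9 * M 1 1 * M 2 2 - 3 * M 1 3 * M 2 0 + 18 * M 0 2 * M 1 1 *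
      M 2 0 + 12 * M 1 1 ^ 3
  | 4, 0 => M 4 0 - 3 * M 2 0 ^ 2
  | 4, 2 => M 4 2 - M 0 2 * M 4 0 - 8 * M 1 1 * M 3 1 - 6 * M 2 0 * M 2 2 + 6 * M 0 2 * M 2 0 ^ 2 +
      24 * M 1 1 ^ 2 * M 2 0
  | 4, 4 => M 4 4 - 6 * M 0 2 * M 4 2 - M 0 4 * M 4 0 - 16 * M 1 1 * M 3 3 - 16 * M 1 3 * M 3 1 - 6
      * M 2 0 * M 2 4 - 18 * M 2 2 ^ 2 + 6 * M 0 2 ^ 2 * M 4 0 + 96 * M 0 2 * M 1 1 * M 3 1 +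
      72 * M 0 2 * M 2 0 * M 2 2 + 6 * M 0 4 * M 2 0 ^ 2 + 144 * M 1 1 ^ 2 * M 2 2 + 96 * M 1
      1 * M 1 3 * M 2 0 - 54 * M 0 2 ^ 2 * M 2 0 ^ 2 - 432 * M 0 2 * M 1 1 ^ 2 * M 2 0 - 144 *
      M 1 1 ^ 4
  | _, _ => 0

lemma jointMoment_jointCumulant {M : ℕ → ℕ → ℝ} (h0 : M 0 0 = 1)
    (hodd : ∀ p q, Odd (p + q) → M p q = 0) {p q : ℕ} (hp : p ≤ 4) (hq : q ≤ 4) :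
    jointMoment (jointCumulant M) p q = M p q := by
  interval_cases p <;> interval_cases q <;>
    first
    | exact (hodd _ _ (by decide)).symm
    | (simp only [jointMoment, jointCumulant, h0]; done)
    | (simp only [jointMoment, jointCumulant]; ring)

set_option maxHeartbeats 4000000 in
/-- Joint cumulants of independent pairs add up: the right hand side is the binomial expansion of the
mixed moments of a sum. -/
lemma jointMoment_add (g h : ℕ → ℕ → ℝ) {p q : ℕ} (hp : p ≤ 4) (hq : q ≤ 4) :
    jointMoment (g + h) p q = ∑ i ∈ Finset.range (p + 1), ∑ j ∈ Finset.range (q + 1),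
      (p.choose i * q.choose j : ℝ) * (jointMoment g i j * jointMoment h (p - i) (q - j)) := by
  interval_cases p <;> interval_cases q <;>
    (simp [Finset.sum_range_succ, jointMoment, Nat.choose]; try ring)

lemma jointMoment_smul (g : ℕ → ℕ → ℝ) (a b : ℝ) {p q : ℕ} (hp : p ≤ 4) (hq : q ≤ 4) :
    jointMoment (fun s t => a ^ s * b ^ t * g s t) p q = a ^ p * b ^ q * jointMoment g p q := by
  interval_cases p <;> interval_cases q <;> (simp only [jointMoment]; try ring)

lemma abs_pow_mul_pow_le (x y : ℝ) {p q : ℕ} (hp : p ≤ 4) (hq : q ≤ 4) :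
    |x ^ p * y ^ q| ≤ 2 + x ^ 8 + y ^ 8 := by
  have h1 := pow_le_one_add_pow (x := x) (a := 2 * p) (b := 8) (by omega) (by simp) (by decide)
  have h2 := pow_le_one_add_pow (x := y) (a := 2 * q) (b := 8) (by omega) (by simp) (by decide)
  rw [mul_comm, pow_mul] at h1 h2
  rw [abs_mul, abs_pow, abs_pow]
  have h3 : (|x| ^ p) ^ 2 = (x ^ 2) ^ p := by rw [← sq_abs x]; ring
  have h4 : (|y| ^ q) ^ 2 = (y ^ 2) ^ q := by rw [← sq_abs y]; ring
  rw [← pow_mul, mul_comm, pow_mul, ← h3] at h1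
  rw [← pow_mul, mul_comm, pow_mul, ← h4] at h2
  nlinarith [sq_nonneg (|x| ^ p - |y| ^ q), sq_nonneg (|x| ^ p), sq_nonneg (|y| ^ q)]

section Cumulants

variable {Ω : Type*} [MeasurableSpace Ω] {P : Measure Ω} [IsProbabilityMeasure P]

/-- The pair `Z` has finite eighth moments, and its mixed moments of orders at most `(4, 4)` are
those that belong to the joint cumulants `g`; in particular those of odd total order vanish. -/
structure HasCumulants (Z : Ω → ℝ × ℝ) (g : ℕ → ℕ → ℝ) (P : Measure Ω) : Prop where
  measurable : Measurable Z
  integrable_fst : Integrable (fun ω => (Z ω).1 ^ 8) P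
  integrable_snd : Integrable (fun ω => (Z ω).2 ^ 8) P
  moment : ∀ {p q : ℕ}, p ≤ 4 → q ≤ 4 → ∫ ω, (Z ω).1 ^ p * (Z ω).2 ^ q ∂P = jointMoment g p q

namespace HasCumulants

variable {Z X Y : Ω → ℝ × ℝ} {g h : ℕ → ℕ → ℝ}

lemma integrable_mul_of_integrable_pow (hZ : Measurable Z)
    (h1 : Integrable (fun ω => (Z ω).1 ^ 8) P) (h2 : Integrable (fun ω => (Z ω).2 ^ 8) P)
    {p q : ℕ} (hp : p ≤ 4) (hq : q ≤ 4) :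
    Integrable (fun ω => (Z ω).1 ^ p * (Z ω).2 ^ q) P := by
  refine Integrable.mono' (((integrable_const 2).add h1).add h2)
    (by fun_prop : Measurable _).aestronglyMeasurable (ae_of_all _ fun ω => ?_)
  exact abs_pow_mul_pow_le _ _ hp hq

lemma integrable_mul (hZ : HasCumulants Z g P) {p q : ℕ} (hp : p ≤ 4) (hq : q ≤ 4) :
    Integrable (fun ω => (Z ω).1 ^ p * (Z ω).2 ^ q) P :=
  integrable_mul_of_integrable_pow hZ.measurable hZ.integrable_fst hZ.integrable_snd hp hq

lemma zero : HasCumulants (fun _ : Ω => (0 : ℝ × ℝ)) 0 P where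
  measurable := measurable_const
  integrable_fst := by simp
  integrable_snd := by simp
  moment := by
    intro p q hp hq
    simp only [Prod.fst_zero, Prod.snd_zero, integral_const, probReal_univ, smul_eq_mul, one_mul]
    interval_cases p <;> interval_cases q <;> simp [jointMoment]

lemma add (hX : HasCumulants X g P) (hY : HasCumulants Y h P) (hXY : IndepFun X Y P) :
    HasCumulants (X + Y) (g + h) P where
  measurable := hX.measurable.add hY.measurable
  integrable_fst := by
    have := hX.measurable; have := hY.measurable
    refine Integrable.mono' ((hX.integrable_fst.add hY.integrable_fst).const_mul (2 ^ 7))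
      (by fun_prop : Measurable _).aestronglyMeasurable (ae_of_all _ fun ω => ?_)
    rw [Real.norm_of_nonneg (Even.pow_nonneg (by decide) _)]
    exact Even.add_pow_le (by decide)
  integrable_snd := by
    have := hX.measurable; have := hY.measurable
    refine Integrable.mono' ((hX.integrable_snd.add hY.integrable_snd).const_mul (2 ^ 7))
      (by fun_prop : Measurable _).aestronglyMeasurable (ae_of_all _ fun ω => ?_)
    rw [Real.norm_of_nonneg (Even.pow_nonneg (by decide) _)]
    exact Even.add_pow_le (by decide)
  moment := by
    intro p q hp hq
    rw [jointMoment_add g h hp hq]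
    have hind : ∀ i j i' j' : ℕ, IndepFun (fun ω => (X ω).1 ^ i * (X ω).2 ^ j)
        (fun ω => (Y ω).1 ^ i' * (Y ω).2 ^ j') P := fun i j i' j' =>
      hXY.comp (φ := fun z : ℝ × ℝ => z.1 ^ i * z.2 ^ j) (ψ := fun z : ℝ × ℝ => z.1 ^ i' * z.2 ^ j')
        (by fun_prop) (by fun_prop)
    have hi : ∀ i ≤ p, ∀ j ≤ q, Integrable (fun ω => (p.choose i * q.choose j : ℝ) *
        (((X ω).1 ^ i * (X ω).2 ^ j) * ((Y ω).1 ^ (p - i) * (Y ω).2 ^ (q - j)))) P :=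
      fun i hi j hj => ((hind i j (p - i) (q - j)).integrable_mul
        (hX.integrable_mul (by omega) (by omega))
        (hY.integrable_mul (by omega) (by omega))).const_mul _
    have hexp : ∀ ω, ((X + Y) ω).1 ^ p * ((X + Y) ω).2 ^ q =
        ∑ i ∈ Finset.range (p + 1), ∑ j ∈ Finset.range (q + 1), (p.choose i * q.choose j : ℝ) *
          (((X ω).1 ^ i * (X ω).2 ^ j) * ((Y ω).1 ^ (p - i) * (Y ω).2 ^ (q - j))) := by
      intro ω
      rw [Pi.add_apply, Prod.fst_add, Prod.snd_add, add_pow, add_pow, Finset.sum_mul_sum]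
      refine Finset.sum_congr rfl fun i _ => Finset.sum_congr rfl fun j _ => ?_
      ring
    simp only [hexp]
    rw [integral_finsetSum _ fun i hi' => integrable_finsetSum _ fun j hj => hi i
      (by simpa [Nat.lt_succ_iff] using hi') j (by simpa [Nat.lt_succ_iff] using hj)]
    refine Finset.sum_congr rfl fun i hi' => ?_
    have hip : i ≤ p := by simpa [Nat.lt_succ_iff] using hi'
    rw [integral_finsetSum _ fun j hj => hi i hip j (by simpa [Nat.lt_succ_iff] using hj)]
    refine Finset.sum_congr rfl fun j hj => ?_
    have hjq : j ≤ q := by simpa [Nat.lt_succ_iff] using hj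
    rw [integral_const_mul, (hind i j (p - i) (q - j)).integral_fun_mul_eq_mul_integral
      (hX.integrable_mul (by omega) (by omega)).aestronglyMeasurable
      (hY.integrable_mul (by omega) (by omega)).aestronglyMeasurable,
      hX.moment (by omega) (by omega), hY.moment (by omega) (by omega)]

lemma smul (hZ : HasCumulants Z g P) (a b : ℝ) :
    HasCumulants (fun ω => (a * (Z ω).1, b * (Z ω).2)) (fun s t => a ^ s * b ^ t * g s t) P where
  measurable := by have := hZ.measurable; fun_prop
  integrable_fst := by simpa only [mul_pow] using hZ.integrable_fst.const_mul _
  integrable_snd := by simpa only [mul_pow] using hZ.integrable_snd.const_mul _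
  moment := by
    intro p q hp hq
    rw [jointMoment_smul g a b hp hq, ← hZ.moment hp hq, ← integral_const_mul]
    refine integral_congr_ae (ae_of_all _ fun ω => ?_)
    simp only [mul_pow]; ring

lemma sum {ι : Type*} {Z : ι → Ω → ℝ × ℝ} {g : ι → ℕ → ℕ → ℝ}
    (hZ : ∀ i, HasCumulants (Z i) (g i) P) (hind : iIndepFun Z P) (s : Finset ι) :
    HasCumulants (∑ i ∈ s, Z i) (∑ i ∈ s, g i) P := by
  classical
  induction s using Finset.induction_on with
  | empty => simpa using! (zero (P := P))
  | insert i s hi ih =>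
    rw [Finset.sum_insert hi, Finset.sum_insert hi]
    exact (hZ i).add ih (hind.indepFun_finsetSum_of_notMem (fun i => (hZ i).measurable) hi).symm

end HasCumulants

end Cumulants

/-! ### Covariances of power sums of linear combinations -/

/-- The sum of the `p`-th powers of the entries of `A y`. -/
def powSum {n : ℕ} (A : Matrix (Fin n) (Fin n) ℝ) (p : ℕ) (y : Fin n → ℝ) : ℝ :=
  ∑ i, (A *ᵥ y) i ^ p

lemma quartic_eq_powSum {n : ℕ} (A : Matrix (Fin n) (Fin n) ℝ) (r : ℝ) (y : Fin n → ℝ) :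
    quartic A r y = powSum A 4 y - r * powSum A 2 y := by
  simp only [quartic, powSum, Finset.sum_sub_distrib, Finset.mul_sum]

/-- The covariance of the `p`-th power of the first and the `q`-th power of the second component
of a pair with joint cumulants `g`. -/
def covMoment (g : ℕ → ℕ → ℝ) (p q : ℕ) : ℝ :=
  jointMoment g p q - jointMoment g p 0 * jointMoment g 0 q

/-- The joint cumulants of the linear combinations `∑ k, a k * x k` and `∑ k, b k * x' k`, where the
pairs `(x k, x' k)` are independent with joint cumulants `κ`. -/
def linCum {n : ℕ} (a b : Fin n → ℝ) (κ : ℕ → ℕ → ℝ) (s t : ℕ) : ℝ :=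
  (∑ k, a k ^ s * b k ^ t) * κ s t

section Covariance

variable {Ω : Type*} [MeasurableSpace Ω] {P : Measure Ω} [IsProbabilityMeasure P]

namespace HasCumulants

variable {Z : Ω → ℝ × ℝ} {g : ℕ → ℕ → ℝ}

lemma memLp_fst_pow (hZ : HasCumulants Z g P) {p : ℕ} (hp : p ≤ 4) :
    MemLp (fun ω => (Z ω).1 ^ p) 2 P := by
  have hm := hZ.measurable
  refine (memLp_two_iff_integrable_sq (by fun_prop : Measurable _).aestronglyMeasurable).2 ?_
  refine Integrable.mono' ((integrable_const 1).add hZ.integrable_fst)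
    (by fun_prop : Measurable _).aestronglyMeasurable (ae_of_all _ fun ω => ?_)
  rw [Real.norm_of_nonneg (sq_nonneg _), ← pow_mul]
  exact pow_le_one_add_pow (by omega) (by simp) (by decide)

lemma memLp_snd_pow (hZ : HasCumulants Z g P) {p : ℕ} (hp : p ≤ 4) :
    MemLp (fun ω => (Z ω).2 ^ p) 2 P := by
  have hm := hZ.measurable
  refine (memLp_two_iff_integrable_sq (by fun_prop : Measurable _).aestronglyMeasurable).2 ?_
  refine Integrable.mono' ((integrable_const 1).add hZ.integrable_snd)
    (by fun_prop : Measurable _).aestronglyMeasurable (ae_of_all _ fun ω => ?_)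
  rw [Real.norm_of_nonneg (sq_nonneg _), ← pow_mul]
  exact pow_le_one_add_pow (by omega) (by simp) (by decide)

lemma integral_fst_pow (hZ : HasCumulants Z g P) {p : ℕ} (hp : p ≤ 4) :
    ∫ ω, (Z ω).1 ^ p ∂P = jointMoment g p 0 := by
  simpa using hZ.moment hp (Nat.zero_le 4)

lemma integral_snd_pow (hZ : HasCumulants Z g P) {p : ℕ} (hp : p ≤ 4) :
    ∫ ω, (Z ω).2 ^ p ∂P = jointMoment g 0 p := by
  simpa using hZ.moment (Nat.zero_le 4) hp

lemma covariance_pow (hZ : HasCumulants Z g P) {p q : ℕ} (hp : p ≤ 4) (hq : q ≤ 4) :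
    cov[fun ω => (Z ω).1 ^ p, fun ω => (Z ω).2 ^ q; P] = covMoment g p q := by
  rw [covariance_eq_sub (hZ.memLp_fst_pow hp) (hZ.memLp_snd_pow hq), hZ.integral_fst_pow hp,
    hZ.integral_snd_pow hq, covMoment, ← hZ.moment hp hq]
  rfl

end HasCumulants

end Covariance

/-- An odd function with finite eighth moment under `μ`. -/
structure OddTransform (μ : Measure ℝ) (f : ℝ → ℝ) : Prop where
  measurable : Measurable f
  odd : ∀ x, f (-x) = -f x
  integrable_pow : Integrable (fun x => f x ^ 8) μ

/-- The mixed moments of `f` and `f'` under `μ`, up to the order `(4, 4)`; they are set to zero beyond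
that order, where they need not exist. -/
noncomputable def pairMoment (μ : Measure ℝ) (f f' : ℝ → ℝ) (p q : ℕ) : ℝ :=
  if p ≤ 4 ∧ q ≤ 4 then ∫ x, f x ^ p * f' x ^ q ∂μ else 0

/-- The joint cumulants of `f` and `f'` under `μ`, up to the order `(4, 4)`. -/
noncomputable def pairCumulant (μ : Measure ℝ) (f f' : ℝ → ℝ) : ℕ → ℕ → ℝ :=
  jointCumulant (pairMoment μ f f')

section Canonical

variable {n : ℕ} {μ : Measure ℝ} [IsProbabilityMeasure μ] {f f' : ℝ → ℝ}

lemma hasCumulants_eval (hsymm : μ.map (fun x => -x) = μ) (hf : OddTransform μ f)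
    (hf' : OddTransform μ f') (k : Fin n) :
    HasCumulants (fun ω : Fin n → ℝ => (f (ω k), f' (ω k))) (pairCumulant μ f f')
      (Measure.pi fun _ => μ) := by
  have hm := hf.measurable
  have hm' := hf'.measurable
  have mp : MeasurePreserving (fun ω : Fin n → ℝ => ω k) (Measure.pi fun _ => μ) μ :=
    measurePreserving_eval (fun _ => μ) k
  refine ⟨by fun_prop, mp.integrable_comp_of_integrable hf.integrable_pow,
    mp.integrable_comp_of_integrable hf'.integrable_pow, ?_⟩
  intro p q hp hq
  have h1 : ∫ ω : Fin n → ℝ, f (ω k) ^ p * f' (ω k) ^ q ∂(Measure.pi fun _ => μ)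
      = pairMoment μ f f' p q := by
    rw [pairMoment, if_pos ⟨hp, hq⟩]
    exact integral_comp_eval (μ := fun _ : Fin n => μ) (f := fun x => f x ^ p * f' x ^ q) (i := k)
      (by fun_prop : Measurable _).aestronglyMeasurable
  rw [h1, pairCumulant, jointMoment_jointCumulant _ _ hp hq]
  · simp [pairMoment]
  · intro p q hpq
    rw [pairMoment]
    split_ifs
    · have : ∫ x, f x ^ p * f' x ^ q ∂μ = ∫ x, f (-x) ^ p * f' (-x) ^ q ∂μ := by
        conv_lhs => rw [← hsymm]
        rw [integral_map (by fun_prop) (by fun_prop : Measurable _).aestronglyMeasurable]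
      simp only [hf.odd, hf'.odd] at this
      have h2 : ∀ x, (-f x) ^ p * (-f' x) ^ q = -(f x ^ p * f' x ^ q) := by
        intro x
        rw [neg_pow, neg_pow (f' x), mul_mul_mul_comm, ← pow_add, hpq.neg_one_pow]
        ring
      simp only [h2, integral_neg] at this
      linarith
    · rfl

lemma hasCumulants_sum (hsymm : μ.map (fun x => -x) = μ) (hf : OddTransform μ f)
    (hf' : OddTransform μ f') (a b : Fin n → ℝ) :
    HasCumulants (fun ω : Fin n → ℝ => (∑ k, a k * f (ω k), ∑ k, b k * f' (ω k)))
      (linCum a b (pairCumulant μ f f')) (Measure.pi fun _ => μ) := by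
  have hm := hf.measurable
  have hm' := hf'.measurable
  have hind : iIndepFun (fun k (ω : Fin n → ℝ) => (a k * f (ω k), b k * f' (ω k)))
      (Measure.pi fun _ => μ) :=
    iIndepFun_pi (μ := fun _ : Fin n => μ) (X := fun k x => (a k * f x, b k * f' x))
      fun k => (by fun_prop : Measurable _).aemeasurable
  have h := HasCumulants.sum (fun k => (hasCumulants_eval hsymm hf hf' k).smul (a k) (b k))
    hind Finset.univ
  convert h using 1
  · ext ω <;> simp [Prod.fst_sum, Prod.snd_sum]
  · ext s t
    simp [linCum, Finset.sum_mul]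

lemma hasCumulants_mulVec (hsymm : μ.map (fun x => -x) = μ) (hf : OddTransform μ f)
    (hf' : OddTransform μ f') (A : Matrix (Fin n) (Fin n) ℝ) (i j : Fin n) :
    HasCumulants (fun ω : Fin n → ℝ => ((A *ᵥ fun k => f (ω k)) i, (A *ᵥ fun k => f' (ω k)) j))
      (linCum (A i) (A j) (pairCumulant μ f f')) (Measure.pi fun _ => μ) :=
  hasCumulants_sum hsymm hf hf' (A i) (A j)

lemma memLp_powSum (hsymm : μ.map (fun x => -x) = μ) (hf : OddTransform μ f)
    (A : Matrix (Fin n) (Fin n) ℝ) {p : ℕ} (hp : p ≤ 4) :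
    MemLp (fun ω : Fin n → ℝ => powSum A p fun k => f (ω k)) 2 (Measure.pi fun _ => μ) :=
  memLp_finsetSum _ fun i _ => (hasCumulants_mulVec hsymm hf hf A i i).memLp_fst_pow hp

lemma integral_powSum (hsymm : μ.map (fun x => -x) = μ) (hf : OddTransform μ f)
    (A : Matrix (Fin n) (Fin n) ℝ) {p : ℕ} (hp : p ≤ 4) :
    ∫ ω : Fin n → ℝ, powSum A p (fun k => f (ω k)) ∂(Measure.pi fun _ => μ)
      = ∑ i, jointMoment (linCum (A i) (A i) (pairCumulant μ f f)) p 0 := by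
  have h := fun i => hasCumulants_mulVec hsymm hf hf A i i
  unfold powSum
  rw [integral_finsetSum _ fun i _ => ((h i).memLp_fst_pow hp).integrable (by norm_num)]
  exact Finset.sum_congr rfl fun i _ => (h i).integral_fst_pow hp

lemma covariance_powSum (hsymm : μ.map (fun x => -x) = μ) (hf : OddTransform μ f)
    (hf' : OddTransform μ f') (A : Matrix (Fin n) (Fin n) ℝ) {p q : ℕ} (hp : p ≤ 4) (hq : q ≤ 4) :
    cov[fun ω : Fin n → ℝ => powSum A p fun k => f (ω k),
      fun ω : Fin n → ℝ => powSum A q fun k => f' (ω k); Measure.pi fun _ => μ]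
      = ∑ i, ∑ j, covMoment (linCum (A i) (A j) (pairCumulant μ f f')) p q := by
  have h := hasCumulants_mulVec hsymm hf hf' A
  unfold powSum
  rw [covariance_fun_sum_fun_sum (fun i => (h i i).memLp_fst_pow hp)
    (fun j => (h j j).memLp_snd_pow hq)]
  exact Finset.sum_congr rfl fun i _ => Finset.sum_congr rfl fun j _ => (h i j).covariance_pow hp hq

/-- The covariance of `x ^ 4 - r * x ^ 2` and `y ^ 4 - r * y ^ 2` for a pair with joint cumulants
`g`. -/
def covPoly (r : ℝ) (g : ℕ → ℕ → ℝ) : ℝ :=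
  covMoment g 4 4 - r * (covMoment g 4 2 + covMoment g 2 4) + r ^ 2 * covMoment g 2 2

lemma memLp_quartic (hsymm : μ.map (fun x => -x) = μ) (hf : OddTransform μ f)
    (A : Matrix (Fin n) (Fin n) ℝ) (r : ℝ) :
    MemLp (fun ω : Fin n → ℝ => quartic A r fun k => f (ω k)) 2 (Measure.pi fun _ => μ) := by
  simp only [quartic_eq_powSum]
  exact (memLp_powSum hsymm hf A le_rfl).sub
    ((memLp_powSum hsymm hf A (p := 2) (by norm_num)).const_mul r)

lemma covariance_quartic (hsymm : μ.map (fun x => -x) = μ) (hf : OddTransform μ f)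
    (hf' : OddTransform μ f') (A : Matrix (Fin n) (Fin n) ℝ) (r : ℝ) :
    cov[fun ω : Fin n → ℝ => quartic A r fun k => f (ω k),
      fun ω : Fin n → ℝ => quartic A r fun k => f' (ω k); Measure.pi fun _ => μ]
      = ∑ i, ∑ j, covPoly r (linCum (A i) (A j) (pairCumulant μ f f')) := by
  have h4 := memLp_powSum hsymm hf A (p := 4) le_rfl
  have h2 := (memLp_powSum hsymm hf A (p := 2) (by norm_num)).const_mul r
  have h4' := memLp_powSum hsymm hf' A (p := 4) le_rfl
  have h2' := (memLp_powSum hsymm hf' A (p := 2) (by norm_num)).const_mul r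
  simp only [quartic_eq_powSum]
  rw [covariance_fun_sub_fun_sub h4 h2 h4' h2', covariance_const_mul_left,
    covariance_const_mul_left, covariance_const_mul_right, covariance_const_mul_right,
    covariance_powSum hsymm hf hf' A le_rfl le_rfl,
    covariance_powSum hsymm hf hf' A le_rfl (by norm_num),
    covariance_powSum hsymm hf hf' A (by norm_num) le_rfl,
    covariance_powSum hsymm hf hf' A (by norm_num) (by norm_num)]
  simp only [covPoly, Finset.sum_add_distrib, Finset.sum_sub_distrib, ← Finset.mul_sum]
  ring

end Canonical

/-! ### Truncation of the variables -/

/-- Bounds for the sums `c s t` of products of `s`-th and `t`-th powers of the entries of two rows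
of a matrix, in terms of a constant `D` and a weight `w` which is summable over pairs of rows. -/
structure PowSumBound (D w r : ℝ) (c : ℕ → ℕ → ℝ) : Prop where
  hD : 1 ≤ D
  hw : w = c 1 1 ^ 2 + c 3 1 ^ 2 + c 1 3 ^ 2 + c 2 2
  h22 : 0 ≤ c 2 2
  r : |r| ≤ D
  c20 : |c 2 0| ≤ D
  c02 : |c 0 2| ≤ D
  c11 : |c 1 1| ≤ D
  c22 : |c 2 2| ≤ D
  c42 : |c 4 2| ≤ D * c 2 2
  c24 : |c 2 4| ≤ D * c 2 2
  c33 : |c 3 3| ≤ D * c 2 2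
  c44 : |c 4 4| ≤ D * c 2 2

namespace PowSumBound

variable {D w r : ℝ} {c : ℕ → ℕ → ℝ}

lemma one (h : PowSumBound D w r c) : |(1 : ℝ)| ≤ D := by simpa using h.hD

lemma w_nonneg (h : PowSumBound D w r c) : 0 ≤ w := by
  rw [h.hw]; have := h.h22; positivity

lemma mul_mul (h : PowSumBound D w r c) {x y z : ℝ} (hx : |x| ≤ D) (hy : |y| ≤ D)
    (hz : |z| ≤ D * w) : |x * (y * z)| ≤ D ^ 3 * w := by
  have hD := h.hD
  have hw := h.w_nonneg
  rw [abs_mul, abs_mul]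
  calc |x| * (|y| * |z|) ≤ D * (D * (D * w)) := by gcongr
    _ = _ := by ring

lemma le_mul (h : PowSumBound D w r c) {x : ℝ} (hx : |x| ≤ w) : |x| ≤ D * w :=
  hx.trans (le_mul_of_one_le_left h.w_nonneg h.hD)

lemma b11 (h : PowSumBound D w r c) : |c 1 1 ^ 2| ≤ D * w := h.le_mul (by
  rw [abs_of_nonneg (sq_nonneg _), h.hw]
  nlinarith [h.h22, sq_nonneg (c 3 1), sq_nonneg (c 1 3)])

lemma b22 (h : PowSumBound D w r c) : |c 2 2| ≤ D * w := h.le_mul (by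
  rw [abs_of_nonneg h.h22, h.hw]
  nlinarith [sq_nonneg (c 1 1), sq_nonneg (c 3 1), sq_nonneg (c 1 3)])

lemma b1131 (h : PowSumBound D w r c) : |c 1 1 * c 3 1| ≤ D * w := h.le_mul (by
  rw [h.hw, abs_le]; have := h.h22
  constructor <;> nlinarith [sq_nonneg (c 1 1 + c 3 1), sq_nonneg (c 1 1 - c 3 1), sq_nonneg (c 1 3),
    sq_nonneg (c 1 1), sq_nonneg (c 3 1)])

lemma b1113 (h : PowSumBound D w r c) : |c 1 1 * c 1 3| ≤ D * w := h.le_mul (by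
  rw [h.hw, abs_le]; have := h.h22
  constructor <;> nlinarith [sq_nonneg (c 1 1 + c 1 3), sq_nonneg (c 1 1 - c 1 3), sq_nonneg (c 3 1),
    sq_nonneg (c 1 1), sq_nonneg (c 1 3)])

lemma b3113 (h : PowSumBound D w r c) : |c 3 1 * c 1 3| ≤ D * w := h.le_mul (by
  rw [h.hw, abs_le]; have := h.h22
  constructor <;> nlinarith [sq_nonneg (c 3 1 + c 1 3), sq_nonneg (c 3 1 - c 1 3), sq_nonneg (c 1 1),
    sq_nonneg (c 3 1), sq_nonneg (c 1 3)])

lemma mul_le_mul_w (h : PowSumBound D w r c) {x : ℝ} (hx : |x| ≤ D * c 2 2) : |x| ≤ D * w := by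
  have hD := h.hD
  refine hx.trans (mul_le_mul_of_nonneg_left ?_ (by linarith))
  rw [h.hw]
  nlinarith [sq_nonneg (c 1 1), sq_nonneg (c 3 1), sq_nonneg (c 1 3)]

lemma b42 (h : PowSumBound D w r c) : |c 4 2| ≤ D * w := h.mul_le_mul_w h.c42
lemma b24 (h : PowSumBound D w r c) : |c 2 4| ≤ D * w := h.mul_le_mul_w h.c24
lemma b33 (h : PowSumBound D w r c) : |c 3 3| ≤ D * w := h.mul_le_mul_w h.c33
lemma b44 (h : PowSumBound D w r c) : |c 4 4| ≤ D * w := h.mul_le_mul_w h.c44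

end PowSumBound

/-- A function of cumulants `κ` and of sums `c` whose combination
`Φ κ₁ + Φ κ₂ - 2 Φ κ₃` is, relative to the weight, small when `κ₁`, `κ₂`, `κ₃` are close to each
other. For covariances `Φ` this combination is the variance of a difference. -/
def SmallDiff (Φ : (ℕ → ℕ → ℝ) → ℝ → (ℕ → ℕ → ℝ) → ℝ) : Prop :=
  ∃ δ : (ℕ → ℕ → ℝ) → (ℕ → ℕ → ℝ) → (ℕ → ℕ → ℝ) → ℝ,
    (Continuous fun x : (ℕ → ℕ → ℝ) × (ℕ → ℕ → ℝ) × (ℕ → ℕ → ℝ) => δ x.1 x.2.1 x.2.2) ∧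
    (∀ κ, δ κ κ κ = 0) ∧ ∀ κ₁ κ₂ κ₃ D w r c, PowSumBound D w r c →
      |Φ κ₁ r c + Φ κ₂ r c - 2 * Φ κ₃ r c| ≤ δ κ₁ κ₂ κ₃ * (D ^ 3 * w)

lemma SmallDiff.add {Φ Ψ : (ℕ → ℕ → ℝ) → ℝ → (ℕ → ℕ → ℝ) → ℝ} (hΦ : SmallDiff Φ)
    (hΨ : SmallDiff Ψ) : SmallDiff (fun κ r c => Φ κ r c + Ψ κ r c) := by
  obtain ⟨δ, h1, h2, h3⟩ := hΦ
  obtain ⟨δ', h1', h2', h3'⟩ := hΨ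
  refine ⟨fun a b c => δ a b c + δ' a b c, h1.add h1', fun κ => by simp [h2, h2'], ?_⟩
  intro κ₁ κ₂ κ₃ D w r c h
  have e1 := h3 κ₁ κ₂ κ₃ D w r c h
  have e2 := h3' κ₁ κ₂ κ₃ D w r c h
  rw [add_mul]
  refine le_trans ?_ (add_le_add e1 e2)
  refine le_trans (le_of_eq ?_) (abs_add_le _ _)
  congr 1; ring

lemma smallDiff_mul {k : (ℕ → ℕ → ℝ) → ℝ} {m : ℝ → (ℕ → ℕ → ℝ) → ℝ} (hk : Continuous k)
    (hm : ∀ {D w r c}, PowSumBound D w r c → |m r c| ≤ D ^ 3 * w) :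
    SmallDiff (fun κ r c => k κ * m r c) := by
  refine ⟨fun a b c => |k a + k b - 2 * k c|, by fun_prop, fun κ => by ring_nf; simp, ?_⟩
  intro κ₁ κ₂ κ₃ D w r c h
  have e : k κ₁ * m r c + k κ₂ * m r c - 2 * (k κ₃ * m r c)
      = (k κ₁ + k κ₂ - 2 * k κ₃) * m r c := by ring
  rw [e, abs_mul]
  exact mul_le_mul_of_nonneg_left (hm h) (abs_nonneg _)

/-- Every monomial of `covPoly` contains a factor that is controlled by the weight. -/
lemma smallDiff_covPoly : SmallDiff fun κ r c => covPoly r fun s t => c s t * κ s t := by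
  have h0 := smallDiff_mul (k := fun κ => 72 * (κ 2 0 * κ 0 2 * κ 1 1 ^ 2))
    (m := fun r c => c 2 0 * (c 0 2 * c 1 1 ^ 2))
    (by fun_prop) fun h => h.mul_mul h.c20 h.c02 h.b11
  have h1 := smallDiff_mul (k := fun κ => 24 * κ 1 1 ^ 4)
    (m := fun r c => c 1 1 * (c 1 1 * c 1 1 ^ 2))
    (by fun_prop) fun h => h.mul_mul h.c11 h.c11 h.b11
  have h2 := smallDiff_mul (k := fun κ => 48 * (κ 3 1 * κ 1 1 * κ 0 2))
    (m := fun r c => c 0 2 * (1 * (c 1 1 * c 3 1)))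
    (by fun_prop) fun h => h.mul_mul h.c02 h.one h.b1131
  have h3 := smallDiff_mul (k := fun κ => 48 * (κ 1 3 * κ 1 1 * κ 2 0))
    (m := fun r c => c 2 0 * (1 * (c 1 1 * c 1 3)))
    (by fun_prop) fun h => h.mul_mul h.c20 h.one h.b1113
  have h4 := smallDiff_mul (k := fun κ => 36 * (κ 2 2 * κ 2 0 * κ 0 2))
    (m := fun r c => c 2 0 * (c 0 2 * c 2 2))
    (by fun_prop) fun h => h.mul_mul h.c20 h.c02 h.b22
  have h5 := smallDiff_mul (k := fun κ => 72 * (κ 2 2 * κ 1 1 ^ 2))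
    (m := fun r c => c 1 1 * (c 1 1 * c 2 2))
    (by fun_prop) fun h => h.mul_mul h.c11 h.c11 h.b22
  have h6 := smallDiff_mul (k := fun κ => 16 * (κ 3 1 * κ 1 3))
    (m := fun r c => 1 * (1 * (c 3 1 * c 1 3)))
    (by fun_prop) fun h => h.mul_mul h.one h.one h.b3113
  have h7 := smallDiff_mul (k := fun κ => 18 * κ 2 2 ^ 2)
    (m := fun r c => 1 * (c 2 2 * c 2 2))
    (by fun_prop) fun h => h.mul_mul h.one h.c22 h.b22
  have h8 := smallDiff_mul (k := fun κ => 6 * (κ 4 2 * κ 0 2))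
    (m := fun r c => 1 * (c 0 2 * c 4 2))
    (by fun_prop) fun h => h.mul_mul h.one h.c02 h.b42
  have h9 := smallDiff_mul (k := fun κ => 6 * (κ 2 4 * κ 2 0))
    (m := fun r c => 1 * (c 2 0 * c 2 4))
    (by fun_prop) fun h => h.mul_mul h.one h.c20 h.b24
  have h10 := smallDiff_mul (k := fun κ => 16 * (κ 3 3 * κ 1 1))
    (m := fun r c => 1 * (c 1 1 * c 3 3))
    (by fun_prop) fun h => h.mul_mul h.one h.c11 h.b33
  have h11 := smallDiff_mul (k := fun κ => κ 4 4)
    (m := fun r c => 1 * (1 * c 4 4))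
    (by fun_prop) fun h => h.mul_mul h.one h.one h.b44
  have h12 := smallDiff_mul (k := fun κ => -12 * (κ 2 0 * κ 1 1 ^ 2))
    (m := fun r c => r * (c 2 0 * c 1 1 ^ 2))
    (by fun_prop) fun h => h.mul_mul h.r h.c20 h.b11
  have h13 := smallDiff_mul (k := fun κ => -8 * (κ 1 1 * κ 3 1))
    (m := fun r c => r * (1 * (c 1 1 * c 3 1)))
    (by fun_prop) fun h => h.mul_mul h.r h.one h.b1131
  have h14 := smallDiff_mul (k := fun κ => -6 * (κ 2 0 * κ 2 2))
    (m := fun r c => r * (c 2 0 * c 2 2))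
    (by fun_prop) fun h => h.mul_mul h.r h.c20 h.b22
  have h15 := smallDiff_mul (k := fun κ => -κ 4 2)
    (m := fun r c => r * (1 * c 4 2))
    (by fun_prop) fun h => h.mul_mul h.r h.one h.b42
  have h16 := smallDiff_mul (k := fun κ => -12 * (κ 0 2 * κ 1 1 ^ 2))
    (m := fun r c => r * (c 0 2 * c 1 1 ^ 2))
    (by fun_prop) fun h => h.mul_mul h.r h.c02 h.b11
  have h17 := smallDiff_mul (k := fun κ => -8 * (κ 1 1 * κ 1 3))
    (m := fun r c => r * (1 * (c 1 1 * c 1 3)))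
    (by fun_prop) fun h => h.mul_mul h.r h.one h.b1113
  have h18 := smallDiff_mul (k := fun κ => -6 * (κ 0 2 * κ 2 2))
    (m := fun r c => r * (c 0 2 * c 2 2))
    (by fun_prop) fun h => h.mul_mul h.r h.c02 h.b22
  have h19 := smallDiff_mul (k := fun κ => -κ 2 4)
    (m := fun r c => r * (1 * c 2 4))
    (by fun_prop) fun h => h.mul_mul h.r h.one h.b24
  have h20 := smallDiff_mul (k := fun κ => 2 * κ 1 1 ^ 2)
    (m := fun r c => r * (r * c 1 1 ^ 2))
    (by fun_prop) fun h => h.mul_mul h.r h.r h.b11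
  have h21 := smallDiff_mul (k := fun κ => κ 2 2)
    (m := fun r c => r * (r * c 2 2))
    (by fun_prop) fun h => h.mul_mul h.r h.r h.b22
  have ha := ((((((h0.add h1).add h2).add h3).add h4).add h5).add h6).add h7
  have hb := ((((((ha.add h8).add h9).add h10).add h11).add h12).add h13).add h14
  have h := ((((((hb.add h15).add h16).add h17).add h18).add h19).add h20).add h21
  convert h using 4 with κ r c
  simp only [covPoly, covMoment, jointMoment]
  ring

section Rows

variable {n : ℕ} {A : Matrix (Fin n) (Fin n) ℝ} {C : ℝ}

lemma sum_sq_cross_pow_le (hA : OpBound A C) (hC : 1 ≤ C) (j : Fin n) {m : ℕ} (hm : 1 ≤ m) :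
    ∑ i, (∑ k, A i k * A j k ^ m) ^ 2 ≤ C ^ (2 * m) := by
  refine (hA.1 fun k => A j k ^ m).trans ?_
  have h1 : ∀ k, (A j k ^ m) ^ 2 ≤ C ^ (2 * m - 2) * A j k ^ 2 := fun k => by
    rw [← pow_mul, mul_comm m 2, ← (even_two_mul m).pow_abs]
    exact hA.abs_pow_le hC j k (by omega)
  calc C * ∑ k, (A j k ^ m) ^ 2 ≤ C * ∑ k, C ^ (2 * m - 2) * A j k ^ 2 := by gcongr; exact h1 _
    _ = C * (C ^ (2 * m - 2) * ∑ k, A j k ^ 2) := by rw [← Finset.mul_sum]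
    _ ≤ C * (C ^ (2 * m - 2) * C) := by gcongr; exact hA.row_le j
    _ = C ^ (2 * m) := by
        rw [← pow_succ, ← pow_succ']; congr 1; omega

lemma sum_cross_sq_sq_le (hA : OpBound A C) (hC : 1 ≤ C) (j : Fin n) :
    ∑ i, ∑ k, A i k ^ 2 * A j k ^ 2 ≤ C ^ 2 := by
  rw [Finset.sum_comm]
  calc ∑ k, ∑ i, A i k ^ 2 * A j k ^ 2 = ∑ k, (∑ i, A i k ^ 2) * A j k ^ 2 := by
        simp only [Finset.sum_mul]
    _ ≤ ∑ k, C * A j k ^ 2 := by gcongr; exact hA.col_le _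
    _ = C * ∑ k, A j k ^ 2 := by rw [Finset.mul_sum]
    _ ≤ C * C := by gcongr; exact hA.row_le j
    _ = C ^ 2 := by ring

/-- The weight in `PowSumBound` is summable over pairs of rows. -/
lemma sum_weight_le (hA : OpBound A C) (hC : 1 ≤ C) :
    ∑ i, ∑ j, ((∑ k, A i k ^ 1 * A j k ^ 1) ^ 2 + (∑ k, A i k ^ 3 * A j k ^ 1) ^ 2
      + (∑ k, A i k ^ 1 * A j k ^ 3) ^ 2 + ∑ k, A i k ^ 2 * A j k ^ 2) ≤ 4 * C ^ 6 * n := by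
  simp only [Finset.sum_add_distrib, pow_one]
  have p2 : C ^ 2 ≤ C ^ 6 := pow_le_pow_right₀ hC (by norm_num)
  have hs : ∑ _j : Fin n, C ^ 6 = C ^ 6 * n := by simp [mul_comm]
  have e1 : ∑ i, ∑ j, (∑ k, A i k * A j k) ^ 2 ≤ C ^ 6 * n := by
    rw [Finset.sum_comm, ← hs]
    exact Finset.sum_le_sum fun j _ => (by
      simpa using sum_sq_cross_pow_le hA hC j (m := 1) le_rfl :
        ∑ i, (∑ k, A i k * A j k) ^ 2 ≤ C ^ 2).trans p2
  have e2 : ∑ i, ∑ j, (∑ k, A i k * A j k ^ 3) ^ 2 ≤ C ^ 6 * n := by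
    rw [Finset.sum_comm, ← hs]
    exact Finset.sum_le_sum fun j _ => sum_sq_cross_pow_le hA hC j (m := 3) (by norm_num)
  have e3 : ∑ i, ∑ j, (∑ k, A i k ^ 3 * A j k) ^ 2 ≤ C ^ 6 * n := by
    rw [← hs]
    refine Finset.sum_le_sum fun i _ => ?_
    simpa only [mul_comm] using sum_sq_cross_pow_le hA hC i (m := 3) (by norm_num)
  have e4 : ∑ i, ∑ j, ∑ k, A i k ^ 2 * A j k ^ 2 ≤ C ^ 6 * n := by
    rw [Finset.sum_comm, ← hs]
    exact Finset.sum_le_sum fun j _ => (sum_cross_sq_sq_le hA hC j).trans p2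
  linarith

lemma powSumBound_rows (hA : OpBound A C) (hC : 1 ≤ C) {r ρ : ℝ} (hr : |r| ≤ ρ) (i j : Fin n) :
    PowSumBound (C ^ 4 + ρ) ((∑ k, A i k ^ 1 * A j k ^ 1) ^ 2 + (∑ k, A i k ^ 3 * A j k ^ 1) ^ 2
      + (∑ k, A i k ^ 1 * A j k ^ 3) ^ 2 + ∑ k, A i k ^ 2 * A j k ^ 2) r
      (fun s t => ∑ k, A i k ^ s * A j k ^ t) := by
  have hρ : 0 ≤ ρ := (abs_nonneg r).trans hr
  have hC0 : 0 ≤ C := by linarith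
  have h4 : 1 ≤ C ^ 4 := one_le_pow₀ hC
  have h14 : C ≤ C ^ 4 := le_self_pow₀ hC (by norm_num)
  have h24 : C ^ 2 ≤ C ^ 4 := pow_le_pow_right₀ hC (by norm_num)
  have hcc : ∀ {a b : ℕ}, 2 ≤ a → 2 ≤ b → (a - 2) + (b - 2) ≤ 4 →
      |∑ k, A i k ^ a * A j k ^ b| ≤ (C ^ 4 + ρ) * ∑ k, A i k ^ 2 * A j k ^ 2 := by
    intro a b ha hb hab
    rw [Finset.mul_sum]
    refine (Finset.abs_sum_le_sum_abs _ _).trans (Finset.sum_le_sum fun k _ => ?_)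
    rw [abs_mul, abs_pow, abs_pow]
    calc |A i k| ^ a * |A j k| ^ b
        ≤ (C ^ (a - 2) * A i k ^ 2) * (C ^ (b - 2) * A j k ^ 2) := by
          gcongr
          · exact hA.abs_pow_le hC i k ha
          · exact hA.abs_pow_le hC j k hb
      _ = C ^ ((a - 2) + (b - 2)) * (A i k ^ 2 * A j k ^ 2) := by rw [pow_add]; ring
      _ ≤ (C ^ 4 + ρ) * (A i k ^ 2 * A j k ^ 2) := by
          refine mul_le_mul_of_nonneg_right ?_ (by positivity)
          exact (pow_le_pow_right₀ hC hab).trans (by linarith)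
  have h22 : 0 ≤ ∑ k, A i k ^ 2 * A j k ^ 2 := Finset.sum_nonneg fun k _ => by positivity
  refine ⟨by linarith, rfl, h22, by linarith, ?_, ?_, ?_, ?_,
    hcc (by norm_num) (by norm_num) (by norm_num), hcc (by norm_num) (by norm_num) (by norm_num),
    hcc (by norm_num) (by norm_num) (by norm_num), hcc (by norm_num) (by norm_num) (by norm_num)⟩
  · simp only [pow_zero, mul_one]
    rw [abs_of_nonneg (Finset.sum_nonneg fun _ _ => sq_nonneg _)]
    linarith [hA.row_le i]
  · simp only [pow_zero, one_mul]
    rw [abs_of_nonneg (Finset.sum_nonneg fun _ _ => sq_nonneg _)]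
    linarith [hA.row_le j]
  · simp only [pow_one]
    have h := (Finset.single_le_sum (f := fun i => (∑ k, A i k * A j k ^ 1) ^ 2)
      (fun _ _ => sq_nonneg _) (Finset.mem_univ i)).trans
      (sum_sq_cross_pow_le hA hC j (m := 1) le_rfl)
    simp only [pow_one, mul_one] at h
    have := abs_le_of_sq_le_sq h hC0
    linarith
  · rw [abs_of_nonneg h22]
    have h := (Finset.single_le_sum (f := fun i => ∑ k, A i k ^ 2 * A j k ^ 2)
      (fun _ _ => Finset.sum_nonneg fun k _ => by positivity) (Finset.mem_univ i)).trans
      (sum_cross_sq_sq_le hA hC j)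
    linarith

end Rows

/-- The truncation of a real number to the interval `[-τ, τ]`. -/
def clamp (τ x : ℝ) : ℝ := max (-τ) (min τ x)

lemma continuous_clamp (τ : ℝ) : Continuous (clamp τ) := by
  unfold clamp; fun_prop

lemma clamp_neg {τ : ℝ} (hτ : 0 ≤ τ) (x : ℝ) : clamp τ (-x) = -clamp τ x := by
  unfold clamp
  simp only [max_def, min_def]
  split_ifs <;> linarith

lemma abs_clamp_le {τ : ℝ} (hτ : 0 ≤ τ) (x : ℝ) : |clamp τ x| ≤ τ := by
  unfold clamp
  rw [abs_le]
  exact ⟨le_max_left _ _, max_le (by linarith) (min_le_left _ _)⟩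

lemma abs_clamp_le_abs {τ : ℝ} (hτ : 0 ≤ τ) (x : ℝ) : |clamp τ x| ≤ |x| := by
  unfold clamp
  rw [abs_le]
  refine ⟨le_max_of_le_right (le_min ?_ (neg_abs_le x)), max_le ?_ ?_⟩
  · linarith [abs_nonneg x]
  · linarith [abs_nonneg x]
  · exact (min_le_right _ _).trans (le_abs_self x)

lemma clamp_eq_self {τ x : ℝ} (h : |x| ≤ τ) : clamp τ x = x := by
  obtain ⟨h1, h2⟩ := abs_le.1 h
  unfold clamp
  rw [min_eq_right h2, max_eq_right h1]

lemma continuous_jointCumulant : Continuous jointCumulant := by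
  refine continuous_pi fun s => continuous_pi fun t => ?_
  unfold jointCumulant
  split <;> fun_prop

section Truncation

variable {μ : Measure ℝ} [IsProbabilityMeasure μ] {C ρ : ℝ}

lemma oddTransform_id (h8 : Integrable (fun x => |x| ^ 8) μ) : OddTransform μ fun x => x :=
  ⟨measurable_id, fun _ => rfl, by simpa only [Even.pow_abs (show Even 8 by decide)] using h8⟩

lemma oddTransform_clamp (h8 : Integrable (fun x => |x| ^ 8) μ) {τ : ℝ} (hτ : 0 ≤ τ) :
    OddTransform μ (clamp τ) := by
  have hm := (continuous_clamp τ).measurable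
  refine ⟨hm, clamp_neg hτ, Integrable.mono' h8 (by fun_prop : Measurable _).aestronglyMeasurable
    (ae_of_all _ fun x => ?_)⟩
  rw [norm_pow, Real.norm_eq_abs]
  exact pow_le_pow_left₀ (abs_nonneg _) (abs_clamp_le_abs hτ x) 8

/-- Joint cumulants of truncated variables converge when the truncation is removed. -/
lemma tendsto_pairCumulant (h8 : Integrable (fun x => |x| ^ 8) μ) {f f' : ℕ → ℝ → ℝ}
    (hm : ∀ N, Measurable (f N)) (hm' : ∀ N, Measurable (f' N))
    (hf : ∀ N x, |f N x| ≤ |x|) (hf' : ∀ N x, |f' N x| ≤ |x|)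
    (hl : ∀ x, ∀ᶠ N in atTop, f N x = x) (hl' : ∀ x, ∀ᶠ N in atTop, f' N x = x) :
    Tendsto (fun N => pairCumulant μ (f N) (f' N)) atTop
      (𝓝 (pairCumulant μ (fun x => x) fun x => x)) := by
  refine (continuous_jointCumulant.tendsto _).comp
    (tendsto_pi_nhds.2 fun p => tendsto_pi_nhds.2 fun q => ?_)
  unfold pairMoment
  split_ifs with hpq
  · have h8' : Integrable (fun x => x ^ 8) μ := by
      simpa only [Even.pow_abs (show Even 8 by decide)] using h8
    refine tendsto_integral_of_dominated_convergence (fun x => 2 + x ^ 8 + x ^ 8)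
      (fun N => (by have := hm N; have := hm' N; fun_prop : Measurable _).aestronglyMeasurable)
      (((integrable_const 2).add h8').add h8') (fun N => ae_of_all _ fun x => ?_)
      (ae_of_all _ fun x => ?_)
    · rw [Real.norm_eq_abs]
      have e8 : Even 8 := by decide
      have h1 : f N x ^ 8 ≤ x ^ 8 := by
        rw [← e8.pow_abs, ← e8.pow_abs x]; exact pow_le_pow_left₀ (abs_nonneg _) (hf N x) 8
      have h2 : f' N x ^ 8 ≤ x ^ 8 := by
        rw [← e8.pow_abs, ← e8.pow_abs x]; exact pow_le_pow_left₀ (abs_nonneg _) (hf' N x) 8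
      have h3 := abs_pow_mul_pow_le (f N x) (f' N x) hpq.1 hpq.2
      linarith
    · refine tendsto_const_nhds.congr' ?_
      filter_upwards [hl x, hl' x] with N h1 h2
      rw [h1, h2]
  · exact tendsto_const_nhds

/-- Truncation at a high level changes `quartic` by little, uniformly over the matrices of bounded
operator norm. -/
theorem exists_variance_sub_clamp_le (hsymm : μ.map (fun x => -x) = μ)
    (h8 : Integrable (fun x => |x| ^ 8) μ) (hC : 1 ≤ C) (hρ : 0 ≤ ρ) {ε : ℝ} (hε : 0 < ε) :
    ∃ τ : ℝ, 1 ≤ τ ∧ ∀ {n : ℕ} {A : Matrix (Fin n) (Fin n) ℝ} {r : ℝ}, OpBound A C → |r| ≤ ρ →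
      Var[fun ω : Fin n → ℝ => quartic A r (fun k => ω k) - quartic A r fun k => clamp τ (ω k);
        Measure.pi fun _ => μ] ≤ ε * n := by
  obtain ⟨δ, hδc, hδ0, hδ⟩ := smallDiff_covPoly
  set D := C ^ 4 + ρ with hD
  set κ := pairCumulant μ (fun x => x) fun x => x with hκ
  have hclN : ∀ x, ∀ᶠ N : ℕ in atTop, clamp N x = x := fun x => by
    filter_upwards [eventually_ge_atTop ⌈|x|⌉₊] with N hN
    exact clamp_eq_self ((Nat.le_ceil _).trans (by exact_mod_cast hN))
  have t1 : Tendsto (fun N : ℕ => pairCumulant μ (clamp N) (clamp N)) atTop (𝓝 κ) :=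
    tendsto_pairCumulant h8 (fun N => (continuous_clamp N).measurable)
      (fun N => (continuous_clamp N).measurable) (fun N => abs_clamp_le_abs N.cast_nonneg)
      (fun N => abs_clamp_le_abs N.cast_nonneg) hclN hclN
  have t2 : Tendsto (fun N : ℕ => pairCumulant μ (fun x => x) (clamp N)) atTop (𝓝 κ) :=
    tendsto_pairCumulant h8 (f := fun _ x => x) (fun N => measurable_id)
      (fun N => (continuous_clamp N).measurable) (fun N x => le_rfl)
      (fun N => abs_clamp_le_abs N.cast_nonneg) (fun x => .of_forall fun _ => rfl) hclN
  have t3 : Tendsto (fun N : ℕ => δ κ (pairCumulant μ (clamp N) (clamp N))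
      (pairCumulant μ (fun x => x) (clamp N)) * (D ^ 3 * (4 * C ^ 6))) atTop (𝓝 0) := by
    have := (hδc.tendsto (κ, κ, κ)).comp (tendsto_const_nhds.prodMk_nhds (t1.prodMk_nhds t2))
    have h := this.mul_const (D ^ 3 * (4 * C ^ 6))
    simpa [hδ0, Function.comp_def] using h
  obtain ⟨N, hN, hN1⟩ := ((t3.eventually (gt_mem_nhds hε)).and (eventually_ge_atTop 1)).exists
  refine ⟨N, by exact_mod_cast hN1, ?_⟩
  intro n A r hA hr
  have hid := oddTransform_id h8
  have hcl := oddTransform_clamp h8 (τ := N) N.cast_nonneg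
  have m1 := memLp_quartic (n := n) hsymm hid A r
  have m2 := memLp_quartic (n := n) hsymm hcl A r
  have e0 := covariance_self (m1.sub m2).aestronglyMeasurable.aemeasurable
  simp only [Pi.sub_def] at e0
  rw [← e0]
  have e := covariance_fun_sub_fun_sub m1 m2 m1 m2
  rw [covariance_comm (fun ω : Fin n → ℝ => quartic A r fun k => clamp N (ω k))
    (fun ω : Fin n → ℝ => quartic A r fun k => ω k), covariance_quartic hsymm hid hid,
    covariance_quartic hsymm hid hcl, covariance_quartic hsymm hcl hcl] at e
  refine (le_of_eq e).trans ?_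
  have hD0 : 0 ≤ D ^ 3 * (4 * C ^ 6) := by positivity
  set κ₂ := pairCumulant μ (clamp N) (clamp N)
  set κ₃ := pairCumulant μ (fun x => x) (clamp N)
  have hw := sum_weight_le hA hC
  set w : Fin n → Fin n → ℝ := fun i j => (∑ k, A i k ^ 1 * A j k ^ 1) ^ 2
    + (∑ k, A i k ^ 3 * A j k ^ 1) ^ 2 + (∑ k, A i k ^ 1 * A j k ^ 3) ^ 2
    + ∑ k, A i k ^ 2 * A j k ^ 2
  have hpair : ∀ i j, covPoly r (linCum (A i) (A j) κ) + covPoly r (linCum (A i) (A j) κ₂)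
      - 2 * covPoly r (linCum (A i) (A j) κ₃) ≤ δ κ κ₂ κ₃ * (D ^ 3 * w i j) := fun i j =>
    (le_abs_self _).trans (hδ κ κ₂ κ₃ D _ r _ (powSumBound_rows hA hC hr i j))
  -- the bound for the one-dimensional identity matrix shows that this factor is nonnegative
  have hδn : 0 ≤ δ κ κ₂ κ₃ := by
    have h1 := powSumBound_rows (r := 0) (ρ := ρ)
      (A := (1 : Matrix (Fin 1) (Fin 1) ℝ)) (C := C) ⟨fun v => by
        simpa using le_mul_of_one_le_left (sq_nonneg _) hC, fun v => by
        simpa using le_mul_of_one_le_left (sq_nonneg _) hC⟩ hC (by simpa using hρ) 0 0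
    have h2 := (abs_nonneg _).trans (hδ κ κ₂ κ₃ D _ 0 _ h1)
    have h3 : 0 < D := by positivity
    simp at h2
    exact nonneg_of_mul_nonneg_left h2 (by positivity)
  calc _ = ∑ i, ∑ j, (covPoly r (linCum (A i) (A j) κ) + covPoly r (linCum (A i) (A j) κ₂)
      - 2 * covPoly r (linCum (A i) (A j) κ₃)) := by
        simp only [Finset.sum_add_distrib, Finset.sum_sub_distrib, ← Finset.mul_sum]
        ring
    _ ≤ ∑ i, ∑ j, δ κ κ₂ κ₃ * (D ^ 3 * w i j) :=
        Finset.sum_le_sum fun i _ => Finset.sum_le_sum fun j _ => hpair i j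
    _ = δ κ κ₂ κ₃ * (D ^ 3 * ∑ i, ∑ j, w i j) := by simp only [Finset.mul_sum]
    _ ≤ δ κ κ₂ κ₃ * (D ^ 3 * (4 * C ^ 6 * n)) := by
        have : 0 ≤ D := by positivity
        gcongr
    _ = δ κ κ₂ κ₃ * (D ^ 3 * (4 * C ^ 6)) * n := by ring
    _ ≤ ε * n := mul_le_mul_of_nonneg_right hN.le n.cast_nonneg

end Truncation

/-! ### Cumulants of a standardized symmetric law, and nondegeneracy -/

section StandardizedLaw

variable {μ : Measure ℝ} [IsProbabilityMeasure μ]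

lemma pairMoment_id {p q : ℕ} (hp : p ≤ 4) (hq : q ≤ 4) :
    pairMoment μ (fun x => x) (fun x => x) p q = lawMoment μ (p + q) := by
  rw [pairMoment, if_pos ⟨hp, hq⟩, lawMoment]
  simp only [pow_add]

/-- The cumulants that depend only on the total order, as for a pair of equal standardized
variables. -/
structure StandardCumulants (μ : Measure ℝ) (κ : ℕ → ℕ → ℝ) : Prop where
  k20 : κ 2 0 = 1
  k11 : κ 1 1 = 1
  k02 : κ 0 2 = 1
  k40 : κ 4 0 = nu4 μ
  k31 : κ 3 1 = nu4 μ
  k22 : κ 2 2 = nu4 μ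
  k13 : κ 1 3 = nu4 μ
  k04 : κ 0 4 = nu4 μ
  k42 : κ 4 2 = nu6 μ
  k33 : κ 3 3 = nu6 μ
  k24 : κ 2 4 = nu6 μ
  k44 : κ 4 4 = nu8 μ

lemma standardCumulants (hvar : ∫ x, x ^ 2 ∂μ = 1) :
    StandardCumulants μ (pairCumulant μ (fun x => x) fun x => x) := by
  have h2 : lawMoment μ 2 = 1 := hvar
  constructor <;> simp only [pairCumulant, jointCumulant] <;>
    simp only [pairMoment_id (μ := μ) (show 0 ≤ 4 by norm_num) (show 2 ≤ 4 by norm_num),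
      pairMoment_id (μ := μ) (show 0 ≤ 4 by norm_num) (show 4 ≤ 4 by norm_num),
      pairMoment_id (μ := μ) (show 1 ≤ 4 by norm_num) (show 1 ≤ 4 by norm_num),
      pairMoment_id (μ := μ) (show 1 ≤ 4 by norm_num) (show 3 ≤ 4 by norm_num),
      pairMoment_id (μ := μ) (show 3 ≤ 4 by norm_num) (show 1 ≤ 4 by norm_num),
      pairMoment_id (μ := μ) (show 3 ≤ 4 by norm_num) (show 3 ≤ 4 by norm_num),
      pairMoment_id (μ := μ) (show 2 ≤ 4 by norm_num) (show 0 ≤ 4 by norm_num),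
      pairMoment_id (μ := μ) (show 2 ≤ 4 by norm_num) (show 2 ≤ 4 by norm_num),
      pairMoment_id (μ := μ) (show 2 ≤ 4 by norm_num) (show 4 ≤ 4 by norm_num),
      pairMoment_id (μ := μ) (show 4 ≤ 4 by norm_num) (show 0 ≤ 4 by norm_num),
      pairMoment_id (μ := μ) (show 4 ≤ 4 by norm_num) (show 2 ≤ 4 by norm_num),
      pairMoment_id (μ := μ) (show 4 ≤ 4 by norm_num) (show 4 ≤ 4 by norm_num),
      Nat.reduceAdd, h2, nu4, nu6, nu8] <;> ring

lemma memLp_pow (h8 : Integrable (fun x => |x| ^ 8) μ) {p : ℕ} (hp : p ≤ 4) :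
    MemLp (fun x : ℝ => x ^ p) 2 μ := by
  refine (memLp_two_iff_integrable_sq (by fun_prop : Measurable _).aestronglyMeasurable).2 ?_
  refine Integrable.mono' ((integrable_const 1).add h8)
    (by fun_prop : Measurable _).aestronglyMeasurable (ae_of_all _ fun x => ?_)
  rw [Real.norm_of_nonneg (sq_nonneg _), ← pow_mul]
  have := pow_le_one_add_pow (x := x) (a := p * 2) (b := 8) (by omega) (by simp) (by decide)
  rwa [← Even.pow_abs (show Even 8 by decide)] at this

lemma covariance_pow_pow (h8 : Integrable (fun x => |x| ^ 8) μ) {p q : ℕ} (hp : p ≤ 4)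
    (hq : q ≤ 4) : cov[fun x : ℝ => x ^ p, fun x : ℝ => x ^ q; μ]
      = lawMoment μ (p + q) - lawMoment μ p * lawMoment μ q := by
  rw [covariance_eq_sub (memLp_pow h8 hp) (memLp_pow h8 hq)]
  simp only [lawMoment, pow_add, Pi.mul_apply]

lemma ae_eq_of_variance_eq_zero {X : ℝ → ℝ} (hX : MemLp X 2 μ) (h : Var[X; μ] = 0) :
    ∃ c, ∀ᵐ x ∂μ, X x = c := by
  refine ⟨_, (evariance_eq_zero_iff hX.aestronglyMeasurable.aemeasurable).1 ?_⟩
  rw [← hX.ofReal_variance_eq, h, ENNReal.ofReal_zero]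

/-- The residual of `x ^ 4` after regression on `1` and `x ^ 2` is not degenerate if `|x|` takes at
least three values. -/
lemma exists_regression (h8 : Integrable (fun x => |x| ^ 8) μ) (hvar : ∫ x, x ^ 2 ∂μ = 1)
    (hnd : ∀ u v : ℝ, ¬ ∀ᵐ x ∂μ, |x| = u ∨ |x| = v) :
    ∃ α : ℝ, α * (lawMoment μ 4 - 1) = lawMoment μ 6 - lawMoment μ 4 ∧
      0 < Var[fun x : ℝ => x ^ 4 - α * x ^ 2; μ] := by
  have h2 : lawMoment μ 2 = 1 := hvar
  have hv2 : Var[fun x : ℝ => x ^ 2; μ] = lawMoment μ 4 - 1 := by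
    rw [← covariance_self (memLp_pow h8 (p := 2) (by norm_num)).aestronglyMeasurable.aemeasurable,
      covariance_pow_pow h8 (by norm_num) (by norm_num), h2]
    norm_num
  have h4 : lawMoment μ 4 - 1 ≠ 0 := by
    rw [← hv2]
    intro h0
    obtain ⟨c, hc⟩ := ae_eq_of_variance_eq_zero (memLp_pow h8 (p := 2) (by norm_num)) h0
    refine hnd (√c) (√c) ?_
    filter_upwards [hc] with x hx
    left
    rw [← hx, Real.sqrt_sq_eq_abs]
  refine ⟨_, div_mul_cancel₀ _ h4, (variance_nonneg _ _).lt_of_ne' fun h0 => ?_⟩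
  set α := (lawMoment μ 6 - lawMoment μ 4) / (lawMoment μ 4 - 1)
  obtain ⟨c, hc⟩ := ae_eq_of_variance_eq_zero ((memLp_pow h8 (p := 4) (by norm_num)).sub
    ((memLp_pow h8 (p := 2) (by norm_num)).const_mul α)) h0
  refine hnd (√(α / 2 + √(c + α ^ 2 / 4))) (√(α / 2 - √(c + α ^ 2 / 4))) ?_
  filter_upwards [hc] with x hx
  have hx' : (x ^ 2 - α / 2) ^ 2 = c + α ^ 2 / 4 := by
    simp only [Pi.sub_apply] at hx
    rw [← hx]; ring
  rw [← hx', Real.sqrt_sq_eq_abs]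
  rcases abs_choice (x ^ 2 - α / 2) with h | h
  · left; rw [h, ← Real.sqrt_sq_eq_abs]; congr 1; ring
  · right; rw [h, ← Real.sqrt_sq_eq_abs]; congr 1; ring

/-- A lower bound for the variance of `quartic`: its projection to the span of the variables
`ψ (ω k)`, with `ψ` the residual of `x ^ 4` after regression on `1` and `x ^ 2`. -/
theorem exists_le_variance_quartic (hsymm : μ.map (fun x => -x) = μ)
    (h8 : Integrable (fun x => |x| ^ 8) μ) (hvar : ∫ x, x ^ 2 ∂μ = 1)
    (hnd : ∀ u v : ℝ, ¬ ∀ᵐ x ∂μ, |x| = u ∨ |x| = v) :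
    ∃ q : ℝ, 0 < q ∧ ∀ {n : ℕ} (A : Matrix (Fin n) (Fin n) ℝ) (r : ℝ),
      q * ∑ k, (∑ i, A i k ^ 4) ^ 2 ≤ Var[quartic A r; Measure.pi fun _ => μ] := by
  obtain ⟨α, hα, hpos⟩ := exists_regression h8 hvar hnd
  refine ⟨_, hpos, ?_⟩
  intro n A r
  have h2 : lawMoment μ 2 = 1 := hvar
  have hid := oddTransform_id h8
  have mW := memLp_quartic (n := n) hsymm hid A r
  have m4 := memLp_pow h8 (p := 4) le_rfl
  have m2 := (memLp_pow h8 (p := 2) (by norm_num)).const_mul α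
  have mψ : MemLp (fun x : ℝ => x ^ 4 - α * x ^ 2) 2 μ := m4.sub m2
  have hvψ : Var[fun x : ℝ => x ^ 4 - α * x ^ 2; μ] = lawMoment μ 8 - lawMoment μ 4 ^ 2
      - α * (lawMoment μ 6 - lawMoment μ 4) := by
    rw [← covariance_self mψ.aestronglyMeasurable.aemeasurable,
      covariance_fun_sub_fun_sub m4 m2 m4 m2, covariance_const_mul_left, covariance_const_mul_left,
      covariance_const_mul_right, covariance_const_mul_right,
      covariance_pow_pow h8 le_rfl le_rfl, covariance_pow_pow h8 le_rfl (by norm_num),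
      covariance_pow_pow h8 (by norm_num) le_rfl, covariance_pow_pow h8 (by norm_num) (by norm_num),
      h2]
    norm_num
    linear_combination α * hα
  set d : Fin n → ℝ := fun k => ∑ i, A i k ^ 4 with hd
  have me : ∀ k : Fin n, MeasurePreserving (fun ω : Fin n → ℝ => ω k) (Measure.pi fun _ => μ) μ :=
    fun k => measurePreserving_eval (fun _ => μ) k
  have m4k := fun k => m4.comp_measurePreserving (me k)
  have m2k := fun k => m2.comp_measurePreserving (me k)
  have mψk := fun k => mψ.comp_measurePreserving (me k)
  simp only [Function.comp_def] at m4k m2k mψk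
  have mY : MemLp (fun ω : Fin n → ℝ => ∑ k, d k * (ω k ^ 4 - α * ω k ^ 2)) 2
      (Measure.pi fun _ => μ) := memLp_finsetSum _ fun k _ => (mψk k).const_mul _
  -- by the choice of `α`, only the fourth power of the entry `A i k` remains
  have hcov1 : ∀ i k, cov[fun ω : Fin n → ℝ => (A *ᵥ ω) i ^ 4 - r * (A *ᵥ ω) i ^ 2,
      fun ω => ω k ^ 4 - α * ω k ^ 2; Measure.pi fun _ => μ]
      = A i k ^ 4 * Var[fun x : ℝ => x ^ 4 - α * x ^ 2; μ] := by
    intro i k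
    have hc := hasCumulants_sum hsymm hid hid (A i) (Pi.single k 1)
    have a4 := hc.memLp_fst_pow (p := 4) le_rfl
    have a2 := (hc.memLp_fst_pow (p := 2) (by norm_num)).const_mul r
    have c44 := hc.covariance_pow (p := 4) (q := 4) le_rfl le_rfl
    have c42 := hc.covariance_pow (p := 4) (q := 2) le_rfl (by norm_num)
    have c24 := hc.covariance_pow (p := 2) (q := 4) (by norm_num) le_rfl
    have c22 := hc.covariance_pow (p := 2) (q := 2) (by norm_num) (by norm_num)
    obtain ⟨k20, k11, k02, k40, k31, k22, k13, k04, k42, k33, k24, k44⟩ :=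
      standardCumulants hvar
    have hs : ∀ s t, 1 ≤ t → ∑ l, A i l ^ s * (Pi.single k 1 : Fin n → ℝ) l ^ t = A i k ^ s := by
      intro s t ht
      rw [Finset.sum_eq_single k]
      · simp
      · intro l _ hl
        simp [Pi.single_eq_of_ne hl, show t ≠ 0 by omega]
      · simp
    have hsel : ∀ ω : Fin n → ℝ, ∑ l, (Pi.single k 1 : Fin n → ℝ) l * ω l = ω k := fun ω => by
      simp [Pi.single_apply]
    simp only [hsel, covMoment, jointMoment, linCum, k20, k11, k02, k40, k31, k22, k13, k04, k42,
      k33, k24, k44, hs _ 1 le_rfl, hs _ 2 one_le_two, hs _ 3 (by norm_num : 1 ≤ 3),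
      hs _ 4 (by norm_num : 1 ≤ 4), nu4, nu6, nu8] at c44 c42 c24 c22 a4 a2
    have e : ∀ ω : Fin n → ℝ, (A *ᵥ ω) i = ∑ l, A i l * ω l := fun _ => rfl
    simp only [e]
    rw [covariance_fun_sub_fun_sub a4 a2 (m4k k) (m2k k), covariance_const_mul_left,
      covariance_const_mul_left, covariance_const_mul_right, covariance_const_mul_right,
      c44, c42, c24, c22, hvψ]
    generalize ∑ l, A i l ^ 2 * (Pi.single k 1 : Fin n → ℝ) l ^ 0 = S
    generalize ∑ l, A i l ^ 4 * (Pi.single k 1 : Fin n → ℝ) l ^ 0 = S'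
    linear_combination (-6 * S * A i k ^ 2 + 6 * A i k ^ 4 + r * A i k ^ 2) * hα
  have hi : ∀ i, MemLp (fun ω : Fin n → ℝ => (A *ᵥ ω) i ^ 4 - r * (A *ᵥ ω) i ^ 2) 2
      (Measure.pi fun _ => μ) := fun i =>
    ((hasCumulants_mulVec hsymm hid hid A i i).memLp_fst_pow le_rfl).sub
      (((hasCumulants_mulVec hsymm hid hid A i i).memLp_fst_pow (p := 2) (by norm_num)).const_mul r)
  have hcov : cov[fun ω : Fin n → ℝ => quartic A r fun k => ω k,
      fun ω => ∑ k, d k * (ω k ^ 4 - α * ω k ^ 2); Measure.pi fun _ => μ]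
      = Var[fun x : ℝ => x ^ 4 - α * x ^ 2; μ] * ∑ k, d k ^ 2 := by
    unfold quartic
    rw [covariance_fun_sum_fun_sum hi fun k => (mψk k).const_mul _, Finset.sum_comm, Finset.mul_sum]
    refine Finset.sum_congr rfl fun k _ => ?_
    simp only [covariance_const_mul_right, hcov1]
    rw [← Finset.mul_sum, ← Finset.sum_mul, hd]
    ring
  have hvY : Var[fun ω : Fin n → ℝ => ∑ k, d k * (ω k ^ 4 - α * ω k ^ 2); Measure.pi fun _ => μ]
      = Var[fun x : ℝ => x ^ 4 - α * x ^ 2; μ] * ∑ k, d k ^ 2 := by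
    have h := variance_sum_pi (μ := fun _ : Fin n => μ)
      (X := fun k x => d k * (x ^ 4 - α * x ^ 2)) fun k => mψ.const_mul _
    simp only [variance_const_mul] at h
    rw [← Finset.sum_mul, mul_comm] at h
    rw [← h]
    congr 1
    ext ω
    simp [Finset.sum_apply]
  have e := covariance_fun_sub_fun_sub mW mY mW mY
  have e0 := covariance_self (mW.sub mY).aestronglyMeasurable.aemeasurable
  have e1 := variance_nonneg ((fun ω : Fin n → ℝ => quartic A r fun k => ω k)
    - fun ω => ∑ k, d k * (ω k ^ 4 - α * ω k ^ 2)) (Measure.pi fun _ => μ)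
  simp only [Pi.sub_def] at e0 e1
  rw [covariance_comm (fun ω : Fin n → ℝ => ∑ k, d k * (ω k ^ 4 - α * ω k ^ 2)) fun ω : Fin n → ℝ =>
    quartic A r fun k => ω k, covariance_self mW.aestronglyMeasurable.aemeasurable,
    covariance_self mY.aestronglyMeasurable.aemeasurable, hcov, hvY, e0] at e
  change _ ≤ Var[fun ω : Fin n → ℝ => quartic A r fun k => ω k; Measure.pi fun _ => μ]
  linarith

end StandardizedLaw

/-! ### The centering and variance constants as moments of power sums -/

section Traces

variable {n : ℕ} (A : Matrix (Fin n) (Fin n) ℝ)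

/-- The sum of products of `s`-th and `t`-th powers of the entries of the rows `i` and `j`. -/
def rowSum (s t : ℕ) (i j : Fin n) : ℝ := ∑ k, A i k ^ s * A j k ^ t

lemma rowSum_comm (s t : ℕ) (i j : Fin n) : rowSum A s t i j = rowSum A t s j i := by
  simp only [rowSum, mul_comm]

lemma mul_transpose_apply_eq_rowSum (i j : Fin n) : (A * Aᵀ) i j = rowSum A 1 1 i j := by
  simp [rowSum, Matrix.mul_apply]

lemma rowSum_two_zero (i j : Fin n) : rowSum A 2 0 i j = (A * Aᵀ) i i := by
  simp [rowSum, Matrix.mul_apply, sq]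

lemma rowSum_zero_two (i j : Fin n) : rowSum A 0 2 i j = (A * Aᵀ) j j := by
  simp [rowSum, Matrix.mul_apply, sq]

lemma hpow_mul_hpow_transpose_apply (s t : ℕ) (i j : Fin n) :
    (hpow A s * (hpow A t)ᵀ) i j = rowSum A s t i j := by
  simp [rowSum, Matrix.mul_apply, hpow]

lemma hadamard_self : A ⊙ A = hpow A 2 := by
  ext; simp [hpow, sq]

lemma hpow_one : hpow A 1 = A := by
  ext; simp [hpow]

lemma trace_hadamard_self : (A ⊙ A).trace = ∑ i, A i i ^ 2 := by
  simp [Matrix.trace, sq]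

variable {A}

/-- The trace of a product of three matrices, the last one transposed. -/
lemma trace_mul_mul_transpose (M R S : Matrix (Fin n) (Fin n) ℝ) :
    (M * R * Sᵀ).trace = ∑ i, ∑ j, M i j * (R * Sᵀ) j i := by
  rw [Matrix.mul_assoc]
  simp [Matrix.trace, Matrix.mul_apply]

lemma trace_sq (M : Matrix (Fin n) (Fin n) ℝ) : (M ^ 2).trace = ∑ i, ∑ j, M i j * M j i := by
  simp [Matrix.trace, Matrix.mul_apply, sq]

lemma dotProduct_mulVec_eq_sum (M : Matrix (Fin n) (Fin n) ℝ) (u v : Fin n → ℝ) :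
    u ⬝ᵥ (M *ᵥ v) = ∑ i, ∑ j, u i * M i j * v j := by
  simp [dotProduct, Matrix.mulVec, Finset.mul_sum, mul_assoc]

lemma transpose_mul_diagonal_mul_apply (d : Fin n → ℝ) (R : Matrix (Fin n) (Fin n) ℝ) (k : Fin n) :
    (Rᵀ * Matrix.diagonal d * R) k k = ∑ i, d i * R i k ^ 2 := by
  rw [Matrix.mul_apply]
  simp only [Matrix.mul_diagonal, Matrix.transpose_apply]
  exact Finset.sum_congr rfl fun i _ => by ring

lemma trace_hadamard_transpose_mul (d : Fin n → ℝ) (s : ℕ) :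
    ((Aᵀ * Matrix.diagonal d * A) ⊙ ((hpow A s)ᵀ * hpow A s)).trace
      = ∑ i, ∑ j, d i * rowSum A 2 (2 * s) i j := by
  simp only [Matrix.trace, Matrix.diag_apply, Matrix.hadamard_apply,
    transpose_mul_diagonal_mul_apply]
  simp only [Matrix.mul_apply, Matrix.transpose_apply, hpow, Matrix.of_apply, rowSum,
    Finset.mul_sum, Finset.sum_mul]
  rw [Finset.sum_comm]
  conv_rhs => rw [Finset.sum_comm]
  refine Finset.sum_congr rfl fun j _ => ?_
  rw [Finset.sum_comm]
  refine Finset.sum_congr rfl fun i _ => Finset.sum_congr rfl fun k _ => ?_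
  rw [pow_mul]; ring

end Traces

section Constants

variable {n : ℕ} {μ : Measure ℝ} {A : Matrix (Fin n) (Fin n) ℝ}

lemma meanT1_eq_sum : meanT1 μ A = ∑ i, (3 * (A * Aᵀ) i i ^ 2 + nu4 μ * ∑ k, A i k ^ 4) := by
  have h : ((A ⊙ A)ᵀ * (A ⊙ A)).trace = ∑ i, ∑ k, A i k ^ 4 := by
    rw [Finset.sum_comm]
    simp only [Matrix.trace, Matrix.diag_apply, Matrix.mul_apply, Matrix.transpose_apply,
      Matrix.hadamard_apply]
    exact Finset.sum_congr rfl fun i _ => Finset.sum_congr rfl fun k _ => by ring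
  rw [meanT1, h, trace_hadamard_self, Finset.sum_add_distrib, Finset.mul_sum, Finset.mul_sum]

lemma trace_gram_hadamard_self :
    ((Aᵀ * A) ⊙ (Aᵀ * A)).trace = ∑ i, ∑ j, rowSum A 2 2 i j := by
  have h := trace_hadamard_transpose_mul (A := A) (fun _ => 1) 1
  rw [Matrix.diagonal_one, Matrix.mul_one, hpow_one] at h
  rw [h]; simp

lemma meanT2_eq_sum : meanT2 μ A = (n : ℝ)⁻¹ * ((A * Aᵀ).trace ^ 2
    + ∑ i, ∑ j, (2 * (A * Aᵀ) i j ^ 2 + nu4 μ * rowSum A 2 2 i j)) := by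
  have hs : ∀ i j, (A * Aᵀ) j i = (A * Aᵀ) i j := fun i j => by
    rw [mul_transpose_apply_eq_rowSum, mul_transpose_apply_eq_rowSum, rowSum_comm]
  rw [meanT2, trace_sq, trace_gram_hadamard_self]
  simp only [Finset.sum_add_distrib, ← Finset.mul_sum, hs, ← sq]
  ring

lemma theta22_eq_sum : theta22 μ A = 4 * (A * Aᵀ).trace ^ 2 / (n : ℝ) ^ 2
    * ∑ i, ∑ j, (2 * (A * Aᵀ) i j ^ 2 + nu4 μ * rowSum A 2 2 i j) := by
  have hs : ∀ i j, (A * Aᵀ) j i = (A * Aᵀ) i j := fun i j => by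
    rw [mul_transpose_apply_eq_rowSum, mul_transpose_apply_eq_rowSum, rowSum_comm]
  rw [theta22, trace_sq, trace_gram_hadamard_self]
  simp only [Finset.sum_add_distrib, ← Finset.mul_sum, hs, ← sq]
  ring

lemma theta12_eq_sum : theta12 μ A = 2 * (A * Aᵀ).trace / (n : ℝ) * ∑ i, ∑ j,
    (12 * ((A * Aᵀ) i i * (A * Aᵀ) i j ^ 2) + 8 * nu4 μ * ((A * Aᵀ) i j * rowSum A 3 1 i j)
      + 6 * nu4 μ * ((A * Aᵀ) i i * rowSum A 2 2 i j) + nu6 μ * rowSum A 4 2 i j) := by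
  have hs : ∀ i j, (A * Aᵀ) j i = (A * Aᵀ) i j := fun i j => by
    rw [mul_transpose_apply_eq_rowSum, mul_transpose_apply_eq_rowSum, rowSum_comm]
  have h1 : (((A * Aᵀ) ^ 2) ⊙ (A * Aᵀ)).trace = ∑ i, ∑ j, (A * Aᵀ) i i * (A * Aᵀ) i j ^ 2 := by
    generalize A * Aᵀ = B at *
    simp only [Matrix.trace, Matrix.diag_apply, Matrix.hadamard_apply, sq B, Matrix.mul_apply,
      Finset.sum_mul]
    refine Finset.sum_congr rfl fun i _ => Finset.sum_congr rfl fun j _ => ?_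
    rw [hs i j]; ring
  have h2 : (A * Aᵀ * A * (hpow A 3)ᵀ).trace = ∑ i, ∑ j, (A * Aᵀ) i j * rowSum A 3 1 i j := by
    rw [trace_mul_mul_transpose]
    refine Finset.sum_congr rfl fun i _ => Finset.sum_congr rfl fun j _ => ?_
    rw [rowSum_comm A 3, ← hpow_mul_hpow_transpose_apply, hpow_one]
  have h3 : ((Aᵀ * diagPart (A * Aᵀ) * A) ⊙ (Aᵀ * A)).trace
      = ∑ i, ∑ j, (A * Aᵀ) i i * rowSum A 2 2 i j := by
    have h := trace_hadamard_transpose_mul (A := A) (A * Aᵀ).diag 1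
    rw [hpow_one] at h
    exact h
  have h4 : (Aᵀ * A).diag ⬝ᵥ ((hpow A 4)ᵀ *ᵥ 1) = ∑ i, ∑ j, rowSum A 4 2 i j := by
    simp only [dotProduct, Matrix.diag_apply, Matrix.mulVec, Matrix.mul_apply,
      Matrix.transpose_apply, hpow, Matrix.of_apply, rowSum, Pi.one_apply, mul_one,
      Finset.sum_mul_sum]
    rw [Finset.sum_comm]
    conv_rhs => rw [Finset.sum_comm]
    refine Finset.sum_congr rfl fun j _ => ?_
    rw [Finset.sum_comm]
    exact Finset.sum_congr rfl fun i _ => Finset.sum_congr rfl fun k _ => by ring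
  simp only [theta12, h1, h2, h3, h4, Finset.sum_add_distrib, ← Finset.mul_sum]
  ring

lemma theta11_eq_sum : theta11 μ A = ∑ i, ∑ j,
    (72 * ((A * Aᵀ) i i * (A * Aᵀ) j j * (A * Aᵀ) i j ^ 2) + 24 * (A * Aᵀ) i j ^ 4
      + nu4 μ * (48 * (rowSum A 3 1 i j * (A * Aᵀ) i j * (A * Aᵀ) j j)
        + 48 * (rowSum A 1 3 i j * (A * Aᵀ) i j * (A * Aᵀ) i i)
        + 36 * (rowSum A 2 2 i j * (A * Aᵀ) i i * (A * Aᵀ) j j)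
        + 72 * (rowSum A 2 2 i j * (A * Aᵀ) i j ^ 2))
      + nu4 μ ^ 2 * (16 * (rowSum A 3 1 i j * rowSum A 1 3 i j) + 18 * rowSum A 2 2 i j ^ 2)
      + nu6 μ * (6 * (rowSum A 4 2 i j * (A * Aᵀ) j j) + 6 * (rowSum A 2 4 i j * (A * Aᵀ) i i)
        + 16 * (rowSum A 3 3 i j * (A * Aᵀ) i j)) + nu8 μ * rowSum A 4 4 i j) := by
  have hs : ∀ i j, (A * Aᵀ) j i = (A * Aᵀ) i j := fun i j => by
    rw [mul_transpose_apply_eq_rowSum, mul_transpose_apply_eq_rowSum, rowSum_comm]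
  have h1 : (A * Aᵀ).diag ⬝ᵥ (((A * Aᵀ) ⊙ (A * Aᵀ)) *ᵥ (A * Aᵀ).diag)
      = ∑ i, ∑ j, (A * Aᵀ) i i * (A * Aᵀ) j j * (A * Aᵀ) i j ^ 2 := by
    rw [dotProduct_mulVec_eq_sum]
    refine Finset.sum_congr rfl fun i _ => Finset.sum_congr rfl fun j _ => ?_
    simp only [Matrix.diag_apply, Matrix.hadamard_apply]; ring
  have h2 : (((A * Aᵀ) ⊙ (A * Aᵀ)) ^ 2).trace = ∑ i, ∑ j, (A * Aᵀ) i j ^ 4 := by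
    rw [trace_sq]
    refine Finset.sum_congr rfl fun i _ => Finset.sum_congr rfl fun j _ => ?_
    simp only [Matrix.hadamard_apply, hs i j]; ring
  have h3 : (A * Aᵀ * diagPart (A * Aᵀ) * A * (hpow A 3)ᵀ).trace
      = ∑ i, ∑ j, rowSum A 3 1 i j * (A * Aᵀ) i j * (A * Aᵀ) j j := by
    rw [trace_mul_mul_transpose]
    refine Finset.sum_congr rfl fun i _ => Finset.sum_congr rfl fun j _ => ?_
    rw [rowSum_comm A 3, ← hpow_mul_hpow_transpose_apply, hpow_one, diagPart, Matrix.mul_diagonal,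
      Matrix.diag_apply]
    ring
  have h3' : ∑ i, ∑ j, rowSum A 1 3 i j * (A * Aᵀ) i j * (A * Aᵀ) i i
      = ∑ i, ∑ j, rowSum A 3 1 i j * (A * Aᵀ) i j * (A * Aᵀ) j j := by
    rw [Finset.sum_comm]
    refine Finset.sum_congr rfl fun i _ => Finset.sum_congr rfl fun j _ => ?_
    rw [rowSum_comm A 1, hs i j]
  have hrs : ∀ i j, ((A ⊙ A) * (A ⊙ A)ᵀ) i j = rowSum A 2 2 i j := fun i j => by
    rw [hadamard_self, hpow_mul_hpow_transpose_apply]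
  have h4 : (((A * Aᵀ) ⊙ (A * Aᵀ)) * ((A ⊙ A) * (A ⊙ A)ᵀ)).trace
      = ∑ i, ∑ j, rowSum A 2 2 i j * (A * Aᵀ) i j ^ 2 := by
    rw [← Matrix.mul_assoc, trace_mul_mul_transpose]
    refine Finset.sum_congr rfl fun i _ => Finset.sum_congr rfl fun j _ => ?_
    rw [hrs, rowSum_comm, Matrix.hadamard_apply]; ring
  have h5 : (A * Aᵀ).diag ⬝ᵥ (((A ⊙ A) * (A ⊙ A)ᵀ) *ᵥ (A * Aᵀ).diag)
      = ∑ i, ∑ j, rowSum A 2 2 i j * (A * Aᵀ) i i * (A * Aᵀ) j j := by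
    rw [dotProduct_mulVec_eq_sum]
    refine Finset.sum_congr rfl fun i _ => Finset.sum_congr rfl fun j _ => ?_
    rw [hrs]; simp only [Matrix.diag_apply]; ring
  have h6 : (((A ⊙ A) * (A ⊙ A)ᵀ) ^ 2).trace = ∑ i, ∑ j, rowSum A 2 2 i j ^ 2 := by
    rw [trace_sq]
    refine Finset.sum_congr rfl fun i _ => Finset.sum_congr rfl fun j _ => ?_
    rw [hrs, hrs, rowSum_comm A 2 2 j i]; ring
  have h7 : ((hpow A 3 * Aᵀ) ^ 2).trace = ∑ i, ∑ j, rowSum A 3 1 i j * rowSum A 1 3 i j := by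
    have e := hpow_mul_hpow_transpose_apply A 3 1
    rw [hpow_one] at e
    rw [trace_sq]
    refine Finset.sum_congr rfl fun i _ => Finset.sum_congr rfl fun j _ => ?_
    rw [e, e, rowSum_comm A 3 1 j i]
  have h8 : ((Aᵀ * diagPart (A * Aᵀ) * A) ⊙ ((hpow A 2)ᵀ * hpow A 2)).trace
      = ∑ i, ∑ j, rowSum A 2 4 i j * (A * Aᵀ) i i := by
    rw [diagPart, trace_hadamard_transpose_mul]
    refine Finset.sum_congr rfl fun i _ => Finset.sum_congr rfl fun j _ => ?_
    rw [mul_comm]; rfl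
  have h8' : ∑ i, ∑ j, rowSum A 4 2 i j * (A * Aᵀ) j j
      = ∑ i, ∑ j, rowSum A 2 4 i j * (A * Aᵀ) i i := by
    rw [Finset.sum_comm]
    refine Finset.sum_congr rfl fun i _ => Finset.sum_congr rfl fun j _ => ?_
    rw [rowSum_comm]
  have h9 : (A * Aᵀ * hpow A 3 * (hpow A 3)ᵀ).trace
      = ∑ i, ∑ j, rowSum A 3 3 i j * (A * Aᵀ) i j := by
    rw [trace_mul_mul_transpose]
    refine Finset.sum_congr rfl fun i _ => Finset.sum_congr rfl fun j _ => ?_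
    rw [hpow_mul_hpow_transpose_apply, rowSum_comm]; ring
  have h10 : (1 : Fin n → ℝ) ⬝ᵥ ((hpow A 4 * (hpow A 4)ᵀ) *ᵥ 1) = ∑ i, ∑ j, rowSum A 4 4 i j := by
    rw [dotProduct_mulVec_eq_sum]
    refine Finset.sum_congr rfl fun i _ => Finset.sum_congr rfl fun j _ => ?_
    rw [hpow_mul_hpow_transpose_apply]; simp
  simp only [theta11, h1, h2, h3, h4, h5, h6, h7, h8, h9, h10, Finset.sum_add_distrib,
    ← Finset.mul_sum, h3', h8']
  ring

end Constants

section Moments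

variable {n : ℕ} {μ : Measure ℝ} [IsProbabilityMeasure μ] (A : Matrix (Fin n) (Fin n) ℝ)

lemma integral_powSum_two (hsymm : μ.map (fun x => -x) = μ)
    (h8 : Integrable (fun x => |x| ^ 8) μ) (hvar : ∫ x, x ^ 2 ∂μ = 1) :
    ∫ ω, powSum A 2 ω ∂(Measure.pi fun _ => μ) = (A * Aᵀ).trace := by
  refine (integral_powSum hsymm (oddTransform_id h8) A (by norm_num)).trans ?_
  refine Finset.sum_congr rfl fun i _ => ?_
  simp only [jointMoment, linCum, (standardCumulants hvar).k20]
  rw [mul_one]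
  exact rowSum_two_zero A i i

lemma integral_powSum_four (hsymm : μ.map (fun x => -x) = μ)
    (h8 : Integrable (fun x => |x| ^ 8) μ) (hvar : ∫ x, x ^ 2 ∂μ = 1) :
    ∫ ω, powSum A 4 ω ∂(Measure.pi fun _ => μ) = meanT1 μ A := by
  refine (integral_powSum hsymm (oddTransform_id h8) A (by norm_num)).trans ?_
  rw [meanT1_eq_sum]
  refine Finset.sum_congr rfl fun i _ => ?_
  have h := rowSum_two_zero A i i
  unfold rowSum at h
  simp only [jointMoment, linCum, (standardCumulants hvar).k20, (standardCumulants hvar).k40, h]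
  simp; ring

lemma variance_powSum_two (hsymm : μ.map (fun x => -x) = μ)
    (h8 : Integrable (fun x => |x| ^ 8) μ) (hvar : ∫ x, x ^ 2 ∂μ = 1) :
    Var[powSum A 2; Measure.pi fun _ => μ]
      = ∑ i, ∑ j, (2 * (A * Aᵀ) i j ^ 2 + nu4 μ * rowSum A 2 2 i j) := by
  have hid := oddTransform_id h8
  rw [← covariance_self (memLp_powSum hsymm hid A (p := 2)
    (by norm_num)).aestronglyMeasurable.aemeasurable]
  refine (covariance_powSum hsymm hid hid A (p := 2) (q := 2) (by norm_num) (by norm_num)).trans ?_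
  refine Finset.sum_congr rfl fun i _ => Finset.sum_congr rfl fun j _ => ?_
  obtain ⟨k20, k11, k02, k40, k31, k22, k13, k04, k42, k33, k24, k44⟩ := standardCumulants hvar
  have h : ∀ s t, ∑ k, A i k ^ s * A j k ^ t = rowSum A s t i j := fun _ _ => rfl
  simp only [covMoment, jointMoment, linCum, h, k20, k11, k02, k22, mul_transpose_apply_eq_rowSum]
  ring

/-- The scaling constant is an exact variance: that of the linearization of the statistic. -/
theorem scaling_eq (hsymm : μ.map (fun x => -x) = μ)
    (h8 : Integrable (fun x => |x| ^ 8) μ) (hvar : ∫ x, x ^ 2 ∂μ = 1) :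
    scaling μ A = Var[quartic A (2 * (A * Aᵀ).trace * meanT1 μ A / (n * meanT2 μ A));
      Measure.pi fun _ => μ] / meanT2 μ A ^ 2 := by
  have hid := oddTransform_id h8
  have hq : ∀ r, Var[quartic A r; Measure.pi fun _ => μ] =
      ∑ i, ∑ j, covPoly r (linCum (A i) (A j) (pairCumulant μ (fun x => x) fun x => x)) := by
    intro r
    rw [← covariance_self (memLp_quartic hsymm hid A r).aestronglyMeasurable.aemeasurable]
    exact covariance_quartic hsymm hid hid A r
  obtain ⟨k20, k11, k02, k40, k31, k22, k13, k04, k42, k33, k24, k44⟩ := standardCumulants hvar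
  set κ := pairCumulant μ (fun x => x) fun x => x
  have h : ∀ s t i j, ∑ k, A i k ^ s * A j k ^ t = rowSum A s t i j := fun _ _ _ _ => rfl
  have c44 : ∑ i, ∑ j, covMoment (linCum (A i) (A j) κ) 4 4 = theta11 μ A := by
    rw [theta11_eq_sum]
    refine Finset.sum_congr rfl fun i _ => Finset.sum_congr rfl fun j _ => ?_
    simp only [covMoment, jointMoment, linCum, h, k20, k11, k02, k40, k31, k22, k13, k04, k42,
      k33, k24, k44, rowSum_two_zero, rowSum_zero_two, ← mul_transpose_apply_eq_rowSum]
    ring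
  obtain ⟨V42, hV42⟩ : ∃ V, V = ∑ i, ∑ j, covMoment (linCum (A i) (A j) κ) 4 2 := ⟨_, rfl⟩
  have c24 : ∑ i, ∑ j, covMoment (linCum (A i) (A j) κ) 2 4 = V42 := by
    rw [Finset.sum_comm, hV42]
    refine Finset.sum_congr rfl fun i _ => Finset.sum_congr rfl fun j _ => ?_
    simp only [covMoment, jointMoment, linCum, h, k20, k11, k02, k40, k31, k22, k13, k04, k42,
      k24, rowSum_comm A _ _ j i]
    ring
  have c42 : theta12 μ A = 2 * (A * Aᵀ).trace / n * V42 := by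
    rw [theta12_eq_sum, hV42]
    congr 1
    refine Finset.sum_congr rfl fun i _ => Finset.sum_congr rfl fun j _ => ?_
    simp only [covMoment, jointMoment, linCum, h, k20, k11, k02, k40, k31, k22, k42,
      rowSum_two_zero, rowSum_zero_two, ← mul_transpose_apply_eq_rowSum]
    ring
  obtain ⟨V22, hV22⟩ : ∃ V, V = ∑ i, ∑ j, covMoment (linCum (A i) (A j) κ) 2 2 := ⟨_, rfl⟩
  have c22 : theta22 μ A = 4 * (A * Aᵀ).trace ^ 2 / n ^ 2 * V22 := by
    rw [theta22_eq_sum, hV22]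
    congr 1
    refine Finset.sum_congr rfl fun i _ => Finset.sum_congr rfl fun j _ => ?_
    simp only [covMoment, jointMoment, linCum, h, k20, k11, k02, k22,
      rowSum_two_zero, rowSum_zero_two, ← mul_transpose_apply_eq_rowSum]
    ring
  rw [hq]
  simp only [covPoly, Finset.sum_add_distrib, Finset.sum_sub_distrib, ← Finset.mul_sum]
  rw [c44, c24, ← hV42, ← hV22]
  simp only [scaling, gradVec, c42, c22]
  simp only [dotProduct, Matrix.mulVec, Fin.sum_univ_two, Matrix.cons_val_zero, Matrix.cons_val_one,
    Matrix.of_apply, Matrix.cons_val', Matrix.cons_val_fin_one]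
  rcases eq_or_ne (meanT2 μ A) 0 with h0 | h0
  · simp [h0]
  · rcases eq_or_ne (n : ℝ) 0 with hn | hn
    · simp [hn]; field_simp
    · field_simp; ring

end Moments

/-! ### The residual projection -/

section Projection

variable {n p : ℕ} {X : Matrix (Fin n) (Fin p) ℝ}

lemma projMat_transpose (X : Matrix (Fin n) (Fin p) ℝ) : (projMat X)ᵀ = projMat X := by
  simp [projMat, Matrix.transpose_nonsing_inv, Matrix.mul_assoc]

lemma projMat_mul_self (hX : IsUnit (Xᵀ * X).det) : projMat X * projMat X = projMat X := by
  have h : X * (Xᵀ * X)⁻¹ * Xᵀ * (X * (Xᵀ * X)⁻¹ * Xᵀ) = X * (Xᵀ * X)⁻¹ * Xᵀ := by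
    calc X * (Xᵀ * X)⁻¹ * Xᵀ * (X * (Xᵀ * X)⁻¹ * Xᵀ)
        = X * ((Xᵀ * X)⁻¹ * (Xᵀ * X)) * (Xᵀ * X)⁻¹ * Xᵀ := by simp only [Matrix.mul_assoc]
      _ = _ := by rw [Matrix.nonsing_inv_mul _ hX, Matrix.mul_one]
  unfold projMat
  rw [Matrix.sub_mul, Matrix.mul_sub, Matrix.mul_sub, h]
  simp

lemma trace_projMat (hX : IsUnit (Xᵀ * X).det) : (projMat X).trace = (n : ℝ) - p := by
  rw [projMat, Matrix.trace_sub, Matrix.trace_one, Matrix.mul_assoc, Matrix.trace_mul_comm,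
    Matrix.mul_assoc, Matrix.nonsing_inv_mul _ hX, Matrix.trace_one]
  simp

lemma projMat_mul (hX : IsUnit (Xᵀ * X).det) : projMat X * X = 0 := by
  rw [projMat, Matrix.sub_mul, Matrix.mul_assoc, Matrix.mul_assoc, Matrix.nonsing_inv_mul _ hX]
  simp

/-- The residuals are a linear image of the standardized errors. -/
lemma residual_response (hX : IsUnit (Xᵀ * X).det) (β : Fin p → ℝ) (σ z : Fin n → ℝ) :
    residual X (response X β fun i => σ i * z i) = scaledProj X σ *ᵥ z := by
  have h1 : ∀ Y, residual X Y = projMat X *ᵥ Y := by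
    intro Y
    simp [residual, olsEstimator, projMat, Matrix.sub_mulVec, Matrix.mulVec_mulVec,
      Matrix.mul_assoc]
  have h2 : (fun i => σ i * z i) = Matrix.diagonal σ *ᵥ z := by
    ext i; simp [Matrix.mulVec_diagonal]
  rw [h1, response, Matrix.mulVec_add, Matrix.mulVec_mulVec, projMat_mul hX, Matrix.zero_mulVec,
    zero_add, h2, Matrix.mulVec_mulVec, scaledProj]

lemma sum_sq_projMat_mulVec_le (hX : IsUnit (Xᵀ * X).det) (v : Fin n → ℝ) :
    ∑ i, (projMat X *ᵥ v) i ^ 2 ≤ ∑ i, v i ^ 2 := by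
  have h1 : (projMat X *ᵥ v) ⬝ᵥ (projMat X *ᵥ v) = v ⬝ᵥ (projMat X *ᵥ v) := by
    rw [Matrix.dotProduct_mulVec, ← Matrix.mulVec_transpose, projMat_transpose,
      Matrix.mulVec_mulVec, projMat_mul_self hX, dotProduct_comm]
  have h2 : 0 ≤ ∑ i, (v i - (projMat X *ᵥ v) i) ^ 2 := Finset.sum_nonneg fun _ _ => sq_nonneg _
  simp only [dotProduct] at h1
  have h3 : ∑ i, (v i - (projMat X *ᵥ v) i) ^ 2 = ∑ i, v i ^ 2
      - 2 * ∑ i, v i * (projMat X *ᵥ v) i + ∑ i, (projMat X *ᵥ v) i * (projMat X *ᵥ v) i := by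
    rw [Finset.mul_sum, ← Finset.sum_sub_distrib, ← Finset.sum_add_distrib]
    exact Finset.sum_congr rfl fun i _ => by ring
  have h4 : ∑ i, (projMat X *ᵥ v) i ^ 2 = ∑ i, (projMat X *ᵥ v) i * (projMat X *ᵥ v) i :=
    Finset.sum_congr rfl fun i _ => by ring
  linarith

lemma scaledProj_apply (σ : Fin n → ℝ) (i k : Fin n) :
    scaledProj X σ i k = projMat X i k * σ k := by
  rw [scaledProj, Matrix.mul_diagonal]

lemma projMat_apply_comm (i k : Fin n) : projMat X i k = projMat X k i := by
  conv_lhs => rw [← projMat_transpose, Matrix.transpose_apply]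

lemma opBound_scaledProj (hX : IsUnit (Xᵀ * X).det) {σ : Fin n → ℝ} (hσ0 : ∀ i, 0 ≤ σ i) {c : ℝ}
    (hσ : ∀ i, σ i ≤ c) : OpBound (scaledProj X σ) (c ^ 2) := by
  have hs : ∀ i, σ i ^ 2 ≤ c ^ 2 := fun i => pow_le_pow_left₀ (hσ0 i) (hσ i) 2
  constructor
  · intro v
    have h1 : ∀ i, ∑ k, scaledProj X σ i k * v k = (projMat X *ᵥ fun k => σ k * v k) i := by
      intro i
      simp only [scaledProj_apply, Matrix.mulVec, dotProduct, mul_assoc]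
    simp only [h1]
    refine (sum_sq_projMat_mulVec_le hX _).trans ?_
    rw [Finset.mul_sum]
    refine Finset.sum_le_sum fun i _ => ?_
    rw [mul_pow]
    exact mul_le_mul_of_nonneg_right (hs i) (sq_nonneg _)
  · intro v
    have h1 : ∀ k, ∑ i, scaledProj X σ i k * v i = σ k * (projMat X *ᵥ v) k := by
      intro k
      simp only [scaledProj_apply, Matrix.mulVec, dotProduct, Finset.mul_sum]
      refine Finset.sum_congr rfl fun i _ => ?_
      rw [projMat_apply_comm]; ring
    simp only [h1, mul_pow]
    calc ∑ k, σ k ^ 2 * (projMat X *ᵥ v) k ^ 2 ≤ ∑ k, c ^ 2 * (projMat X *ᵥ v) k ^ 2 :=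
          Finset.sum_le_sum fun k _ => mul_le_mul_of_nonneg_right (hs k) (sq_nonneg _)
      _ = c ^ 2 * ∑ k, (projMat X *ᵥ v) k ^ 2 := by rw [Finset.mul_sum]
      _ ≤ c ^ 2 * ∑ k, v k ^ 2 :=
          mul_le_mul_of_nonneg_left (sum_sq_projMat_mulVec_le hX v) (sq_nonneg _)

lemma projMat_diag_eq_sum_sq (hX : IsUnit (Xᵀ * X).det) (k : Fin n) :
    projMat X k k = ∑ i, projMat X i k ^ 2 := by
  conv_lhs => rw [← projMat_mul_self hX]
  rw [Matrix.mul_apply]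
  refine Finset.sum_congr rfl fun i _ => ?_
  rw [projMat_apply_comm k i, sq]

lemma trace_mul_transpose_eq_sum (A : Matrix (Fin n) (Fin n) ℝ) :
    (A * Aᵀ).trace = ∑ i, ∑ k, A i k ^ 2 := by
  simp [Matrix.trace, Matrix.mul_apply, sq]

lemma trace_scaledProj (hX : IsUnit (Xᵀ * X).det) (σ : Fin n → ℝ) :
    (scaledProj X σ * (scaledProj X σ)ᵀ).trace = ∑ k, σ k * scaledProj X σ k k := by
  rw [trace_mul_transpose_eq_sum, Finset.sum_comm]
  refine Finset.sum_congr rfl fun k _ => ?_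
  simp only [scaledProj_apply, mul_pow]
  rw [← Finset.sum_mul, ← projMat_diag_eq_sum_sq hX]
  ring

/-- A lower bound for the sum in `exists_le_variance_quartic`, in terms of the trace. -/
lemma le_sum_sq_sum_pow_four (hX : IsUnit (Xᵀ * X).det) {σ : Fin n → ℝ} (hσ0 : ∀ i, 0 ≤ σ i)
    {c d : ℝ} (hc : 0 < c) (hσ : ∀ i, σ i ≤ c) (hd : 0 ≤ d) (hn : 0 < n)
    (htr : d * n ≤ (scaledProj X σ * (scaledProj X σ)ᵀ).trace) :
    (d / c) ^ 8 * n ≤ ∑ k, (∑ i, scaledProj X σ i k ^ 4) ^ 2 := by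
  have hn0 : (0 : ℝ) < n := by exact_mod_cast hn
  have h0 : ∀ k, 0 ≤ scaledProj X σ k k := fun k => by
    rw [scaledProj_apply, projMat_diag_eq_sum_sq hX]
    exact mul_nonneg (Finset.sum_nonneg fun _ _ => sq_nonneg _) (hσ0 k)
  have h1 : d * n ≤ c * ∑ k, scaledProj X σ k k := by
    refine htr.trans ?_
    rw [trace_scaledProj hX, Finset.mul_sum]
    exact Finset.sum_le_sum fun k _ => mul_le_mul_of_nonneg_right (hσ k) (h0 k)
  have h2 : d / c * n ≤ ∑ k, scaledProj X σ k k := by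
    rw [div_mul_eq_mul_div, div_le_iff₀ hc]; linarith
  have h3 : (∑ k, scaledProj X σ k k) ^ 8 ≤ (n : ℝ) ^ 7 * ∑ k, scaledProj X σ k k ^ 8 := by
    simpa using pow_sum_le_card_mul_sum_pow (s := Finset.univ) (fun k _ => h0 k) 7
  have h4 : ∑ k, scaledProj X σ k k ^ 8 ≤ ∑ k, (∑ i, scaledProj X σ i k ^ 4) ^ 2 := by
    refine Finset.sum_le_sum fun k _ => ?_
    rw [show (8 : ℕ) = 4 * 2 by norm_num, pow_mul]
    refine pow_le_pow_left₀ (pow_nonneg (h0 k) 4) ?_ 2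
    exact Finset.single_le_sum (f := fun i => scaledProj X σ i k ^ 4)
      (fun i _ => Even.pow_nonneg (by decide) _) (Finset.mem_univ k)
  have h5 : (d / c * n) ^ 8 ≤ (n : ℝ) ^ 7 * ∑ k, (∑ i, scaledProj X σ i k ^ 4) ^ 2 :=
    (pow_le_pow_left₀ (by positivity) h2 8).trans (h3.trans (by gcongr))
  have h6 : (n : ℝ) ^ 7 * ((d / c) ^ 8 * n) = (d / c * n) ^ 8 := by ring
  rw [← h6] at h5
  exact le_of_mul_le_mul_left h5 (by positivity)

end Projection

/-! ### The constants under homoscedasticity -/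

section Homoscedastic

variable {n p : ℕ} {μ : Measure ℝ} {X : Matrix (Fin n) (Fin p) ℝ}

lemma hpow_smul (s : ℝ) (M : Matrix (Fin n) (Fin n) ℝ) (k : ℕ) :
    hpow (s • M) k = s ^ k • hpow M k := by
  ext; simp [hpow, mul_pow]

lemma hpow_transpose {M : Matrix (Fin n) (Fin n) ℝ} (hM : Mᵀ = M) (k : ℕ) :
    (hpow M k)ᵀ = hpow M k := by
  ext i j
  simp only [hpow, Matrix.transpose_apply, Matrix.of_apply]
  rw [← Matrix.transpose_apply M, hM]

lemma diagPart_smul (s : ℝ) (M : Matrix (Fin n) (Fin n) ℝ) :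
    diagPart (s • M) = s • diagPart M := by
  ext i j
  rcases eq_or_ne i j with h | h
  · subst h; simp [diagPart]
  · simp [diagPart, h]

lemma scaledProj_const {σ : Fin n → ℝ} {s : ℝ} (hσ : ∀ i, σ i = s) :
    scaledProj X σ = s • projMat X := by
  ext i j
  rw [scaledProj_apply, hσ, Matrix.smul_apply, smul_eq_mul, mul_comm]

lemma smul_mul_smul_transpose {s : ℝ} {P : Matrix (Fin n) (Fin n) ℝ} (h1 : Pᵀ = P)
    (h2 : P * P = P) : (s • P) * (s • P)ᵀ = s ^ 2 • P := by
  rw [Matrix.transpose_smul, h1, Matrix.smul_mul, Matrix.mul_smul, smul_smul, h2, sq]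

lemma transpose_smul_mul_smul {s : ℝ} {P : Matrix (Fin n) (Fin n) ℝ} (h1 : Pᵀ = P)
    (h2 : P * P = P) : (s • P)ᵀ * (s • P) = s ^ 2 • P := by
  rw [Matrix.transpose_smul, h1, Matrix.smul_mul, Matrix.mul_smul, smul_smul, h2, sq]

variable {P : Matrix (Fin n) (Fin n) ℝ} {s : ℝ}

lemma meanT1_smul (h1 : Pᵀ = P) (h2 : P * P = P) : meanT1 μ (s • P) = s ^ 4 * numH0 μ P := by
  have h3 : (P ⊙ P)ᵀ = P ⊙ P := by rw [hadamard_self, hpow_transpose h1]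
  rw [meanT1, numH0, smul_mul_smul_transpose h1 h2]
  simp only [Matrix.smul_hadamard, Matrix.hadamard_smul, Matrix.transpose_smul, Matrix.smul_mul,
    Matrix.mul_smul, Matrix.trace_smul, smul_eq_mul, h3, sq (P ⊙ P)]
  ring

lemma meanT2_smul (h1 : Pᵀ = P) (h2 : P * P = P) (h3 : P.trace = (n : ℝ) - p) :
    meanT2 μ (s • P) = s ^ 4 * denH0 μ p P / n := by
  rw [meanT2, denH0, smul_mul_smul_transpose h1 h2, transpose_smul_mul_smul h1 h2]
  simp only [Matrix.smul_hadamard, Matrix.hadamard_smul, Matrix.trace_smul, smul_eq_mul, h3,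
    sq (s ^ 2 • P), Matrix.smul_mul, Matrix.mul_smul, h2]
  ring

lemma theta22_smul (h1 : Pᵀ = P) (h2 : P * P = P) (h3 : P.trace = (n : ℝ) - p) :
    theta22 μ (s • P) = s ^ 8 * theta22H0 μ p P := by
  rw [theta22, theta22H0, smul_mul_smul_transpose h1 h2, transpose_smul_mul_smul h1 h2]
  simp only [Matrix.smul_hadamard, Matrix.hadamard_smul, Matrix.trace_smul, smul_eq_mul, h3,
    sq (s ^ 2 • P), Matrix.smul_mul, Matrix.mul_smul, h2]
  ring

lemma theta12_smul (h1 : Pᵀ = P) (h2 : P * P = P) (h3 : P.trace = (n : ℝ) - p) :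
    theta12 μ (s • P) = s ^ 8 * theta12H0 μ p P := by
  rw [theta12, theta12H0, smul_mul_smul_transpose h1 h2, transpose_smul_mul_smul h1 h2]
  simp only [hpow_smul, diagPart_smul, Matrix.transpose_smul, hpow_transpose h1, h1,
    Matrix.smul_hadamard, Matrix.hadamard_smul, Matrix.trace_smul, smul_eq_mul, h3,
    sq (s ^ 2 • P), Matrix.smul_mul, Matrix.mul_smul, h2, Matrix.diag_smul, Matrix.smul_mulVec,
    dotProduct_smul, smul_dotProduct]
  ring

lemma theta11_smul (h1 : Pᵀ = P) (h2 : P * P = P) :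
    theta11 μ (s • P) = s ^ 8 * theta11H0 μ P := by
  rw [theta11, theta11H0, smul_mul_smul_transpose h1 h2]
  have h4 : (P ⊙ P)ᵀ = P ⊙ P := by rw [hadamard_self, hpow_transpose h1]
  have e3 : (P ⊙ P) ^ 3 = (P ⊙ P) * ((P ⊙ P) * (P ⊙ P)) := by rw [pow_succ', sq]
  have e4 : (P ⊙ P) ^ 4 = ((P ⊙ P) * (P ⊙ P)) * ((P ⊙ P) * (P ⊙ P)) := by
    rw [show 4 = 2 + 2 by norm_num, pow_add, sq]
  have hsq : ∀ (c : ℝ) (M : Matrix (Fin n) (Fin n) ℝ), (c • M) ^ 2 = c ^ 2 • (M * M) := by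
    intro c M; rw [sq, Matrix.smul_mul, Matrix.mul_smul, smul_smul, sq]
  simp only [hpow_smul, diagPart_smul, Matrix.transpose_smul, hpow_transpose h1, h1, h4, e3, e4,
    Matrix.smul_hadamard, Matrix.hadamard_smul, Matrix.trace_smul, smul_eq_mul, hsq, smul_smul,
    sq (P ⊙ P), sq (hpow P 3 * P), Matrix.smul_mul, Matrix.mul_smul, Matrix.diag_smul,
    Matrix.smul_mulVec, dotProduct_smul, smul_dotProduct, Matrix.mulVec_smul]
  ring

theorem centering_eq_centeringH0 (hX : IsUnit (Xᵀ * X).det) {σ : Fin n → ℝ} (hs : 0 < s)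
    (hσ : ∀ i, σ i = s) :
    centering μ (scaledProj X σ) = centeringH0 μ p (projMat X) := by
  have h1 := projMat_transpose X
  have h2 := projMat_mul_self hX
  have h3 := trace_projMat hX
  rw [scaledProj_const hσ, centering, centeringH0, meanT1_smul h1 h2, meanT2_smul h1 h2 h3]
  rcases eq_or_ne (denH0 μ p (projMat X)) 0 with h | h
  · simp [h]
  · congr 1
    field_simp

theorem scaling_eq_scalingH0 (hX : IsUnit (Xᵀ * X).det) {σ : Fin n → ℝ} (hs : 0 < s)
    (hσ : ∀ i, σ i = s) :
    scaling μ (scaledProj X σ) = scalingH0 μ p (projMat X) := by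
  have h1 := projMat_transpose X
  have h2 := projMat_mul_self hX
  have h3 := trace_projMat hX
  rw [scaledProj_const hσ, scaling, scalingH0, gradVec, gradVecH0, meanT1_smul h1 h2,
    meanT2_smul h1 h2 h3, theta11_smul h1 h2, theta12_smul h1 h2 h3, theta22_smul h1 h2 h3]
  simp only [dotProduct, Matrix.mulVec, Fin.sum_univ_two, Matrix.cons_val_zero, Matrix.cons_val_one,
    Matrix.of_apply, Matrix.cons_val', Matrix.cons_val_fin_one]
  rcases eq_or_ne (denH0 μ p (projMat X)) 0 with h | h
  · simp [h]
  · rcases eq_or_ne (n : ℝ) 0 with hn | hn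
    · simp [hn]
    · field_simp

end Homoscedastic

/-! ### Normal approximation of the quartic form for unbounded variables -/

section L2

variable {Ω : Type*} [MeasurableSpace Ω] {P : Measure Ω} [IsProbabilityMeasure P] {X Y : Ω → ℝ}

lemma sq_covariance_le (hX : MemLp X 2 P) (hY : MemLp Y 2 P) :
    cov[X, Y; P] ^ 2 ≤ Var[X; P] * Var[Y; P] := by
  have h : ∀ s : ℝ, 0 ≤ Var[Y; P] * (s * s) + (2 * cov[X, Y; P]) * s + Var[X; P] := by
    intro s
    have h1 := variance_nonneg (X + fun ω => s * Y ω) P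
    rw [variance_add hX (hY.const_mul s), variance_const_mul, covariance_const_mul_right] at h1
    nlinarith
  have := discrim_le_zero h
  unfold discrim at this
  linarith

/-- The standard deviation is a seminorm. -/
lemma abs_sqrt_variance_sub_le (hX : MemLp X 2 P) (hY : MemLp Y 2 P) :
    |√Var[X; P] - √Var[Y; P]| ≤ √Var[X - Y; P] := by
  have hc := sq_covariance_le hX hY
  have hx := Real.sq_sqrt (variance_nonneg X P)
  have hy := Real.sq_sqrt (variance_nonneg Y P)
  have hx0 := Real.sqrt_nonneg (Var[X; P])
  have hy0 := Real.sqrt_nonneg (Var[Y; P])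
  refine Real.le_sqrt_of_sq_le ?_
  rw [sq_abs, variance_sub hX hY]
  have : cov[X, Y; P] ≤ √Var[X; P] * √Var[Y; P] := by
    refine (abs_le_of_sq_le_sq' ?_ (by positivity)).2
    rw [mul_pow, hx, hy]; exact hc
  nlinarith

lemma integral_abs_sub_integral_le (hX : MemLp X 2 P) :
    ∫ ω, |X ω - ∫ z, X z ∂P| ∂P ≤ √Var[X; P] := by
  refine Real.le_sqrt_of_sq_le ?_
  have hm : MemLp (fun ω => |X ω - ∫ z, X z ∂P|) 2 P := (hX.sub (memLp_const _)).norm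
  have h := variance_nonneg (fun ω => |X ω - ∫ z, X z ∂P|) P
  rw [variance_eq_sub hm] at h
  simp only [Pi.pow_apply, sq_abs] at h
  rw [variance_eq_integral hX.aestronglyMeasurable.aemeasurable]
  linarith

end L2

lemma norm_exp_I_mul_sub_exp_le (x y : ℝ) :
    ‖Complex.exp (Complex.I * x) - Complex.exp (Complex.I * y)‖ ≤ |x - y| := by
  have h : Complex.exp (Complex.I * x) - Complex.exp (Complex.I * y)
      = Complex.exp (Complex.I * y) * (Complex.exp (Complex.I * (x - y : ℝ)) - 1) := by
    rw [mul_sub, ← Complex.exp_add, mul_one]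
    congr 2; push_cast; ring
  rw [h, norm_mul, Complex.norm_exp_I_mul_ofReal, one_mul]
  exact Real.norm_exp_I_mul_ofReal_sub_one_le

lemma abs_exp_neg_sq_half_sub_le (x y : ℝ) :
    |Real.exp (-(x ^ 2 / 2)) - Real.exp (-(y ^ 2 / 2))| ≤ |x - y| := by
  have hd : ∀ x : ℝ, HasDerivAt (fun x : ℝ => Real.exp (-(x ^ 2 / 2)))
      (Real.exp (-(x ^ 2 / 2)) * (-x)) x := by
    intro x
    have h1 : HasDerivAt (fun x : ℝ => -(x ^ 2 / 2)) (-x) x := by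
      have := ((hasDerivAt_pow 2 x).div_const 2).neg
      refine this.congr_deriv ?_
      simp
    exact h1.exp
  have := Convex.norm_image_sub_le_of_norm_hasDerivWithin_le (f := fun x : ℝ =>
    Real.exp (-(x ^ 2 / 2))) (f' := fun x => Real.exp (-(x ^ 2 / 2)) * (-x)) (C := 1)
    (s := Set.univ) (x := y) (y := x) (fun x _ => (hd x).hasDerivWithinAt) (fun x _ => ?_)
    convex_univ (Set.mem_univ _) (Set.mem_univ _)
  · simpa [Real.norm_eq_abs] using this
  · rw [norm_mul, norm_neg, Real.norm_of_nonneg (Real.exp_pos _).le, Real.norm_eq_abs]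
    have h1 : |x| ≤ Real.exp (x ^ 2 / 2) := by
      have := Real.add_one_le_exp (x ^ 2 / 2)
      nlinarith [sq_nonneg (|x| - 1), sq_abs x]
    calc Real.exp (-(x ^ 2 / 2)) * |x| ≤ Real.exp (-(x ^ 2 / 2)) * Real.exp (x ^ 2 / 2) := by gcongr
      _ = 1 := by rw [← Real.exp_add]; simp

section Approximation

variable {μ : Measure ℝ} [IsProbabilityMeasure μ] {C ρ : ℝ}

/-- Normal approximation of the centered `quartic` under a symmetric law with finite eighth moment,
uniformly over the matrices of bounded operator norm. -/
theorem exists_forall_norm_charFun_quartic_sub_le (hsymm : μ.map (fun x => -x) = μ)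
    (h8 : Integrable (fun x => |x| ^ 8) μ) (hC : 1 ≤ C) (hρ : 0 ≤ ρ) {K ε : ℝ} (hK : 0 ≤ K)
    (hε : 0 < ε) :
    ∃ N : ℕ, ∀ {n : ℕ} {A : Matrix (Fin n) (Fin n) ℝ} {r : ℝ}, N ≤ n → 0 < n → OpBound A C →
      |r| ≤ ρ → ∀ t : ℝ, |t| ≤ K →
      ‖∫ y, Complex.exp (Complex.I * (t * ((quartic A r y
          - ∫ z, quartic A r z ∂(Measure.pi fun _ => μ)) / √n) : ℝ)) ∂(Measure.pi fun _ => μ)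
        - Real.exp (-(Var[quartic A r; Measure.pi fun _ => μ] / n * t ^ 2 / 2))‖ ≤ ε := by
  set η : ℝ := (ε / (4 * (K + 1))) ^ 2 with hη
  have hη0 : 0 < η := by positivity
  obtain ⟨τ, hτ1, hτ⟩ := exists_variance_sub_clamp_le hsymm h8 hC hρ hη0
  have hτ0 : 0 ≤ τ := by linarith
  have hcl := oddTransform_clamp h8 hτ0
  have hid := oddTransform_id h8
  have hmc : Measurable (clamp τ) := hcl.measurable
  set ν : Measure ℝ := μ.map (clamp τ) with hν
  have : IsProbabilityMeasure ν := Measure.isProbabilityMeasure_map hmc.aemeasurable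
  have hνb : ∀ᵐ y ∂ν, |y| ≤ τ := by
    rw [hν, ae_map_iff hmc.aemeasurable (measurableSet_le (by fun_prop) (by fun_prop))]
    exact ae_of_all _ fun x => abs_clamp_le hτ0 x
  have hνs : ν.map (fun x => -x) = ν := by
    rw [hν, Measure.map_map measurable_neg hmc]
    conv_rhs => rw [← hsymm]
    rw [Measure.map_map hmc measurable_neg]
    congr 1
    ext x
    simp [clamp_neg hτ0]
  obtain ⟨L, hL0, hL⟩ := exists_norm_charFun_quartic_sub_le hνb hτ1 hνs hC hρ
  have hlim : Tendsto (fun n : ℕ => L * (1 + K ^ 3) / √√n) atTop (𝓝 0) := by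
    refine Tendsto.div_atTop tendsto_const_nhds ?_
    exact Real.tendsto_sqrt_atTop.comp (Real.tendsto_sqrt_atTop.comp tendsto_natCast_atTop_atTop)
  obtain ⟨N, hN⟩ := eventually_atTop.1 (hlim.eventually (gt_mem_nhds (half_pos hε)))
  refine ⟨N, ?_⟩
  intro n A r hNn hn hA hr t ht
  have h1 := hL hn hA hr t
  have h2 : L * (1 + |t| ^ 3) / √√n ≤ ε / 2 := by
    refine le_trans ?_ (hN n hNn).le
    gcongr
  set Pμ : Measure (Fin n → ℝ) := Measure.pi fun _ => μ with hPμ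
  set Pν : Measure (Fin n → ℝ) := Measure.pi fun _ => ν with hPν
  have mp : MeasurePreserving (fun (ω : Fin n → ℝ) k => clamp τ (ω k)) Pμ Pν :=
    measurePreserving_pi (fun _ : Fin n => μ) (fun _ => ν) (f := fun _ => clamp τ)
      fun _ => ⟨hmc, rfl⟩
  have hWm : Continuous (quartic A r) := continuous_quartic A r
  have hint : ∫ z, quartic A r z ∂Pν = ∫ ω, quartic A r (fun k => clamp τ (ω k)) ∂Pμ := by
    rw [← mp.map_eq, integral_map mp.measurable.aemeasurable hWm.aestronglyMeasurable]
  have hvarν : Var[quartic A r; Pν] = Var[fun ω => quartic A r fun k => clamp τ (ω k); Pμ] := by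
    rw [← mp.map_eq, variance_map hWm.measurable.aemeasurable mp.measurable.aemeasurable]
    rfl
  have hchar : ∀ m : ℝ, ∫ y, Complex.exp (Complex.I * (t * ((quartic A r y - m) / √n) : ℝ)) ∂Pν
      = ∫ ω, Complex.exp (Complex.I * (t * ((quartic A r (fun k => clamp τ (ω k)) - m) / √n) : ℝ))
        ∂Pμ := by
    intro m
    rw [← mp.map_eq, integral_map mp.measurable.aemeasurable
      (Continuous.aestronglyMeasurable (by fun_prop))]
  rw [hint, hchar, hvarν] at h1
  have mX := memLp_quartic (n := n) hsymm hid A r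
  have mY := memLp_quartic (n := n) hsymm hcl A r
  have hvar := hτ hA hr
  set X : (Fin n → ℝ) → ℝ := fun ω => quartic A r fun k => ω k with hX
  set Y : (Fin n → ℝ) → ℝ := fun ω => quartic A r fun k => clamp τ (ω k) with hY
  change Var[X - Y; Pμ] ≤ η * n at hvar
  change ‖∫ ω, Complex.exp (Complex.I * (t * ((Y ω - ∫ z, Y z ∂Pμ) / √n) : ℝ)) ∂Pμ
    - Real.exp (-(Var[Y; Pμ] / n * t ^ 2 / 2))‖ ≤ _ at h1
  change ‖∫ ω, Complex.exp (Complex.I * (t * ((X ω - ∫ z, X z ∂Pμ) / √n) : ℝ)) ∂Pμ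
    - Real.exp (-(Var[X; Pμ] / n * t ^ 2 / 2))‖ ≤ ε
  have hXm : Measurable X := hWm.measurable
  have hYm : Measurable Y := by
    have : Measurable (quartic A r) := hWm.measurable
    exact this.comp mp.measurable
  have hn0 : (0 : ℝ) < n := by exact_mod_cast hn
  have hsn : 0 < √(n : ℝ) := Real.sqrt_pos.2 hn0
  have hsv : √Var[X - Y; Pμ] ≤ √η * √n := by
    rw [← Real.sqrt_mul hη0.le]; exact Real.sqrt_le_sqrt hvar
  have hKη : K * √η ≤ ε / 4 := by
    rw [hη, Real.sqrt_sq (by positivity), ← mul_div_assoc, div_le_div_iff₀ (by positivity)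
      (by norm_num)]
    nlinarith
  -- comparison of the characteristic functions
  have d1 : ‖∫ ω, Complex.exp (Complex.I * (t * ((X ω - ∫ z, X z ∂Pμ) / √n) : ℝ)) ∂Pμ
      - ∫ ω, Complex.exp (Complex.I * (t * ((Y ω - ∫ z, Y z ∂Pμ) / √n) : ℝ)) ∂Pμ‖ ≤ ε / 4 := by
    have hie : ∀ G : (Fin n → ℝ) → ℝ, Measurable G →
        Integrable (fun ω => Complex.exp (Complex.I * (G ω : ℝ))) Pμ := by
      intro G hG
      refine Integrable.of_bound (by fun_prop : Measurable _).aestronglyMeasurable 1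
        (ae_of_all _ fun ω => ?_)
      rw [Complex.norm_exp_I_mul_ofReal]
    rw [← integral_sub (hie _ (by fun_prop)) (hie _ (by fun_prop))]
    have mZ : MemLp (X - Y) 2 Pμ := mX.sub mY
    have hmean : ∫ z, (X - Y) z ∂Pμ = ∫ z, X z ∂Pμ - ∫ z, Y z ∂Pμ :=
      integral_sub (mX.integrable (by norm_num)) (mY.integrable (by norm_num))
    have hiz : Integrable (fun ω => |(X - Y) ω - ∫ z, (X - Y) z ∂Pμ|) Pμ :=
      ((mZ.integrable (by norm_num)).sub (integrable_const _)).abs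
    calc _ ≤ ∫ ω, ‖Complex.exp (Complex.I * (t * ((X ω - ∫ z, X z ∂Pμ) / √n) : ℝ))
          - Complex.exp (Complex.I * (t * ((Y ω - ∫ z, Y z ∂Pμ) / √n) : ℝ))‖ ∂Pμ :=
          norm_integral_le_integral_norm _
      _ ≤ ∫ ω, |t| / √n * |(X - Y) ω - ∫ z, (X - Y) z ∂Pμ| ∂Pμ := by
          refine integral_mono ((hie _ (by fun_prop)).sub (hie _ (by fun_prop))).norm
            (hiz.const_mul _) fun ω => ?_
          refine (norm_exp_I_mul_sub_exp_le _ _).trans (le_of_eq ?_)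
          rw [hmean, div_mul_eq_mul_div, ← abs_mul, ← abs_of_pos hsn, ← abs_div, abs_of_pos hsn]
          congr 1
          simp only [Pi.sub_apply]
          ring
      _ = |t| / √n * ∫ ω, |(X - Y) ω - ∫ z, (X - Y) z ∂Pμ| ∂Pμ := integral_const_mul _ _
      _ ≤ K / √n * (√η * √n) := by
          gcongr
          exact (integral_abs_sub_integral_le mZ).trans hsv
      _ = K * √η := by field_simp
      _ ≤ ε / 4 := hKη
  -- comparison of the variances
  have d2 : |Real.exp (-(Var[X; Pμ] / n * t ^ 2 / 2)) - Real.exp (-(Var[Y; Pμ] / n * t ^ 2 / 2))|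
      ≤ ε / 4 := by
    have e : ∀ v : ℝ, 0 ≤ v → v / n * t ^ 2 / 2 = (t * (√v / √n)) ^ 2 / 2 := by
      intro v hv
      rw [mul_pow, div_pow, Real.sq_sqrt hv, Real.sq_sqrt hn0.le]; ring
    rw [e _ (variance_nonneg _ _), e _ (variance_nonneg _ _)]
    refine (abs_exp_neg_sq_half_sub_le _ _).trans ?_
    rw [← mul_sub, ← sub_div, abs_mul, abs_div, abs_of_pos hsn]
    calc |t| * (|√Var[X; Pμ] - √Var[Y; Pμ]| / √n) ≤ K * ((√η * √n) / √n) := by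
          gcongr
          exact (abs_sqrt_variance_sub_le mX mY).trans hsv
      _ = K * √η := by field_simp
      _ ≤ ε / 4 := hKη
  set a := ∫ ω, Complex.exp (Complex.I * (t * ((X ω - ∫ z, X z ∂Pμ) / √n) : ℝ)) ∂Pμ
  set b := ∫ ω, Complex.exp (Complex.I * (t * ((Y ω - ∫ z, Y z ∂Pμ) / √n) : ℝ)) ∂Pμ
  set x := Real.exp (-(Var[X; Pμ] / n * t ^ 2 / 2))
  set y := Real.exp (-(Var[Y; Pμ] / n * t ^ 2 / 2))
  have d3 : ‖((y : ℝ) : ℂ) - x‖ ≤ ε / 4 := by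
    rw [← Complex.ofReal_sub, Complex.norm_real, Real.norm_eq_abs, abs_sub_comm]; exact d2
  calc ‖a - x‖ = ‖(a - b) + (b - y) + (y - x)‖ := by congr 1; ring
    _ ≤ ‖a - b‖ + ‖b - y‖ + ‖(y : ℂ) - x‖ := norm_add₃_le
    _ ≤ ε / 4 + ε / 2 + ε / 4 := by linarith
    _ = ε := by ring

end Approximation

/-! ### Linearization of the statistic -/

section Linearization

lemma norm_integral_exp_sub_le {Ω : Type*} [MeasurableSpace Ω] {P : Measure Ω}
    [IsProbabilityMeasure P] {G Z U : Ω → ℝ} (hG : Measurable G) (hZ : Measurable Z)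
    (hU : Integrable U P) (hU0 : ∀ ω, 0 ≤ U ω) {δ : ℝ} (hδ : 0 ≤ δ)
    (h : ∀ ω, U ω ≤ 1 → |G ω - Z ω| ≤ δ) (t : ℝ) :
    ‖∫ ω, Complex.exp (Complex.I * (t * G ω : ℝ)) ∂P
      - ∫ ω, Complex.exp (Complex.I * (t * Z ω : ℝ)) ∂P‖ ≤ |t| * δ + 2 * ∫ ω, U ω ∂P := by
  have hie : ∀ H : Ω → ℝ, Measurable H →
      Integrable (fun ω => Complex.exp (Complex.I * (H ω : ℝ))) P := by
    intro H hH
    refine Integrable.of_bound (by fun_prop : Measurable _).aestronglyMeasurable 1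
      (ae_of_all _ fun ω => ?_)
    rw [Complex.norm_exp_I_mul_ofReal]
  have i1 := hie _ (hG.const_mul t)
  have i2 := hie _ (hZ.const_mul t)
  rw [← integral_sub i1 i2]
  have i3 : Integrable (fun ω => |t| * δ + 2 * U ω) P := (integrable_const _).add (hU.const_mul 2)
  calc _ ≤ ∫ ω, ‖Complex.exp (Complex.I * (t * G ω : ℝ))
        - Complex.exp (Complex.I * (t * Z ω : ℝ))‖ ∂P := norm_integral_le_integral_norm _
    _ ≤ ∫ ω, (|t| * δ + 2 * U ω) ∂P := by
        refine integral_mono (i1.sub i2).norm i3 fun ω => ?_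
        rcases le_or_gt (U ω) 1 with h1 | h1
        · refine (norm_exp_I_mul_sub_exp_le _ _).trans ?_
          rw [← mul_sub, abs_mul]
          have := mul_le_mul_of_nonneg_left (h ω h1) (abs_nonneg t)
          have := hU0 ω
          linarith
        · refine (norm_sub_le _ _).trans ?_
          rw [Complex.norm_exp_I_mul_ofReal, Complex.norm_exp_I_mul_ofReal]
          have : 0 ≤ |t| * δ := by positivity
          linarith
    _ = _ := by
        rw [integral_add (integrable_const _) (hU.const_mul 2), integral_const_mul 2 U]
        simp

/-- The remainder of the linearization of `T₁ / S²` at the means, where `w` and `S - s` are the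
centered linear part and the centered sum of squares. -/
lemma abs_remainder_le {n s V m w S v d L₁ L₂ M K κ : ℝ} (hd : 0 < d) (hκ : 0 < κ)
    (hn : 1 ≤ n) (hs : d * n ≤ s) (hV0 : 0 ≤ V) (hV : V ≤ L₂ * n)
    (hL₁ : 0 ≤ L₁) (hL₂ : 0 ≤ L₂) (hM : 0 ≤ M)
    (hm : |m| ≤ L₁ * n) (hv : √(κ * n) ≤ v) (hx : (S - s) ^ 2 ≤ M * n) (hw : |w / v| ≤ K)
    (hnM : 4 * M ≤ d ^ 2 * n) :
    S ≠ 0 ∧ |(s ^ 2 + V) / S ^ 2 * (w / v - m / (s ^ 2 + V) * ((S - s) ^ 2 - V) / v) - w / v|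
      ≤ (4 * ((L₂ + M) / d ^ 2 + 2 * √M / d) * K
          + 4 * (1 + L₂ / d ^ 2) * (L₁ / d ^ 2) * (M + L₂) / √κ) / √n := by
  have hn0 : 0 < n := by linarith
  have hs0 : 0 < s := lt_of_lt_of_le (by positivity) hs
  have hr1 : 1 ≤ √n := Real.one_le_sqrt.2 hn
  have hr0 : 0 < √n := by linarith
  have hrr : √n * √n = n := Real.mul_self_sqrt hn0.le
  have hκ0 : 0 < √κ := Real.sqrt_pos.2 hκ
  rw [Real.sqrt_mul hκ.le] at hv
  have hv0 : 0 < v := lt_of_lt_of_le (by positivity) hv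
  have hxa : |S - s| ≤ √M * √n := by
    rw [← Real.sqrt_mul hM]; exact Real.abs_le_sqrt hx
  have hdn : 0 < d * n := by positivity
  have hsq : (d * n) ^ 2 ≤ s ^ 2 := pow_le_pow_left₀ hdn.le hs 2
  have hS : s / 2 ≤ S := by
    have h1 : |S - s| ≤ s / 2 := by
      refine abs_le_of_sq_le_sq ?_ (by positivity)
      nlinarith
    have := (abs_le.1 h1).1
    linarith
  have hS0 : 0 < S := by linarith
  have hSS : s ^ 2 / 4 ≤ S ^ 2 := by
    have := pow_le_pow_left₀ (by positivity) hS 2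
    linarith [this, (by ring : (s / 2) ^ 2 = s ^ 2 / 4)]
  have hsV : 0 < s ^ 2 + V := by positivity
  have hS2 : 0 < S ^ 2 := by positivity
  refine ⟨hS0.ne', ?_⟩
  -- the factor replacing the square by its mean
  have hVs : V / s ^ 2 ≤ L₂ / d ^ 2 / n := by
    rw [div_div, div_le_div_iff₀ (by positivity) (by positivity)]
    calc V * (d ^ 2 * n) ≤ (L₂ * n) * (d ^ 2 * n) := by gcongr
      _ = L₂ * (d * n) ^ 2 := by ring
      _ ≤ L₂ * s ^ 2 := by gcongr
  have hinv : 1 / n ≤ 1 / √n := by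
    refine one_div_le_one_div_of_le hr0 ?_
    nlinarith
  have hQ1 : |(s ^ 2 + V) / S ^ 2 - 1| ≤ 4 * ((L₂ + M) / d ^ 2 + 2 * √M / d) / √n := by
    have e : (s ^ 2 + V) / S ^ 2 - 1 = (V - 2 * s * (S - s) - (S - s) ^ 2) / S ^ 2 := by
      field_simp; ring
    have hnum : |V - 2 * s * (S - s) - (S - s) ^ 2| ≤ V + 2 * s * (√M * √n) + M * n := by
      have h1 : |V - 2 * s * (S - s) - (S - s) ^ 2|
          ≤ |V| + |2 * s * (S - s)| + |(S - s) ^ 2| := by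
        refine (abs_sub _ _).trans ?_
        gcongr
        exact abs_sub _ _
      rw [abs_of_nonneg hV0, abs_mul, abs_of_nonneg (by positivity : 0 ≤ 2 * s),
        abs_of_nonneg (sq_nonneg (S - s))] at h1
      refine h1.trans ?_
      gcongr
    rw [e, abs_div, abs_of_pos hS2]
    calc |V - 2 * s * (S - s) - (S - s) ^ 2| / S ^ 2
        ≤ (V + 2 * s * (√M * √n) + M * n) / (s ^ 2 / 4) := by gcongr
      _ = 4 * (V / s ^ 2 + 2 * √M * √n / s + M * n / s ^ 2) := by field_simp
      _ ≤ 4 * (L₂ / d ^ 2 / n + 2 * √M * √n / (d * n) + M * n / (d * n) ^ 2) := by gcongr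
      _ = 4 * ((L₂ + M) / d ^ 2 * (1 / n) + 2 * √M / d * (√n / n)) := by field_simp; ring
      _ = 4 * ((L₂ + M) / d ^ 2 * (1 / n) + 2 * √M / d * (1 / √n)) := by
          rw [Real.sqrt_div_self']
      _ ≤ 4 * ((L₂ + M) / d ^ 2 * (1 / √n) + 2 * √M / d * (1 / √n)) := by gcongr
      _ = _ := by ring
  have hQ : (s ^ 2 + V) / S ^ 2 ≤ 4 * (1 + L₂ / d ^ 2) := by
    calc (s ^ 2 + V) / S ^ 2 ≤ (s ^ 2 + V) / (s ^ 2 / 4) := by gcongr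
      _ = 4 * (1 + V / s ^ 2) := by field_simp
      _ ≤ 4 * (1 + L₂ / d ^ 2) := by
          have := hVs.trans (div_le_self (by positivity) hn)
          linarith
  have hR : |m / (s ^ 2 + V) * ((S - s) ^ 2 - V) / v| ≤ L₁ / d ^ 2 * (M + L₂) / √κ / √n := by
    rw [abs_div, abs_mul, abs_div, abs_of_pos hsV, abs_of_pos hv0]
    have h1 : |(S - s) ^ 2 - V| ≤ (M + L₂) * n := by
      rw [abs_le]; constructor <;> nlinarith [sq_nonneg (S - s), mul_nonneg hM hn0.le,
        mul_nonneg hL₂ hn0.le]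
    calc |m| / (s ^ 2 + V) * |(S - s) ^ 2 - V| / v
        ≤ (L₁ * n) / (d * n) ^ 2 * ((M + L₂) * n) / (√κ * √n) := by
          gcongr
          linarith
      _ = _ := by field_simp
  have e : (s ^ 2 + V) / S ^ 2 * (w / v - m / (s ^ 2 + V) * ((S - s) ^ 2 - V) / v) - w / v
      = ((s ^ 2 + V) / S ^ 2 - 1) * (w / v)
        - (s ^ 2 + V) / S ^ 2 * (m / (s ^ 2 + V) * ((S - s) ^ 2 - V) / v) := by ring
  rw [e]
  refine (abs_sub _ _).trans ?_
  rw [abs_mul, abs_mul, abs_of_pos (by positivity : 0 < (s ^ 2 + V) / S ^ 2)]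
  calc _ ≤ 4 * ((L₂ + M) / d ^ 2 + 2 * √M / d) / √n * K
        + 4 * (1 + L₂ / d ^ 2) * (L₁ / d ^ 2 * (M + L₂) / √κ / √n) := by gcongr
    _ = _ := by ring

variable {n : ℕ}

lemma cvStat_eq {e : Fin n → ℝ} (hn : n ≠ 0) (h : ∑ i, e i ^ 2 ≠ 0) :
    cvStat e = n * (∑ i, e i ^ 4) / (∑ i, e i ^ 2) ^ 2 - 1 := by
  have hn0 : (n : ℝ) ≠ 0 := by exact_mod_cast hn
  obtain ⟨S, hS⟩ : ∃ S, S = ∑ i, e i ^ 2 := ⟨_, rfl⟩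
  have h1 : ∑ i, (e i ^ 2 - 1 / (n : ℝ) * S) ^ 2 = ∑ i, e i ^ 4 - S ^ 2 / n := by
    have h2 : ∀ i, (e i ^ 2 - 1 / (n : ℝ) * S) ^ 2
        = e i ^ 4 - 2 / n * S * e i ^ 2 + (S / n) ^ 2 := fun i => by ring
    simp only [h2, Finset.sum_add_distrib, Finset.sum_sub_distrib, ← Finset.mul_sum, ← hS]
    simp
    field_simp
    ring
  rw [← hS] at h
  rw [cvStat, ← hS, h1]
  field_simp

end Linearization

section Statistic

variable {n : ℕ} {μ : Measure ℝ} [IsProbabilityMeasure μ] {A : Matrix (Fin n) (Fin n) ℝ} {C : ℝ}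

lemma abs_meanT1_le (hA : OpBound A C) : |meanT1 μ A| ≤ (3 + |nu4 μ|) * C ^ 2 * n := by
  rw [meanT1_eq_sum]
  refine (Finset.abs_sum_le_sum_abs _ _).trans ?_
  have h : ∀ i, |3 * (A * Aᵀ) i i ^ 2 + nu4 μ * ∑ k, A i k ^ 4| ≤ (3 + |nu4 μ|) * C ^ 2 := by
    intro i
    have h1 : (A * Aᵀ) i i = ∑ k, A i k ^ 2 := by simp [Matrix.mul_apply, sq]
    have h0 : 0 ≤ ∑ k, A i k ^ 2 := Finset.sum_nonneg fun _ _ => sq_nonneg _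
    have h2 : (∑ k, A i k ^ 2) ^ 2 ≤ C ^ 2 := pow_le_pow_left₀ h0 (hA.row_le i) 2
    have h3 : ∑ k, A i k ^ 4 ≤ (∑ k, A i k ^ 2) ^ 2 := by
      have := Finset.sum_sq_le_sq_sum_of_nonneg (s := Finset.univ) (f := fun k => A i k ^ 2)
        fun k _ => sq_nonneg _
      refine le_trans (le_of_eq ?_) this
      exact Finset.sum_congr rfl fun k _ => by ring
    have h4 : 0 ≤ ∑ k, A i k ^ 4 := Finset.sum_nonneg fun _ _ => by positivity
    rw [h1]
    refine (abs_add_le _ _).trans ?_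
    rw [abs_mul (nu4 μ), abs_of_nonneg h4, abs_of_nonneg (by positivity), add_mul]
    gcongr
    exact h3.trans h2
  calc _ ≤ ∑ _i : Fin n, (3 + |nu4 μ|) * C ^ 2 := Finset.sum_le_sum fun i _ => h i
    _ = _ := by simp; ring

lemma variance_powSum_two_le (hsymm : μ.map (fun x => -x) = μ)
    (h8 : Integrable (fun x => |x| ^ 8) μ) (hvar : ∫ x, x ^ 2 ∂μ = 1) (hA : OpBound A C)
    (hC : 1 ≤ C) :
    Var[powSum A 2; Measure.pi fun _ => μ] ≤ (2 + |nu4 μ|) * (4 * C ^ 6) * n := by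
  rw [variance_powSum_two A hsymm h8 hvar]
  have h := sum_weight_le hA hC
  calc _ ≤ ∑ i, ∑ j, (2 + |nu4 μ|) * ((∑ k, A i k ^ 1 * A j k ^ 1) ^ 2
        + (∑ k, A i k ^ 3 * A j k ^ 1) ^ 2 + (∑ k, A i k ^ 1 * A j k ^ 3) ^ 2
        + ∑ k, A i k ^ 2 * A j k ^ 2) := by
        refine Finset.sum_le_sum fun i _ => Finset.sum_le_sum fun j _ => ?_
        rw [mul_transpose_apply_eq_rowSum]
        have h0 : 0 ≤ ∑ k, A i k ^ 2 * A j k ^ 2 := Finset.sum_nonneg fun _ _ => by positivity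
        have h1 := sq_nonneg (∑ k, A i k ^ 3 * A j k ^ 1)
        have h2 := sq_nonneg (∑ k, A i k ^ 1 * A j k ^ 3)
        have h3 := sq_nonneg (∑ k, A i k ^ 1 * A j k ^ 1)
        have h4 := le_abs_self (nu4 μ)
        have h5 := abs_nonneg (nu4 μ)
        unfold rowSum
        nlinarith [mul_le_mul_of_nonneg_right h4 h0, mul_nonneg h5 h1, mul_nonneg h5 h2,
          mul_nonneg h5 h3]
    _ = (2 + |nu4 μ|) * ∑ i, ∑ j, ((∑ k, A i k ^ 1 * A j k ^ 1) ^ 2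
        + (∑ k, A i k ^ 3 * A j k ^ 1) ^ 2 + (∑ k, A i k ^ 1 * A j k ^ 3) ^ 2
        + ∑ k, A i k ^ 2 * A j k ^ 2) := by simp only [Finset.mul_sum]
    _ ≤ (2 + |nu4 μ|) * (4 * C ^ 6 * n) := by gcongr
    _ = _ := by ring

lemma measurable_cvStat : Measurable fun y : Fin n → ℝ => cvStat (A *ᵥ y) := by
  have h : ∀ i, Continuous fun y : Fin n → ℝ => (A *ᵥ y) i := fun i =>
    (continuous_apply i).comp (continuous_const.matrix_mulVec continuous_id)
  have h' : ∀ i, Measurable fun y : Fin n → ℝ => (A *ᵥ y) i := fun i => (h i).measurable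
  unfold cvStat
  fun_prop

/-- The coefficient of the sum of squares in the linearization of the statistic. -/
noncomputable def linCoeff (μ : Measure ℝ) (A : Matrix (Fin n) (Fin n) ℝ) : ℝ :=
  2 * (A * Aᵀ).trace * meanT1 μ A / (n * meanT2 μ A)

lemma mul_meanT2 (hsymm : μ.map (fun x => -x) = μ)
    (h8 : Integrable (fun x => |x| ^ 8) μ) (hvar : ∫ x, x ^ 2 ∂μ = 1) (hn : n ≠ 0) :
    n * meanT2 μ A = (A * Aᵀ).trace ^ 2 + Var[powSum A 2; Measure.pi fun _ => μ] := by
  have hn0 : (n : ℝ) ≠ 0 := by exact_mod_cast hn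
  rw [variance_powSum_two A hsymm h8 hvar, meanT2_eq_sum, mul_inv_cancel_left₀ hn0]

lemma abs_linCoeff_le (hsymm : μ.map (fun x => -x) = μ)
    (h8 : Integrable (fun x => |x| ^ 8) μ) (hvar : ∫ x, x ^ 2 ∂μ = 1) (hA : OpBound A C)
    {d : ℝ} (hd : 0 < d) (hn : n ≠ 0) (htr : d * n ≤ (A * Aᵀ).trace) :
    |linCoeff μ A| ≤ 2 * ((3 + |nu4 μ|) * C ^ 2) / d := by
  have hn0 : (0 : ℝ) < n := by exact_mod_cast Nat.pos_of_ne_zero hn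
  rw [linCoeff, mul_meanT2 hsymm h8 hvar hn]
  have hm := abs_meanT1_le (μ := μ) hA
  obtain ⟨s, hs⟩ : ∃ s, s = (A * Aᵀ).trace := ⟨_, rfl⟩
  have hV := variance_nonneg (powSum A 2) (Measure.pi fun _ => μ)
  rw [← hs] at htr ⊢
  have hs0 : 0 < s := lt_of_lt_of_le (by positivity) htr
  rw [abs_div, abs_mul, abs_of_pos (by positivity : 0 < 2 * s),
    abs_of_pos (by positivity : 0 < s ^ 2 + Var[powSum A 2; Measure.pi fun _ => μ])]
  calc _ ≤ 2 * s * ((3 + |nu4 μ|) * C ^ 2 * n) / s ^ 2 := by gcongr; linarith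
    _ = 2 * ((3 + |nu4 μ|) * C ^ 2) * n / s := by field_simp
    _ ≤ 2 * ((3 + |nu4 μ|) * C ^ 2) * n / (d * n) := by gcongr
    _ = _ := by field_simp

/-- The standardized statistic in terms of the centered linear part. -/
lemma statistic_eq (hsymm : μ.map (fun x => -x) = μ)
    (h8 : Integrable (fun x => |x| ^ 8) μ) (hvar : ∫ x, x ^ 2 ∂μ = 1) (hn : n ≠ 0)
    (hs : 0 < (A * Aᵀ).trace)
    (hW : 0 < Var[quartic A (linCoeff μ A); Measure.pi fun _ => μ]) {y : Fin n → ℝ}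
    (hS : powSum A 2 y ≠ 0) :
    (cvStat (A *ᵥ y) - centering μ A) / √(scaling μ A)
      = ((A * Aᵀ).trace ^ 2 + Var[powSum A 2; Measure.pi fun _ => μ]) / powSum A 2 y ^ 2
        * ((quartic A (linCoeff μ A) y - ∫ z, quartic A (linCoeff μ A) z ∂(Measure.pi fun _ => μ))
            / √Var[quartic A (linCoeff μ A); Measure.pi fun _ => μ]
          - meanT1 μ A / ((A * Aᵀ).trace ^ 2 + Var[powSum A 2; Measure.pi fun _ => μ])
            * ((powSum A 2 y - (A * Aᵀ).trace) ^ 2 - Var[powSum A 2; Measure.pi fun _ => μ])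
            / √Var[quartic A (linCoeff μ A); Measure.pi fun _ => μ]) := by
  have hn0 : (0 : ℝ) < n := by exact_mod_cast Nat.pos_of_ne_zero hn
  have hid := oddTransform_id h8
  have hmean : ∫ z, quartic A (linCoeff μ A) z ∂(Measure.pi fun _ => μ)
      = meanT1 μ A - linCoeff μ A * (A * Aᵀ).trace := by
    simp only [quartic_eq_powSum]
    have i4 : Integrable (fun z => powSum A 4 z) (Measure.pi fun _ => μ) :=
      (memLp_powSum hsymm hid A (p := 4) le_rfl).integrable (by norm_num)
    have i2 : Integrable (fun z => powSum A 2 z) (Measure.pi fun _ => μ) :=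
      (memLp_powSum hsymm hid A (p := 2) (by norm_num)).integrable (by norm_num)
    rw [integral_sub i4 (i2.const_mul _), integral_const_mul, integral_powSum_two A hsymm h8 hvar,
      integral_powSum_four A hsymm h8 hvar]
  have hsc := scaling_eq A hsymm h8 hvar
  change scaling μ A = Var[quartic A (linCoeff μ A); Measure.pi fun _ => μ] / meanT2 μ A ^ 2 at hsc
  have hm2 := mul_meanT2 (A := A) hsymm h8 hvar hn
  have hV := variance_nonneg (powSum A 2) (Measure.pi fun _ => μ)
  have hr : linCoeff μ A = 2 * (A * Aᵀ).trace * meanT1 μ A / (n * meanT2 μ A) := rfl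
  have hcv : cvStat (A *ᵥ y) = n * powSum A 4 y / powSum A 2 y ^ 2 - 1 := cvStat_eq hn hS
  rw [hmean, quartic_eq_powSum, hsc, hcv, centering]
  generalize Var[quartic A (linCoeff μ A); Measure.pi fun _ => μ] = vW at *
  generalize Var[powSum A 2; Measure.pi fun _ => μ] = V at *
  generalize linCoeff μ A = r at *
  generalize powSum A 2 y = S at *
  generalize powSum A 4 y = T at *
  generalize (A * Aᵀ).trace = s at *
  generalize meanT1 μ A = m₁ at *
  have hm20 : 0 < meanT2 μ A := by
    have : 0 < n * meanT2 μ A := by rw [hm2]; positivity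
    exact pos_of_mul_pos_right this hn0.le
  generalize meanT2 μ A = m₂ at *
  have hv0 : 0 < √vW := Real.sqrt_pos.2 hW
  rw [Real.sqrt_div hW.le, Real.sqrt_sq hm20.le, hr]
  generalize √vW = v at *
  have hVe : V = n * m₂ - s ^ 2 := by linarith
  rw [hVe]
  field_simp
  ring

end Statistic

/-! ### Convergence of the characteristic functions -/

section CharFun

variable {μ : Measure ℝ} [IsProbabilityMeasure μ] {C : ℝ}

/-- Away from an event of small probability, the standardized statistic is close to its
linearization. -/
lemma norm_charFun_statistic_sub_le (hsymm : μ.map (fun x => -x) = μ)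
    (h8 : Integrable (fun x => |x| ^ 8) μ) (hvar : ∫ x, x ^ 2 ∂μ = 1) (hC : 1 ≤ C) {d κ : ℝ}
    (hd : 0 < d) (hκ : 0 < κ) {M K : ℝ} (hM : 0 < M) (hK : 0 < K) :
    ∃ D : ℝ, 0 ≤ D ∧ ∀ {n : ℕ} {A : Matrix (Fin n) (Fin n) ℝ}, n ≠ 0 → 4 * M ≤ d ^ 2 * n →
      OpBound A C → d * n ≤ (A * Aᵀ).trace →
      κ * n ≤ Var[quartic A (linCoeff μ A); Measure.pi fun _ => μ] → ∀ t : ℝ,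
      ‖∫ y, Complex.exp (Complex.I * (t * ((cvStat (A *ᵥ y) - centering μ A) / √(scaling μ A)) : ℝ))
          ∂(Measure.pi fun _ => μ)
        - ∫ y, Complex.exp (Complex.I * (t * ((quartic A (linCoeff μ A) y
          - ∫ z, quartic A (linCoeff μ A) z ∂(Measure.pi fun _ => μ))
          / √Var[quartic A (linCoeff μ A); Measure.pi fun _ => μ]) : ℝ))
          ∂(Measure.pi fun _ => μ)‖
        ≤ |t| * (D / √n) + 2 * ((2 + |nu4 μ|) * (4 * C ^ 6) / M + 1 / K ^ 2) := by
  obtain ⟨L₁, hL₁⟩ : ∃ L, L = (3 + |nu4 μ|) * C ^ 2 := ⟨_, rfl⟩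
  obtain ⟨L₂, hL₂⟩ : ∃ L, L = (2 + |nu4 μ|) * (4 * C ^ 6) := ⟨_, rfl⟩
  have hL₁0 : 0 ≤ L₁ := by rw [hL₁]; positivity
  have hL₂0 : 0 ≤ L₂ := by rw [hL₂]; positivity
  refine ⟨4 * ((L₂ + M) / d ^ 2 + 2 * √M / d) * K
    + 4 * (1 + L₂ / d ^ 2) * (L₁ / d ^ 2) * (M + L₂) / √κ, by positivity, ?_⟩
  intro n A hn hnM hA htr hW t
  have hn1 : (1 : ℝ) ≤ n := by exact_mod_cast Nat.one_le_iff_ne_zero.2 hn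
  have hn0 : (0 : ℝ) < n := by linarith
  have hid := oddTransform_id h8
  have hs0 : 0 < (A * Aᵀ).trace := lt_of_lt_of_le (by positivity) htr
  have hW0 : 0 < Var[quartic A (linCoeff μ A); Measure.pi fun _ => μ] :=
    lt_of_lt_of_le (by positivity) hW
  have hV := variance_powSum_two_le hsymm h8 hvar hA hC
  have hV0 := variance_nonneg (powSum A 2) (Measure.pi fun _ => μ)
  have hm := abs_meanT1_le (μ := μ) hA
  rw [← hL₁] at hm
  rw [← hL₂] at hV ⊢
  have hWm : Measurable (quartic A (linCoeff μ A)) := (continuous_quartic A _).measurable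
  have mS : MemLp (fun y => powSum A 2 y) 2 (Measure.pi fun _ => μ) :=
    memLp_powSum hsymm hid A (p := 2) (by norm_num)
  have mW : MemLp (fun y => quartic A (linCoeff μ A) y) 2 (Measure.pi fun _ => μ) :=
    memLp_quartic hsymm hid A _
  have eS : ∫ y, (powSum A 2 y - (A * Aᵀ).trace) ^ 2 ∂(Measure.pi fun _ => μ)
      = Var[powSum A 2; Measure.pi fun _ => μ] := by
    rw [variance_eq_integral mS.aestronglyMeasurable.aemeasurable,
      integral_powSum_two A hsymm h8 hvar]
  have eW : ∫ y, ((quartic A (linCoeff μ A) y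
      - ∫ z, quartic A (linCoeff μ A) z ∂(Measure.pi fun _ => μ))
      / √Var[quartic A (linCoeff μ A); Measure.pi fun _ => μ]) ^ 2 ∂(Measure.pi fun _ => μ)
      = 1 := by
    simp only [div_pow]
    rw [integral_div, ← variance_eq_integral mW.aestronglyMeasurable.aemeasurable,
      Real.sq_sqrt hW0.le, div_self hW0.ne']
  have iS : Integrable (fun y => (powSum A 2 y - (A * Aᵀ).trace) ^ 2)
      (Measure.pi fun _ => μ) := (mS.sub (memLp_const _)).integrable_sq
  have iW : Integrable (fun y => ((quartic A (linCoeff μ A) y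
      - ∫ z, quartic A (linCoeff μ A) z ∂(Measure.pi fun _ => μ))
      / √Var[quartic A (linCoeff μ A); Measure.pi fun _ => μ]) ^ 2) (Measure.pi fun _ => μ) := by
    have h : Integrable (fun y => (quartic A (linCoeff μ A) y
      - ∫ z, quartic A (linCoeff μ A) z ∂(Measure.pi fun _ => μ)) ^ 2)
      (Measure.pi fun _ => μ) := (mW.sub (memLp_const _)).integrable_sq
    simp only [div_pow]
    exact h.div_const _
  have key := norm_integral_exp_sub_le (P := Measure.pi fun _ : Fin n => μ)
    (G := fun y => (cvStat (A *ᵥ y) - centering μ A) / √(scaling μ A))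
    (Z := fun y => (quartic A (linCoeff μ A) y
      - ∫ z, quartic A (linCoeff μ A) z ∂(Measure.pi fun _ => μ))
      / √Var[quartic A (linCoeff μ A); Measure.pi fun _ => μ])
    (U := fun y => (powSum A 2 y - (A * Aᵀ).trace) ^ 2 / (M * n)
      + ((quartic A (linCoeff μ A) y
        - ∫ z, quartic A (linCoeff μ A) z ∂(Measure.pi fun _ => μ))
        / √Var[quartic A (linCoeff μ A); Measure.pi fun _ => μ]) ^ 2 / K ^ 2)
    ((measurable_cvStat.sub_const _).div_const _) ((hWm.sub_const _).div_const _)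
    ((iS.div_const _).add (iW.div_const _)) (fun y => by positivity)
    (δ := (4 * ((L₂ + M) / d ^ 2 + 2 * √M / d) * K
      + 4 * (1 + L₂ / d ^ 2) * (L₁ / d ^ 2) * (M + L₂) / √κ) / √n) (by positivity) ?_ t
  · refine key.trans ?_
    rw [integral_add (iS.div_const _) (iW.div_const _), integral_div, integral_div, eS, eW]
    have h1 : Var[powSum A 2; Measure.pi fun _ => μ] / (M * n) ≤ L₂ / M := by
      calc _ ≤ L₂ * n / (M * n) := by gcongr
        _ = L₂ / M := by field_simp
    gcongr
  · intro y hy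
    have hp1 : 0 ≤ (powSum A 2 y - (A * Aᵀ).trace) ^ 2 / (M * n) := by positivity
    have hp2 : 0 ≤ ((quartic A (linCoeff μ A) y
        - ∫ z, quartic A (linCoeff μ A) z ∂(Measure.pi fun _ => μ))
        / √Var[quartic A (linCoeff μ A); Measure.pi fun _ => μ]) ^ 2 / K ^ 2 := by positivity
    have h1 : (powSum A 2 y - (A * Aᵀ).trace) ^ 2 ≤ M * n := by
      rw [← div_le_one (by positivity)]; linarith
    have h2 : |(quartic A (linCoeff μ A) y
        - ∫ z, quartic A (linCoeff μ A) z ∂(Measure.pi fun _ => μ))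
        / √Var[quartic A (linCoeff μ A); Measure.pi fun _ => μ]| ≤ K := by
      refine abs_le_of_sq_le_sq ?_ hK.le
      rw [← div_le_one (by positivity)]; linarith
    obtain ⟨hS, hle⟩ := abs_remainder_le hd hκ hn1 htr hV0 hV hL₁0 hL₂0 hM.le hm
      (Real.sqrt_le_sqrt hW) h1 h2 hnM
    rw [statistic_eq hsymm h8 hvar hn hs0 hW0 hS]
    exact hle

/-- The characteristic function of the standardized statistic converges to that of the standard
normal law, uniformly over the matrices with bounded operator norm for which the trace and the
variance of the linearization have at least the order of the sample size. -/
theorem exists_forall_norm_charFun_statistic_sub_le (hsymm : μ.map (fun x => -x) = μ)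
    (h8 : Integrable (fun x => |x| ^ 8) μ) (hvar : ∫ x, x ^ 2 ∂μ = 1) (hC : 1 ≤ C) {d κ : ℝ}
    (hd : 0 < d) (hκ : 0 < κ) (t : ℝ) {ε : ℝ} (hε : 0 < ε) :
    ∃ N : ℕ, ∀ {n : ℕ} {A : Matrix (Fin n) (Fin n) ℝ}, N ≤ n → n ≠ 0 →
      OpBound A C → d * n ≤ (A * Aᵀ).trace →
      κ * n ≤ Var[quartic A (linCoeff μ A); Measure.pi fun _ => μ] →
      ‖∫ y, Complex.exp (Complex.I * (t * ((cvStat (A *ᵥ y) - centering μ A) / √(scaling μ A)) : ℝ))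
          ∂(Measure.pi fun _ => μ) - Real.exp (-(t ^ 2 / 2))‖ ≤ ε := by
  obtain ⟨L, hL⟩ : ∃ L, L = (2 + |nu4 μ|) * (4 * C ^ 6) := ⟨_, rfl⟩
  have hL0 : 0 < L := by rw [hL]; positivity
  -- by Chebyshev, the exceptional event contributes at most `ε / 2`
  have hM : 0 < 8 * L / ε := by positivity
  have hK : 0 < √(8 / ε) := Real.sqrt_pos.2 (by positivity)
  obtain ⟨D, hD0, hD⟩ := norm_charFun_statistic_sub_le hsymm h8 hvar hC hd hκ hM hK
  obtain ⟨N₁, hN₁⟩ := exists_forall_norm_charFun_quartic_sub_le hsymm h8 hC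
    (ρ := 2 * ((3 + |nu4 μ|) * C ^ 2) / d) (by positivity)
    (K := |t| / √κ) (by positivity) (ε := ε / 4) (by positivity)
  have hlim : Tendsto (fun n : ℕ => |t| * (D / √n)) atTop (𝓝 0) := by
    have h := (Real.tendsto_sqrt_atTop.comp tendsto_natCast_atTop_atTop).const_div_atTop D
    simpa using h.const_mul |t|
  obtain ⟨N₂, hN₂⟩ := eventually_atTop.1 (hlim.eventually (gt_mem_nhds (by positivity : 0 < ε / 4)))
  obtain ⟨N₃, hN₃⟩ := eventually_atTop.1
    ((tendsto_natCast_atTop_atTop.const_mul_atTop (by positivity : 0 < d ^ 2)).eventually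
      (eventually_ge_atTop (4 * (8 * L / ε))))
  refine ⟨max N₁ (max N₂ N₃), ?_⟩
  intro n A hN hn hA htr hW
  simp only [max_le_iff] at hN
  have hn0 : (0 : ℝ) < n := by exact_mod_cast Nat.pos_of_ne_zero hn
  have h1 := hD hn (hN₃ n hN.2.2) hA htr hW t
  have h2 := (hN₂ n hN.2.1).le
  have hW0 : 0 < Var[quartic A (linCoeff μ A); Measure.pi fun _ => μ] :=
    lt_of_lt_of_le (by positivity) hW
  have hv0 := Real.sqrt_pos.2 hW0
  have h3 := hN₁ hN.1 (Nat.pos_of_ne_zero hn) hA (abs_linCoeff_le hsymm h8 hvar hA hd hn htr)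
    (t * (√n / √Var[quartic A (linCoeff μ A); Measure.pi fun _ => μ])) (by
      rw [abs_mul, abs_of_nonneg (by positivity :
        0 ≤ √n / √Var[quartic A (linCoeff μ A); Measure.pi fun _ => μ]), div_eq_mul_inv |t|]
      gcongr
      rw [div_le_iff₀ hv0, ← div_le_iff₀' (by positivity), div_inv_eq_mul, mul_comm,
        ← Real.sqrt_mul hκ.le]
      exact Real.sqrt_le_sqrt hW)
  have e1 : ∀ y, t * (√n / √Var[quartic A (linCoeff μ A); Measure.pi fun _ => μ])
      * ((quartic A (linCoeff μ A) y
        - ∫ z, quartic A (linCoeff μ A) z ∂(Measure.pi fun _ => μ)) / √n)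
      = t * ((quartic A (linCoeff μ A) y
        - ∫ z, quartic A (linCoeff μ A) z ∂(Measure.pi fun _ => μ))
        / √Var[quartic A (linCoeff μ A); Measure.pi fun _ => μ]) := by
    intro y
    have := (Real.sqrt_pos.2 hn0).ne'
    field_simp
  have e2 : Var[quartic A (linCoeff μ A); Measure.pi fun _ => μ] / n
      * (t * (√n / √Var[quartic A (linCoeff μ A); Measure.pi fun _ => μ])) ^ 2 / 2
      = t ^ 2 / 2 := by
    rw [mul_pow, div_pow, Real.sq_sqrt hn0.le, Real.sq_sqrt hW0.le]
    field_simp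
  simp only [e1] at h3
  rw [e2] at h3
  have h4 : 2 * ((2 + |nu4 μ|) * (4 * C ^ 6) / (8 * L / ε) + 1 / √(8 / ε) ^ 2) = ε / 2 := by
    rw [← hL, Real.sq_sqrt (by positivity)]
    field_simp
    ring
  rw [h4] at h1
  refine (norm_sub_le_norm_sub_add_norm_sub _ _ _).trans ((add_le_add h1 h3).trans ?_)
  linarith

end CharFun

/-! ### Convergence in distribution -/

/-- The variance of the linearization has at least the order of the sample size. -/
lemma exists_eventually_le_variance {μ : Measure ℝ} [IsProbabilityMeasure μ]
    (hsymm : μ.map (fun x => -x) = μ) (h8 : Integrable (fun x => |x| ^ 8) μ)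
    (hvar : ∫ x, x ^ 2 ∂μ = 1) {p : ℕ → ℕ} {X : ∀ n, Matrix (Fin n) (Fin (p n)) ℝ}
    (hX : ∀ n, IsUnit ((X n)ᵀ * X n).det) {σ : ∀ n, Fin n → ℝ} (hσ0 : ∀ n i, 0 ≤ σ n i)
    {c : ℝ} (hc : 0 < c) (hσ : ∀ n i, σ n i ≤ c) {d : ℝ} (hd : 0 < d)
    (htr : ∀ᶠ n : ℕ in atTop, d * n ≤ (scaledProj (X n) (σ n) * (scaledProj (X n) (σ n))ᵀ).trace)
    (hnd : (∀ u v : ℝ, ¬ ∀ᵐ x ∂μ, |x| = u ∨ |x| = v) ∨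
      ∃ c : ℝ, 0 < c ∧ ∀ᶠ n : ℕ in atTop, c ≤ n * scaling μ (scaledProj (X n) (σ n))) :
    ∃ κ : ℝ, 0 < κ ∧ ∀ᶠ n : ℕ in atTop, κ * n ≤ Var[quartic (scaledProj (X n) (σ n))
      (linCoeff μ (scaledProj (X n) (σ n))); Measure.pi fun _ => μ] := by
  rcases hnd with hnd | ⟨c₀, hc₀, hb⟩
  · obtain ⟨q, hq, hle⟩ := exists_le_variance_quartic hsymm h8 hvar hnd
    refine ⟨q * (d / c) ^ 8, by positivity, ?_⟩
    filter_upwards [htr, eventually_gt_atTop 0] with n h1 hn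
    refine le_trans ?_ (hle _ _)
    rw [mul_assoc]
    gcongr
    exact le_sum_sq_sum_pow_four (hX n) (hσ0 n) hc (hσ n) hd.le hn h1
  · refine ⟨c₀ * d ^ 4, by positivity, ?_⟩
    filter_upwards [htr, hb, eventually_gt_atTop 0] with n h1 h2 hn
    have hn0 : (0 : ℝ) < n := by exact_mod_cast hn
    have hsc := scaling_eq (scaledProj (X n) (σ n)) hsymm h8 hvar
    have hm := mul_meanT2 (A := scaledProj (X n) (σ n)) hsymm h8 hvar hn.ne'
    have hV := variance_nonneg (powSum (scaledProj (X n) (σ n)) 2) (Measure.pi fun _ => μ)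
    change scaling μ (scaledProj (X n) (σ n)) = Var[quartic (scaledProj (X n) (σ n))
      (linCoeff μ (scaledProj (X n) (σ n))); Measure.pi fun _ => μ]
        / meanT2 μ (scaledProj (X n) (σ n)) ^ 2 at hsc
    rw [hsc] at h2
    have h3 : d ^ 2 * n ≤ meanT2 μ (scaledProj (X n) (σ n)) := by
      have h4 : (d * n) ^ 2 ≤ (scaledProj (X n) (σ n) * (scaledProj (X n) (σ n))ᵀ).trace ^ 2 :=
        pow_le_pow_left₀ (by positivity) h1 2
      refine le_of_mul_le_mul_left ?_ hn0
      rw [hm]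
      nlinarith
    have hm0 : 0 < meanT2 μ (scaledProj (X n) (σ n)) := lt_of_lt_of_le (by positivity) h3
    rw [← mul_div_assoc, le_div_iff₀ (by positivity)] at h2
    refine le_of_mul_le_mul_left ?_ hn0
    refine le_trans ?_ h2
    calc n * (c₀ * d ^ 4 * n) = c₀ * (d ^ 2 * n) ^ 2 := by ring
      _ ≤ _ := by gcongr

end Homoscedasticity

theorem theorem1
    {Ω : ℕ → Type*} [∀ n, MeasurableSpace (Ω n)]
    (Pr : ∀ n, Measure (Ω n)) [∀ n, IsProbabilityMeasure (Pr n)]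
    -- the law of the standardized errors
    (μ : Measure ℝ) [IsProbabilityMeasure μ]
    (hsymm : μ.map (fun x => -x) = μ)
    (hvar : ∫ x, x ^ 2 ∂μ = 1)
    (hmom : Integrable (fun x => |x| ^ 8) μ)
    -- the standardized errors: for every sample size i.i.d. with law `μ`
    (ξ : ∀ n, Fin n → Ω n → ℝ)
    (hlaw : ∀ n i, HasLaw (ξ n i) μ (Pr n))
    (hindep : ∀ n, iIndepFun (ξ n) (Pr n))
    -- the design and the dimension
    (p : ℕ → ℕ) (y : ℝ) (hy0 : 0 ≤ y) (hy1 : y < 1)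
    (hpn : Tendsto (fun n : ℕ => (p n : ℝ) / (n : ℝ)) atTop (𝓝 y))
    (X : ∀ n, Matrix (Fin n) (Fin (p n)) ℝ)
    (hX : ∀ n, IsUnit ((X n)ᵀ * X n).det)
    (β : ∀ n, Fin (p n) → ℝ)
    -- the standard deviations: no homoscedasticity
    (σ : ∀ n, Fin n → ℝ) (hσ0 : ∀ n i, 0 ≤ σ n i)
    (hσ : ∃ C : ℝ, ∀ n i, σ n i ≤ C)
    (htr : ∃ c : ℝ, 0 < c ∧ ∀ᶠ n : ℕ in atTop,
      c * n ≤ (Homoscedasticity.scaledProj (X n) (σ n)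
        * (Homoscedasticity.scaledProj (X n) (σ n))ᵀ).trace)
    -- nondegeneracy
    (hnd : (∀ u v : ℝ, ¬ ∀ᵐ x ∂μ, |x| = u ∨ |x| = v) ∨
      ∃ c : ℝ, 0 < c ∧ ∀ᶠ n : ℕ in atTop,
        c ≤ n * Homoscedasticity.scaling μ (Homoscedasticity.scaledProj (X n) (σ n))) :
    TendstoInDistribution
      (fun n ω =>
        (Homoscedasticity.cvStat (Homoscedasticity.residual (X n)
            (Homoscedasticity.response (X n) (β n) (fun i => σ n i * ξ n i ω)))
          - Homoscedasticity.centering μ (Homoscedasticity.scaledProj (X n) (σ n)))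
        / √(Homoscedasticity.scaling μ (Homoscedasticity.scaledProj (X n) (σ n))))
      atTop (id : ℝ → ℝ) Pr (gaussianReal 0 1) ∧
    ∀ (n : ℕ) (s : ℝ), 0 < s → (∀ i, σ n i = s) →
      Homoscedasticity.centering μ (Homoscedasticity.scaledProj (X n) (σ n))
          = Homoscedasticity.centeringH0 μ (p n) (Homoscedasticity.projMat (X n)) ∧
      Homoscedasticity.scaling μ (Homoscedasticity.scaledProj (X n) (σ n))
          = Homoscedasticity.scalingH0 μ (p n) (Homoscedasticity.projMat (X n)) := by
  refine ⟨?_, fun n s hs hσs => ⟨Homoscedasticity.centering_eq_centeringH0 (hX n) hs hσs,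
    Homoscedasticity.scaling_eq_scalingH0 (hX n) hs hσs⟩⟩
  obtain ⟨c', hc'⟩ := hσ
  obtain ⟨c, hc, hσc⟩ : ∃ c : ℝ, 1 ≤ c ∧ ∀ n i, σ n i ≤ c :=
    ⟨max 1 c', le_max_left _ _, fun n i => (hc' n i).trans (le_max_right _ _)⟩
  obtain ⟨d, hd, htr⟩ := htr
  obtain ⟨κ, hκ, hW⟩ := Homoscedasticity.exists_eventually_le_variance hsymm hmom hvar hX hσ0
    (by linarith) hσc hd htr hnd
  have hl : ∀ n, HasLaw (fun ω i => ξ n i ω) (Measure.pi fun _ => μ) (Pr n) := fun n =>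
    (hindep n).hasLaw_pi (hlaw n)
  simp only [fun n ω => Homoscedasticity.residual_response (hX n) (β n) (σ n) fun i => ξ n i ω]
  have hmeas : ∀ n, Measurable fun z : Fin n → ℝ =>
      (Homoscedasticity.cvStat (Homoscedasticity.scaledProj (X n) (σ n) *ᵥ z)
        - Homoscedasticity.centering μ (Homoscedasticity.scaledProj (X n) (σ n)))
        / √(Homoscedasticity.scaling μ (Homoscedasticity.scaledProj (X n) (σ n))) := fun n =>
    (Homoscedasticity.measurable_cvStat.sub_const _).div_const _
  have hae : ∀ n, AEMeasurable (fun ω =>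
      (Homoscedasticity.cvStat (Homoscedasticity.scaledProj (X n) (σ n) *ᵥ fun i => ξ n i ω)
        - Homoscedasticity.centering μ (Homoscedasticity.scaledProj (X n) (σ n)))
        / √(Homoscedasticity.scaling μ (Homoscedasticity.scaledProj (X n) (σ n)))) (Pr n) :=
    fun n => (hmeas n).comp_aemeasurable (hl n).aemeasurable
  refine ⟨hae, aemeasurable_id, ?_⟩
  refine ProbabilityMeasure.tendsto_of_tendsto_charFun fun t => ?_
  have h0 : charFun (Measure.map id (gaussianReal 0 1)) t = (Real.exp (-(t ^ 2 / 2)) : ℝ) := by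
    rw [Measure.map_id, charFun_gaussianReal]
    push_cast
    congr 1
    simp
  have hcf : ∀ n, charFun (Measure.map (fun ω =>
      (Homoscedasticity.cvStat (Homoscedasticity.scaledProj (X n) (σ n) *ᵥ fun i => ξ n i ω)
        - Homoscedasticity.centering μ (Homoscedasticity.scaledProj (X n) (σ n)))
        / √(Homoscedasticity.scaling μ (Homoscedasticity.scaledProj (X n) (σ n)))) (Pr n)) t
      = ∫ z, Complex.exp (Complex.I * (t * ((Homoscedasticity.cvStat
          (Homoscedasticity.scaledProj (X n) (σ n) *ᵥ z)
        - Homoscedasticity.centering μ (Homoscedasticity.scaledProj (X n) (σ n)))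
        / √(Homoscedasticity.scaling μ (Homoscedasticity.scaledProj (X n) (σ n)))) : ℝ))
        ∂(Measure.pi fun _ => μ) := by
    intro n
    have hm := (hmeas n)
    rw [charFun_apply_real, integral_map (hae n) (by fun_prop), ← (hl n).map_eq,
      integral_map (hl n).aemeasurable
        (by fun_prop : Measurable _).aestronglyMeasurable]
    refine integral_congr_ae (ae_of_all _ fun ω => ?_)
    simp only
    congr 1
    push_cast
    ring
  change Tendsto (fun n => charFun (Measure.map _ (Pr n)) t) atTop
    (𝓝 (charFun (Measure.map id (gaussianReal 0 1)) t))
  rw [h0]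
  simp only [hcf]
  rw [Metric.tendsto_nhds]
  intro ε hε
  obtain ⟨N, hN⟩ := Homoscedasticity.exists_forall_norm_charFun_statistic_sub_le hsymm hmom hvar
    (C := c ^ 2) (one_le_pow₀ hc) hd hκ t (half_pos hε)
  filter_upwards [htr, hW, eventually_ge_atTop N, eventually_gt_atTop 0] with n h1 h2 h3 h4
  rw [dist_eq_norm]
  exact (hN h3 h4.ne' (Homoscedasticity.opBound_scaledProj (hX n) (hσ0 n) (hσc n)) h1 h2).trans_lt
    (half_lt_self hε)
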